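/- Let $\mathbb F$ be an algebraically closed field with $\operatorname{char}\mathbb F\neq 2$, let $G$ be an abelian group and put $G^\#=G\times\mathbb Z_2$, so that a $G$-graded superspace (superalgebra) is the same as a $G^\#$-graded vector space (algebra). The $\mathbb Z_2$-component of $g\in G^\#$, or of the $G^\#$-degree of a homogeneous element, is denoted $|\cdot|$. A triple $(\mathcal D,\mathcal U,B)$ consists of: a finite-dimensional graded-division superalgebra $\mathcal D$ over $\mathbb F$ (nonzero, unital, every nonzero $G^\#$-homogeneous element is invertible); a nonzero graded right $\mathcal D$-module $\mathcal U$ of finite rank; and a nondegenerate $\mathbb F$-bilinear map $B:\mathcal U\times\mathcal U\to\mathcal D$, homogeneous of some degree $g_0\in G^\#$, which is sesquilinear for some degree-preserving super-anti-automorphism $\varphi_0$ of $\mathcal D$, i.e. $B(u,vd)=B(u,v)d$ and $B(ud,v)=(-1)^{(|B|+|u|)|d|}\varphi_0(d)B(u,v)$, and such that $\overline B=\delta B$ for some $\delta\in\{\pm1\}$, where $\overline B(u,v)=(-1)^{|u||v|}\varphi_0^{-1}(B(v,u))$. Here signs refer to homogeneous elements. Let $E(\mathcal D,\mathcal U,B)$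 be the graded superalgebra $\operatorname{End}_{\mathcal D}(\mathcal U)$ with the superadjunction $\varphi$ with respect to $B$, i.e. the unique super-anti-automorphism with $B(ru,v)=(-1)^{|r||u|}B(u,\varphi(r)v)$. The parameters $(T,\tilde\beta,\eta,\kappa,g_0,\delta)$ of $(\mathcal D,\mathcal U,B)$ are: the support $T=\operatorname{supp}\mathcal D\le G^\#$; the skew-symmetric bicharacter $\tilde\beta:T\times T\to\mathbb F^\times$ with $X_tX_s=(-1)^{|t||s|}\tilde\beta(t,s)X_sX_t$ for all $X_t\in\mathcal D_t$, $X_s\in\mathcal D_s$; the map $\eta:T\to\{\pm1\}$ with $\varphi_0(X_t)=\eta(t)X_t$; the map $\kappa:G^\#/T\to\mathbb Z_{\ge0}$, $\kappa(x)=\dim_{\mathcal D}\mathcal U_x$, where $\mathcal U_x=\bigoplus_{g\in x}\mathcal U_g$; $g_0=\deg B$; and $\delta$ as above. For a subgroup $T\le G^\#$ and a skew-symmetric bicharacter $\tilde\beta$ on $T$ with $\tilde\beta(t,t)=(-1)^{|t|}$ for all $t\in T$, let $\mathbf I(T,\tilde\beta)$ be the set of admissible quadruples $(\eta,\kappa,g_0,\delta)$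 with $\eta:T\to\{\pm1\}$, $\kappa:G^\#/T\to\mathbb Z_{\ge0}$, $g_0\in G^\#$, $\delta\in\{\pm1\}$, that is, those such that: (1) $\eta(ab)\eta(a)^{-1}\eta(b)^{-1}=\tilde\beta(a,b)$ for all $a,b\in T$; (2) $\kappa$ has finite support; (3) $\kappa(x)=\kappa(g_0^{-1}x^{-1})$ for all $x$; (4) if $g\in G^\#$ satisfies $g_0g^2\in T$ and $(-1)^{|g|}\eta(g_0g^2)\delta=-1$, then $\kappa(gT)$ is even. The group $T\times G^\#$ acts on $\mathbf I(T,\tilde\beta)$ by $$t\cdot(\eta,\kappa,g_0,\delta)=\bigl(\tilde\beta(t,\cdot)\eta,\ \kappa,\ tg_0,\ (-1)^{|t|}\eta(t)\delta\bigr),\qquad g\cdot(\eta,\kappa,g_0,\delta)=\bigl(\eta,\ g\cdot\kappa,\ g_0g^{-2},\ (-1)^{|g|}\delta\bigr),$$ for $t\in T$, $g\in G^\#$, where $(g\cdot\kappa)(x)=\kappa(g^{-1}x)$. Theorem. For every triple $(\mathcal D,\mathcal U,B)$ as above, the superadjunction exists and is unique, and the parameters exist, are unique, and satisfy $(\eta,\kappa,g_0,\delta)\in\mathbf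 I(T,\tilde\beta)$. If $(\mathcal D,\mathcal U,B)$ and $(\mathcal D',\mathcal U',B')$ are two triples, with parameters $(T,\tilde\beta,\eta,\kappa,g_0,\delta)$ and $(T',\tilde\beta',\eta',\kappa',g_0',\delta')$, then $E(\mathcal D,\mathcal U,B)\cong E(\mathcal D',\mathcal U',B')$, as graded superalgebras with super-anti-automorphism, if and only if $T=T'$, $\tilde\beta=\tilde\beta'$, and $(\eta,\kappa,g_0,\delta)$ and $(\eta',\kappa',g_0',\delta')$ lie in the same $T\times G^\#$-orbit in $\mathbf I(T,\tilde\beta)$. -/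

import Mathlib

/-!
Throughout, `G` is an abelian group, written additively, and `G × ZMod 2` plays the role of
`G^#`: a `G`-graded superspace (superalgebra) is the same as a `G × ZMod 2`-graded vector space
(algebra), the second component of the degree being the parity.
-/

namespace GrSuper

/-- The sign `(-1)^i`, for a parity `i`, as a unit of the field `F`. -/
def sgn (F : Type*) [Field F] (i : ZMod 2) : Fˣ := (-1) ^ i.val

theorem sgn_add (F : Type*) [Field F] (i j : ZMod 2) : sgn F (i + j) = sgn F i * sgn F j := by
  revert i j
  have h : ∀ i : ZMod 2, i = 0 ∨ i = 1 := by decide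
  intro i j
  rcases h i with rfl | rfl <;> rcases h j with rfl | rfl <;>
    simp [sgn, ZMod.val_one, CharTwo.add_self_eq_zero]

theorem sgn_mul_self (F : Type*) [Field F] (i : ZMod 2) : sgn F i * sgn F i = 1 := by
  rw [← sgn_add, CharTwo.add_self_eq_zero]; simp [sgn]

theorem sgn_eq (F : Type*) [Field F] (i : ZMod 2) : sgn F i = 1 ∨ sgn F i = -1 :=
  neg_one_pow_eq_or _ _

section Objects

variable {F : Type*} [Field F] {G : Type*} [AddCommGroup G]
variable {A : Type*} [Ring A] [Algebra F A]
variable {D : Type*} [Ring D] [Algebra F D]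
variable {U : Type*} [AddCommGroup U] [Module F U] [Module Dᵐᵒᵖ U] [IsScalarTower F Dᵐᵒᵖ U]

/-- Every nonzero `G^#`-homogeneous element of the (nonzero, unital) algebra `D` is invertible. -/
def IsGradedDivision (𝒟 : G × ZMod 2 → Submodule F D) : Prop :=
  Nontrivial D ∧ ∀ g, ∀ x ∈ 𝒟 g, x ≠ 0 → IsUnit x

/-- Compatibility of the gradings with the right action: `U_g D_h ⊆ U_{g+h}`.
The right action of `d` on `u` is `MulOpposite.op d • u`. -/
def IsGradedRightModule (𝒟 : G × ZMod 2 → Submodule F D) (𝒰 : G × ZMod 2 → Submodule F U) :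
    Prop :=
  ∀ g h, ∀ u ∈ 𝒰 g, ∀ d ∈ 𝒟 h, MulOpposite.op d • u ∈ 𝒰 (g + h)

/-- A degree-preserving super-anti-automorphism of a graded superalgebra. -/
structure IsSuperAntiAut (𝒜 : G × ZMod 2 → Submodule F A) (φ : A ≃ₗ[F] A) : Prop where
  map_mem : ∀ g, ∀ a ∈ 𝒜 g, φ a ∈ 𝒜 g
  map_mul : ∀ g h, ∀ a ∈ 𝒜 g, ∀ b ∈ 𝒜 h, φ (a * b) = sgn F (g.2 * h.2) • (φ b * φ a)

/-- `B` is a `φ₀`-sesquilinear form on `U`, homogeneous of degree `b ∈ G^#`. -/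
structure IsSesquilinear (𝒟 : G × ZMod 2 → Submodule F D) (𝒰 : G × ZMod 2 → Submodule F U)
    (φ₀ : D ≃ₗ[F] D) (b : G × ZMod 2) (B : U →ₗ[F] U →ₗ[F] D) : Prop where
  homogeneous : ∀ g h, ∀ u ∈ 𝒰 g, ∀ v ∈ 𝒰 h, B u v ∈ 𝒟 (b + g + h)
  smul_right : ∀ u v d, B u (MulOpposite.op d • v) = B u v * d
  smul_left : ∀ g h, ∀ u ∈ 𝒰 g, ∀ d ∈ 𝒟 h, ∀ v,
    B (MulOpposite.op d • u) v = sgn F ((b.2 + g.2) * h.2) • (φ₀ d * B u v)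

/-- The (left) radical of `B` is zero. -/
def IsNondegenerate (B : U →ₗ[F] U →ₗ[F] D) : Prop :=
  ∀ u, (∀ v, B u v = 0) → u = 0

/-- `B̄ = δ B`, where `B̄(u, v) = (-1)^{|u||v|} φ₀⁻¹(B(v, u))` on homogeneous elements. -/
def IsSuperHermitian (𝒰 : G × ZMod 2 → Submodule F U) (φ₀ : D ≃ₗ[F] D) (δ : Fˣ)
    (B : U →ₗ[F] U →ₗ[F] D) : Prop :=
  ∀ g h, ∀ u ∈ 𝒰 g, ∀ v ∈ 𝒰 h, sgn F (g.2 * h.2) • φ₀.symm (B v u) = δ • B u v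

/-- `B` is a nondegenerate sesquilinear form on `U` (with respect to some degree-preserving
super-anti-automorphism `φ₀` of `D`) that is super-Hermitian (`δ = 1`) or super-skew-Hermitian
(`δ = -1`). -/
def IsNondegenerateHermitianForm (𝒟 : G × ZMod 2 → Submodule F D)
    (𝒰 : G × ZMod 2 → Submodule F U) (B : U →ₗ[F] U →ₗ[F] D) : Prop :=
  IsNondegenerate B ∧ ∃ (φ₀ : D ≃ₗ[F] D) (b : G × ZMod 2) (δ : Fˣ),
    IsSuperAntiAut 𝒟 φ₀ ∧ IsSesquilinear 𝒟 𝒰 φ₀ b B ∧ (δ = 1 ∨ δ = -1) ∧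
      IsSuperHermitian 𝒰 φ₀ δ B

/-- The `G^#`-grading of `End_D(U)`: the `D`-linear maps of degree `g`. -/
def endGrading (𝒰 : G × ZMod 2 → Submodule F U) (g : G × ZMod 2) :
    Submodule F (Module.End Dᵐᵒᵖ U) where
  carrier := {r | ∀ h, ∀ u ∈ 𝒰 h, r u ∈ 𝒰 (g + h)}
  add_mem' hr hs h u hu := (𝒰 (g + h)).add_mem (hr h u hu) (hs h u hu)
  zero_mem' h _ _ := (𝒰 (g + h)).zero_mem
  smul_mem' c _ hr h u hu := (𝒰 (g + h)).smul_mem c (hr h u hu)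

/-- `φ` is the superadjunction on `End_D(U)` with respect to `B`: the super-anti-automorphism with
`B(r u, v) = (-1)^{|r||u|} B(u, φ(r) v)`. The graded superalgebra `End_D(U)` together with `φ` is
`E(D, U, B)`. -/
structure IsSuperadjunction (𝒰 : G × ZMod 2 → Submodule F U) (B : U →ₗ[F] U →ₗ[F] D)
    (φ : Module.End Dᵐᵒᵖ U ≃ₗ[F] Module.End Dᵐᵒᵖ U) : Prop where
  antiAut : IsSuperAntiAut (endGrading 𝒰) φ
  adjoint : ∀ g h, ∀ r ∈ endGrading (D := D) 𝒰 g, ∀ u ∈ 𝒰 h, ∀ v,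
    B (r u) v = sgn F (g.2 * h.2) • B u (φ r v)

/-- Isomorphism of graded superalgebras with super-anti-automorphism: an isomorphism of algebras
that preserves degrees (and hence parities) and commutes with the super-anti-automorphisms. -/
def IsomorphicSuper {A' : Type*} [Ring A'] [Algebra F A']
    (𝒜 : G × ZMod 2 → Submodule F A) (φ : A ≃ₗ[F] A)
    (𝒜' : G × ZMod 2 → Submodule F A') (φ' : A' ≃ₗ[F] A') : Prop :=
  ∃ ψ : A ≃ₐ[F] A', (∀ g, ∀ a ∈ 𝒜 g, ψ a ∈ 𝒜' g) ∧ ∀ a, ψ (φ a) = φ' (ψ a)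

/-- The isotypic component `U_x = ⨁_{g ∈ x} U_g` attached to a coset `x ∈ G^#/T`, where `T` is the
support of `D`, as a `D`-submodule (it is spanned by the `U_g` with `g ∈ x`). -/
def isotypic (𝒰 : G × ZMod 2 → Submodule F U) (T : AddSubgroup (G × ZMod 2))
    (x : (G × ZMod 2) ⧸ T) : Submodule Dᵐᵒᵖ U :=
  Submodule.span Dᵐᵒᵖ {u | ∃ g : G × ZMod 2, (QuotientAddGroup.mk g : (G × ZMod 2) ⧸ T) = x ∧
    u ∈ 𝒰 g}

end Objects

/-- A skew-symmetric bicharacter `β̃` on `T ⊆ G^#` compatible with the parity: the bicharacter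
`β(t, s) = (-1)^{|t||s|} β̃(t, s)` is alternating. (Skew-symmetry of `β̃` follows, by expanding
`β̃(t + s, t + s)`.) -/
structure SuperBicharacter (F : Type*) [Field F] {G : Type*} [AddCommGroup G]
    (T : AddSubgroup (G × ZMod 2)) where
  toFun : T → T → Fˣ
  add_left : ∀ s t r, toFun (s + t) r = toFun s r * toFun t r
  add_right : ∀ r s t, toFun r (s + t) = toFun r s * toFun r t
  alternating : ∀ t : T, sgn F (t.1.2 * t.1.2) * toFun t t = 1

/-- The set `I(T, β̃)` of admissible quadruples `(η, κ, g₀, δ)`. -/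
@[ext]
structure Inertia {F : Type*} [Field F] {G : Type*} [AddCommGroup G]
    (T : AddSubgroup (G × ZMod 2)) (β : SuperBicharacter F T) where
  η : T → Fˣ
  κ : (G × ZMod 2) ⧸ T → ℕ
  g₀ : G × ZMod 2
  δ : Fˣ
  η_sign : ∀ t, η t = 1 ∨ η t = -1
  δ_sign : δ = 1 ∨ δ = -1
  coboundary : ∀ a b, η (a + b) * (η a)⁻¹ * (η b)⁻¹ = β.toFun a b
  finite_support : (Function.support κ).Finite
  duality : ∀ x, κ x = κ (-(QuotientAddGroup.mk g₀ : (G × ZMod 2) ⧸ T) - x)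
  parity : ∀ (g : G × ZMod 2) (h : g₀ + 2 • g ∈ T),
    sgn F g.2 * η ⟨g₀ + 2 • g, h⟩ * δ = -1 → Even (κ (QuotientAddGroup.mk g))

section Action

variable {F : Type*} [Field F] {G : Type*} [AddCommGroup G]
  {T : AddSubgroup (G × ZMod 2)} {β : SuperBicharacter F T}

theorem SuperBicharacter.self (β : SuperBicharacter F T) (t : T) :
    β.toFun t t = sgn F t.1.2 := by
  have h := β.alternating t
  have h2 : t.1.2 * t.1.2 = t.1.2 := by
    generalize t.1.2 = i
    revert i; decide
  rw [h2] at h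
  calc β.toFun t t = (sgn F t.1.2 * sgn F t.1.2) * β.toFun t t := by rw [sgn_mul_self, one_mul]
    _ = sgn F t.1.2 := by rw [mul_assoc, h, mul_one]

theorem SuperBicharacter.zero_left (β : SuperBicharacter F T) (s : T) : β.toFun 0 s = 1 := by
  have h := β.add_left 0 0 s
  rw [add_zero] at h
  exact (mul_eq_left.mp h.symm)

theorem pm_mul {a b : Fˣ} (ha : a = 1 ∨ a = -1) (hb : b = 1 ∨ b = -1) :
    a * b = 1 ∨ a * b = -1 := by
  rcases ha with rfl | rfl <;> rcases hb with rfl | rfl <;> simp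

theorem pm_sq {a : Fˣ} (ha : a = 1 ∨ a = -1) : a * a = 1 := by
  rcases ha with rfl | rfl <;> simp

theorem pm_inv {a : Fˣ} (ha : a = 1 ∨ a = -1) : a⁻¹ = a := by
  rcases ha with rfl | rfl <;> simp

namespace Inertia

theorem η_add (q : Inertia T β) (a b : T) : q.η (a + b) = β.toFun a b * q.η a * q.η b := by
  rw [← q.coboundary a b]; simp [mul_comm, mul_left_comm]

theorem β_sign (q : Inertia T β) (a b : T) : β.toFun a b = 1 ∨ β.toFun a b = -1 := by
  rw [← q.coboundary a b, pm_inv (q.η_sign a), pm_inv (q.η_sign b)]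
  exact pm_mul (pm_mul (q.η_sign _) (q.η_sign _)) (q.η_sign _)

/-- `t · (η, κ, g₀, δ) = (β̃(t, ·) η, κ, t g₀, (-1)^{|t|} η(t) δ)`, in additive notation. -/
def actT (t : T) (q : Inertia T β) : Inertia T β where
  η s := β.toFun t s * q.η s
  κ := q.κ
  g₀ := t + q.g₀
  δ := sgn F t.1.2 * q.η t * q.δ
  η_sign s := pm_mul (q.β_sign t s) (q.η_sign s)
  δ_sign := pm_mul (pm_mul (sgn_eq F _) (q.η_sign t)) q.δ_sign
  coboundary a b := by
    rw [← q.coboundary a b, β.add_right, mul_inv, mul_inv]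
    calc _ = (β.toFun t a * (β.toFun t a)⁻¹) * (β.toFun t b * (β.toFun t b)⁻¹) *
        (q.η (a + b) * (q.η a)⁻¹ * (q.η b)⁻¹) := by
          simp only [mul_assoc, mul_comm, mul_left_comm]
      _ = _ := by simp
  finite_support := q.finite_support
  duality x := by
    have h : (QuotientAddGroup.mk ((t : G × ZMod 2) + q.g₀) : (G × ZMod 2) ⧸ T) =
        QuotientAddGroup.mk q.g₀ := by
      rw [QuotientAddGroup.mk_add, (QuotientAddGroup.eq_zero_iff (t : G × ZMod 2)).2 t.2, zero_add]
    rw [h]; exact q.duality x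
  parity g h hμ := by
    have h' : q.g₀ + 2 • g ∈ T := by
      have := T.sub_mem h t.2
      rwa [add_assoc, add_sub_cancel_left] at this
    apply q.parity g h'
    have e : (⟨(t : G × ZMod 2) + q.g₀ + 2 • g, h⟩ : T) = t + ⟨q.g₀ + 2 • g, h'⟩ := by
      ext1; simp [add_assoc]
    rw [e, q.η_add, β.add_right, β.self] at hμ
    rw [← hμ]
    have h1 := pm_sq (q.β_sign t ⟨q.g₀ + 2 • g, h'⟩)
    have h2 := pm_sq (q.η_sign t)
    have h3 := sgn_mul_self F t.1.2
    generalize β.toFun t ⟨q.g₀ + 2 • g, h'⟩ = b at h1 ⊢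
    generalize q.η t = c at h2 ⊢
    generalize sgn F t.1.2 = s at h3 ⊢
    generalize q.η ⟨q.g₀ + 2 • g, h'⟩ = e
    calc _ = (b * b) * (c * c) * (s * s) * (sgn F g.2 * e * q.δ) := by
          rw [h1, h2, h3]; simp
      _ = _ := by simp only [mul_comm, mul_left_comm]

/-- `g · (η, κ, g₀, δ) = (η, g · κ, g₀ g⁻², (-1)^{|g|} δ)` with `(g · κ)(x) = κ(g⁻¹ x)`, in additive
notation. -/
def actG (g : G × ZMod 2) (q : Inertia T β) : Inertia T β where
  η := q.η
  κ x := q.κ (-(QuotientAddGroup.mk g : (G × ZMod 2) ⧸ T) + x)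
  g₀ := q.g₀ - 2 • g
  δ := sgn F g.2 * q.δ
  η_sign := q.η_sign
  δ_sign := pm_mul (sgn_eq F _) q.δ_sign
  coboundary := q.coboundary
  finite_support := by
    have h : Function.support (fun x : (G × ZMod 2) ⧸ T => q.κ (-QuotientAddGroup.mk g + x)) =
        (fun x => -(QuotientAddGroup.mk g : (G × ZMod 2) ⧸ T) + x) ⁻¹' Function.support q.κ := rfl
    rw [h]
    exact q.finite_support.preimage (add_right_injective _).injOn
  duality x := by
    rw [q.duality]
    congr 1
    rw [QuotientAddGroup.mk_sub, QuotientAddGroup.mk_nsmul]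
    abel
  parity k h hμ := by
    have e : q.g₀ - 2 • g + 2 • k = q.g₀ + 2 • (-g + k) := by abel
    have h' : q.g₀ + 2 • (-g + k) ∈ T := e ▸ h
    have h2 := q.parity (-g + k) h'
    rw [QuotientAddGroup.mk_add, QuotientAddGroup.mk_neg] at h2
    apply h2
    rw [← hμ]
    have e2 : (⟨q.g₀ - 2 • g + 2 • k, h⟩ : T) = ⟨q.g₀ + 2 • (-g + k), h'⟩ := Subtype.ext e
    have e3 : (-g + k).2 = g.2 + k.2 := by
      rw [Prod.snd_add, Prod.snd_neg, ZModModule.neg_eq_self]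
    rw [e2, e3, sgn_add]
    simp only [mul_assoc, mul_comm, mul_left_comm]

/-- The action of `T × G^#` on `I(T, β̃)`. -/
instance : AddAction (T × (G × ZMod 2)) (Inertia T β) where
  vadd p q := actT p.1 (actG p.2 q)
  zero_vadd q := by
    change actT 0 (actG 0 q) = q
    ext x <;> simp [actT, actG, β.zero_left, sgn]
    have h := q.η_add 0 0
    rw [β.zero_left, add_zero, one_mul] at h
    rw [mul_eq_left.mp h.symm]
  add_vadd p p' q := by
    change actT (p.1 + p'.1) (actG (p.2 + p'.2) q) = actT p.1 (actG p.2 (actT p'.1 (actG p'.2 q)))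
    apply Inertia.ext
    · funext s
      simp only [actT, actG, β.add_left, mul_assoc]
    · funext x
      simp only [actT, actG, QuotientAddGroup.mk_add]
      congr 1
      abel
    · simp only [actT, actG, AddSubgroup.coe_add]
      abel
    · simp only [actT, actG, AddSubgroup.coe_add, Prod.snd_add, sgn_add, q.η_add]
      have : β.toFun p.1 p'.1 = β.toFun p'.1 p.1 := by
        have h1 := q.η_add p.1 p'.1
        rw [add_comm, q.η_add, mul_assoc, mul_assoc, mul_comm (q.η p'.1)] at h1
        exact (mul_right_cancel h1).symm
      rw [this]
      simp only [mul_assoc, mul_comm, mul_left_comm]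

end Inertia

end Action

/-- Sextuples `(T, β̃, η, κ, g₀, δ)` with `T ⊆ G^#` a subgroup and `(η, κ, g₀, δ) ∈ I(T, β̃)`. -/
structure Parameters (F : Type*) [Field F] (G : Type*) [AddCommGroup G] where
  T : AddSubgroup (G × ZMod 2)
  β : SuperBicharacter F T
  inertia : Inertia T β

/-- `P = (T, β̃, η, κ, g₀, δ)` are the parameters of the triple `(D, U, B)`. -/
structure HasParameters {F : Type*} [Field F] {G : Type*} [AddCommGroup G]
    {D : Type*} [Ring D] [Algebra F D]
    {U : Type*} [AddCommGroup U] [Module F U] [Module Dᵐᵒᵖ U] [IsScalarTower F Dᵐᵒᵖ U]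
    (𝒟 : G × ZMod 2 → Submodule F D) (𝒰 : G × ZMod 2 → Submodule F U)
    (B : U →ₗ[F] U →ₗ[F] D) (P : Parameters F G) : Prop where
  support : ∀ g, g ∈ P.T ↔ 𝒟 g ≠ ⊥
  commutation : ∀ t s : P.T, ∀ x ∈ 𝒟 t, ∀ y ∈ 𝒟 s,
    x * y = (sgn F (t.1.2 * s.1.2) * P.β.toFun t s) • (y * x)
  form : ∃ φ₀ : D ≃ₗ[F] D, IsSuperAntiAut 𝒟 φ₀ ∧
    IsSesquilinear 𝒟 𝒰 φ₀ P.inertia.g₀ B ∧ IsSuperHermitian 𝒰 φ₀ P.inertia.δ B ∧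
    ∀ t : P.T, ∀ x ∈ 𝒟 t, φ₀ x = P.inertia.η t • x
  multiplicity : ∀ x, P.inertia.κ x = Module.finrank Dᵐᵒᵖ (isotypic (D := D) 𝒰 P.T x)

end GrSuper

open GrSuper

/-! Write R for End_D(U). Two principles carry the "only if" half. First, the graded algebra R
determines (D, U) up to a shift of the grading of U. If u and w are homogeneous with B(w,u) = 1,
then e = u B(w,·) is an idempotent of degree zero, x ↦ x B(w,·) identifies U with Re, and D is
recovered as eRe. Hence a graded isomorphism of endomorphism algebras is conjugation by a semilinear
bijection; the degree of the image of u is arbitrary, which leaves a shift s ∈ G^# undetermined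
(`IsHermitianTriple.exists_pairEquiv`). Second, the superadjunction determines B up to left
multiplication by a nonzero homogeneous d ∈ D, as one sees by evaluating the adjoint identity on
rank-one operators (`IsHermitianTriple.exists_twist`). Shifting U and twisting B leave R and its
superadjunction unchanged and act on the parameters exactly as G^# and T act on I(T, β̃)
(`HasParameters.shift`, `HasParameters.twist`). Since parameters are unique
(`HasParameters.unique`), isomorphic data give points of one orbit.

Conversely, after a shift and a twist the parameters coincide, and it remains to see that equal
parameters give isometric triples (`HasParameters.exists_isometry`). The homogeneous components of D
are at most one-dimensional, because F is algebraically closed, so D is determined by T and β̃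
(`IsGradedDivision.exists_algEquiv`), and φ₀ is then determined by η. The module U is free on
F-bases of components U_g, one g for each coset of T, and B pairs such components with values in a
line of D, that is, by scalars. A coset x different from its dual -g₀ - x contributes a perfect
pairing of two spaces, whose only invariant is the dimension. A self-dual coset contributes a
nondegenerate form that is symmetric or alternating according to the sign (-1)^{|g|} η(g₀+2g) δ;
over an algebraically closed field of characteristic not 2 its only invariant is again the
dimension. That alternating forms live in even dimension is the last admissibility condition.

Existence of the superadjunction comes from a homogeneous basis of U and its B-dual family
(`IsHermitianTriple.exists_dual`), which also show that the rank-one operators span R. -/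

set_option linter.unusedSectionVars false

namespace GrSuper

open MulOpposite

/-! ### Classification of perfect pairings, symmetric forms and alternating forms over F. -/

section BilinearForms

variable {F : Type*} [Field F]

/-- Nondegeneracy on both sides makes `p'` identify V' with the dual of W', so θ u is forced to
represent the functional p(u, a⁻¹ ·). This settles pairs of cosets that are dual to each other and
distinct. -/
theorem exists_equiv_of_pairing {V W V' W' : Type*} [AddCommGroup V] [Module F V]
    [AddCommGroup W] [Module F W] [AddCommGroup V'] [Module F V'] [AddCommGroup W'] [Module F W']
    [FiniteDimensional F V] [FiniteDimensional F V'] [FiniteDimensional F W']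
    (p : V →ₗ[F] W →ₗ[F] F) (p' : V' →ₗ[F] W' →ₗ[F] F)
    (hp : ∀ u, (∀ v, p u v = 0) → u = 0)
    (hl : ∀ u, (∀ v, p' u v = 0) → u = 0) (hr : ∀ v, (∀ u, p' u v = 0) → v = 0)
    (hd : Module.finrank F V = Module.finrank F V') (a : W ≃ₗ[F] W') :
    ∃ θ : V ≃ₗ[F] V', ∀ u v, p' (θ u) (a v) = p u v := by
  have hl' : Function.Injective p' := by
    rw [← LinearMap.ker_eq_bot, LinearMap.ker_eq_bot']
    exact fun u h => hl u fun v => by rw [h]; rfl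
  have hr' : Function.Injective p'.flip := by
    rw [← LinearMap.ker_eq_bot, LinearMap.ker_eq_bot']
    exact fun v h => hr v fun u => LinearMap.congr_fun h u
  have h1 := LinearMap.finrank_le_finrank_of_injective hl'
  have h2 := LinearMap.finrank_le_finrank_of_injective hr'
  rw [Subspace.dual_finrank_eq] at h1 h2
  have he : Module.finrank F V' = Module.finrank F (Module.Dual F W') := by
    rw [Subspace.dual_finrank_eq]; omega
  let e : V' ≃ₗ[F] Module.Dual F W' := LinearEquiv.ofInjectiveOfFinrankEq p' hl' he
  let θ : V →ₗ[F] V' := e.symm.toLinearMap ∘ₗ (a.symm.toLinearMap.lcomp F F) ∘ₗ p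
  have hθ : ∀ u v, p' (θ u) (a v) = p u v := by
    intro u v
    have : e (θ u) = (a.symm.toLinearMap.lcomp F F) (p u) := by simp [θ]
    have h3 := LinearMap.congr_fun this (a v)
    simpa using (show p' (θ u) (a v) = _ from h3)
  have hθi : Function.Injective θ := by
    rw [← LinearMap.ker_eq_bot, LinearMap.ker_eq_bot']
    intro u h
    apply hp u
    intro v
    rw [← hθ, h]; simp
  exact ⟨LinearEquiv.ofInjectiveOfFinrankEq θ hθi hd, hθ⟩

theorem associated_toQuadraticMap_of_symm [Invertible (2 : F)] {V : Type*} [AddCommGroup V]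
    [Module F V] (p : V →ₗ[F] V →ₗ[F] F) (hs : ∀ u v, p u v = p v u) :
    QuadraticMap.associated (R := F) (LinearMap.BilinMap.toQuadraticMap p) = p :=
  QuadraticMap.associated_left_inverse (S := F) hs

/-- Both quadratic forms are sums of squares in the same number of variables; polarization, which
divides by 2, turns the equivalence into an isometry of bilinear forms. -/
theorem exists_isometry_of_symm [IsAlgClosed F] (h2 : (2 : F) ≠ 0) {V V' : Type*}
    [AddCommGroup V] [Module F V] [AddCommGroup V'] [Module F V']
    [FiniteDimensional F V] [FiniteDimensional F V']
    (p : V →ₗ[F] V →ₗ[F] F) (p' : V' →ₗ[F] V' →ₗ[F] F)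
    (hs : ∀ u v, p u v = p v u) (hs' : ∀ u v, p' u v = p' v u)
    (hp : ∀ u, (∀ v, p u v = 0) → u = 0) (hp' : ∀ u, (∀ v, p' u v = 0) → u = 0)
    (hd : Module.finrank F V = Module.finrank F V') :
    ∃ θ : V ≃ₗ[F] V', ∀ u v, p' (θ u) (θ v) = p u v := by
  have : Invertible (2 : F) := invertibleOfNonzero h2
  have e1 := QuadraticForm.equivalent_weightedSumSquares_of_isAlgClosed
    (LinearMap.BilinMap.toQuadraticMap p) (by rw [associated_toQuadraticMap_of_symm p hs]; exact hp)
  have e2 := QuadraticForm.equivalent_weightedSumSquares_of_isAlgClosed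
    (LinearMap.BilinMap.toQuadraticMap p')
    (by rw [associated_toQuadraticMap_of_symm p' hs']; exact hp')
  rw [hd] at e1
  obtain ⟨e⟩ := e1.trans e2.symm
  refine ⟨e.toLinearEquiv, fun u v => ?_⟩
  have h (x : V) : p' (e x) (e x) = p x x := by
    exact e.map_app x
  have h3 := h (u + v)
  simp only [map_add, LinearMap.add_apply, h] at h3
  rw [hs' (e v) (e u), hs v u] at h3
  have h4 : (2 : F) * p' (e u) (e v) = 2 * p u v := by linear_combination h3
  exact mul_left_cancel₀ h2 h4

/-- Induction on the dimension: split off a hyperbolic plane spanned by x and y with p(x,y) = 1 and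
continue in its orthogonal complement. Only spanning is recorded here, since independence can be
read off from the values of the form. -/
theorem exists_symplectic_family (n : ℕ) {V : Type*} [AddCommGroup V] [Module F V]
    [FiniteDimensional F V] (p : V →ₗ[F] V →ₗ[F] F) (hs : ∀ u, p u u = 0)
    (hp : ∀ u, (∀ v, p u v = 0) → u = 0) (hn : Module.finrank F V = n) :
    ∃ (m : ℕ) (x y : Fin m → V), (∀ i j, p (x i) (x j) = 0) ∧ (∀ i j, p (y i) (y j) = 0) ∧
      (∀ i j, p (x i) (y j) = if i = j then 1 else 0) ∧
      ⊤ ≤ Submodule.span F (Set.range (Sum.elim x y)) := by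
  induction n using Nat.strong_induction_on generalizing V with
  | _ n ih =>
  have hsk : ∀ u v, p u v = - p v u := fun u v => by
    have h := hs (u + v)
    simp only [map_add, LinearMap.add_apply, hs] at h
    linear_combination h
  rcases subsingleton_or_nontrivial V with hV | hV
  · exact ⟨0, Fin.elim0, Fin.elim0, fun i => i.elim0, fun i => i.elim0, fun i => i.elim0,
      fun v _ => by rw [Subsingleton.elim v 0]; exact Submodule.zero_mem _⟩
  obtain ⟨x, hx⟩ := exists_ne (0 : V)
  obtain ⟨y, hy⟩ : ∃ y, p x y ≠ 0 := by
    by_contra! h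
    exact hx (hp x h)
  obtain ⟨y, hxy⟩ : ∃ y, p x y = 1 := ⟨(p x y)⁻¹ • y, by simp [hy]⟩
  clear hy
  have hyx : p y x = -1 := by rw [hsk, hxy]
  let W : Submodule F V := LinearMap.ker (p x) ⊓ LinearMap.ker (p y)
  have hW : ∀ w ∈ W, p x w = 0 ∧ p y w = 0 := fun w hw => hw
  have hW' : ∀ w ∈ W, p w x = 0 ∧ p w y = 0 := fun w hw => by
    rw [hsk w x, hsk w y, (hW w hw).1, (hW w hw).2]; simp
  -- This is the orthogonal projection along the plane. A vector of W pairs with v as it does with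
  -- this projection, so the restriction of p to W is still nondegenerate.
  have hproj : ∀ v, v - p v y • x + p v x • y ∈ W := by
    intro v
    constructor <;> simp [hs, hxy, hyx, hsk v]
  have hlt : Module.finrank F W < n := by
    rw [← hn]
    apply Submodule.finrank_lt
    intro h
    have : y ∈ W := h ▸ Submodule.mem_top
    exact one_ne_zero (hxy.symm.trans (hW y this).1)
  obtain ⟨m, a, b, haa, hbb, hab, hspan⟩ := ih _ hlt
    ((p.domRestrict₁₂ W W)) (fun u => hs u) (fun u hu => by
      apply Subtype.ext
      apply hp
      intro v
      have := hu ⟨_, hproj v⟩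
      simpa [LinearMap.domRestrict₁₂_apply, (hW' u u.2).1, (hW' u u.2).2] using this) rfl
  simp only [LinearMap.domRestrict₁₂_apply] at haa hbb hab
  refine ⟨m + 1, Fin.cons x fun i => a i, Fin.cons y fun i => b i, ?_, ?_, ?_, ?_⟩
  · intro i j
    refine Fin.cases ?_ (fun i => ?_) i <;> refine Fin.cases ?_ (fun j => ?_) j <;>
      simp [hs, haa, (hW _ (a _).2).1, (hW' _ (a _).2).1]
  · intro i j
    refine Fin.cases ?_ (fun i => ?_) i <;> refine Fin.cases ?_ (fun j => ?_) j <;>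
      simp [hs, hbb, (hW _ (b _).2).2, (hW' _ (b _).2).2]
  · intro i j
    refine Fin.cases ?_ (fun i => ?_) i <;> refine Fin.cases ?_ (fun j => ?_) j <;>
      simp [hxy, hab, (hW _ (b _).2).1, (hW' _ (a _).2).2, (Fin.succ_ne_zero _).symm]
  · intro v _
    set S := Submodule.span F (Set.range (Sum.elim (Fin.cons x fun i => (a i : V) : Fin (m+1) → V)
      (Fin.cons y fun i => (b i : V)))) with hS
    have hxS : x ∈ S := Submodule.subset_span ⟨Sum.inl 0, rfl⟩
    have hyS : y ∈ S := Submodule.subset_span ⟨Sum.inr 0, rfl⟩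
    have hWS : W ≤ S := by
      intro w hw
      have h1 : (⟨w, hw⟩ : W) ∈ Submodule.span F (Set.range (Sum.elim a b)) := hspan trivial
      have h2 : w ∈ (Submodule.span F (Set.range (Sum.elim a b))).map W.subtype := ⟨_, h1, rfl⟩
      rw [Submodule.map_span] at h2
      refine Submodule.span_mono ?_ h2
      rintro _ ⟨_, ⟨i | i, rfl⟩, rfl⟩
      · exact ⟨Sum.inl i.succ, rfl⟩
      · exact ⟨Sum.inr i.succ, rfl⟩
    have h3 : v = (v - p v y • x + p v x • y) + p v y • x - p v x • y := by abel
    rw [h3]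
    exact S.sub_mem (S.add_mem (hWS (hproj v)) (S.smul_mem _ hxS)) (S.smul_mem _ hyS)

theorem exists_symplectic_basis {V : Type*} [AddCommGroup V] [Module F V]
    [FiniteDimensional F V] (p : V →ₗ[F] V →ₗ[F] F) (hs : ∀ u, p u u = 0)
    (hp : ∀ u, (∀ v, p u v = 0) → u = 0) :
    ∃ (m : ℕ) (e : Module.Basis (Fin m ⊕ Fin m) F V), ∀ i j, p (e i) (e j) =
      Sum.elim (fun i => Sum.elim (fun _ => (0 : F)) (fun j => if i = j then 1 else 0) j)
        (fun i => Sum.elim (fun j => if i = j then (-1 : F) else 0) (fun _ => 0) j) i := by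
  obtain ⟨m, x, y, hxx, hyy, hxy, hspan⟩ := exists_symplectic_family _ p hs hp rfl
  have hsk : ∀ u v, p u v = - p v u := fun u v => by
    have h := hs (u + v)
    simp only [map_add, LinearMap.add_apply, hs] at h
    linear_combination h
  have hyx : ∀ i j, p (y i) (x j) = if i = j then (-1 : F) else 0 := fun i j => by
    rw [hsk, hxy]; by_cases h : i = j
    · simp [h]
    · simp [h, Ne.symm h]
  have hli : LinearIndependent F (Sum.elim x y) := by
    rw [Fintype.linearIndependent_iff]
    intro g hg
    have h1 : ∀ j, g (Sum.inl j) = 0 := fun j => by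
      have := congrArg (fun v => p v (y j)) hg
      simpa [hxy, hyy] using this
    have h2 : ∀ j, g (Sum.inr j) = 0 := fun j => by
      have := congrArg (fun v => p v (x j)) hg
      simpa [hyx, hxx] using this
    rintro (j | j)
    · exact h1 j
    · exact h2 j
  refine ⟨m, Module.Basis.mk hli hspan, ?_⟩
  rintro (i | i) (j | j) <;> simp [hxx, hyy, hxy, hyx]

theorem even_finrank_of_alternating {V : Type*} [AddCommGroup V] [Module F V]
    [FiniteDimensional F V] (p : V →ₗ[F] V →ₗ[F] F) (hs : ∀ u, p u u = 0)
    (hp : ∀ u, (∀ v, p u v = 0) → u = 0) : Even (Module.finrank F V) := by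
  obtain ⟨m, e, -⟩ := exists_symplectic_basis p hs hp
  exact ⟨m, by rw [Module.finrank_eq_card_basis e]; simp⟩

/-- Symplectic bases of the two spaces have the same Gram matrix, so matching them is an isometry.
-/
theorem exists_isometry_of_alternating {V V' : Type*}
    [AddCommGroup V] [Module F V] [AddCommGroup V'] [Module F V']
    [FiniteDimensional F V] [FiniteDimensional F V']
    (p : V →ₗ[F] V →ₗ[F] F) (p' : V' →ₗ[F] V' →ₗ[F] F)
    (hs : ∀ u, p u u = 0) (hs' : ∀ u, p' u u = 0)
    (hp : ∀ u, (∀ v, p u v = 0) → u = 0) (hp' : ∀ u, (∀ v, p' u v = 0) → u = 0)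
    (hd : Module.finrank F V = Module.finrank F V') :
    ∃ θ : V ≃ₗ[F] V', ∀ u v, p' (θ u) (θ v) = p u v := by
  obtain ⟨m, e, he⟩ := exists_symplectic_basis p hs hp
  obtain ⟨m', e', he'⟩ := exists_symplectic_basis p' hs' hp'
  have hm : m = m' := by
    rw [Module.finrank_eq_card_basis e, Module.finrank_eq_card_basis e'] at hd
    simp at hd
    omega
  subst hm
  refine ⟨e.equiv e' (Equiv.refl _), fun u v => ?_⟩
  have : p'.compl₁₂ (e.equiv e' (Equiv.refl _)).toLinearMap
      (e.equiv e' (Equiv.refl _)).toLinearMap = p := by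
    refine e.ext fun i => e.ext fun j => ?_
    simp [he, he']
  rw [← this]; rfl

end BilinearForms

/-! ### Projections onto the components of a graded vector space. -/

section Components

variable {F : Type*} [Field F] {Γ : Type*} [DecidableEq Γ]
variable {U : Type*} [AddCommGroup U] [Module F U]
variable {W : Type*} [AddCommGroup W] [Module F W]

/-- The projection of a graded vector space onto its component of degree `g`. -/
def homComponent (𝒰 : Γ → Submodule F U) [DirectSum.Decomposition 𝒰] (g : Γ) : U →ₗ[F] U :=
  (𝒰 g).subtype ∘ₗ DirectSum.component F Γ (fun i => 𝒰 i) g ∘ₗ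
    (DirectSum.decomposeLinearEquiv 𝒰).toLinearMap

variable (𝒰 : Γ → Submodule F U) [DirectSum.Decomposition 𝒰]

theorem homComponent_apply (g : Γ) (u : U) :
    homComponent 𝒰 g u = (DirectSum.decompose 𝒰 u g : U) := rfl

theorem homComponent_mem (g : Γ) (u : U) : homComponent 𝒰 g u ∈ 𝒰 g :=
  (DirectSum.decompose 𝒰 u g).2

variable {𝒰}

theorem homComponent_same {g : Γ} {u : U} (hu : u ∈ 𝒰 g) : homComponent 𝒰 g u = u :=
  DirectSum.decompose_of_mem_same 𝒰 hu

theorem homComponent_ne {g h : Γ} {u : U} (hu : u ∈ 𝒰 h) (hgh : h ≠ g) :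
    homComponent 𝒰 g u = 0 :=
  DirectSum.decompose_of_mem_ne 𝒰 hu hgh

theorem homComponent_of_mem (g : Γ) {h : Γ} {u : U} (hu : u ∈ 𝒰 h) :
    homComponent 𝒰 g u = if h = g then u else 0 := by
  split_ifs with e
  · exact homComponent_same (e ▸ hu)
  · exact homComponent_ne hu e

variable (𝒰)

theorem ext_homComponent {u v : U} (h : ∀ g, homComponent 𝒰 g u = homComponent 𝒰 g v) : u = v := by
  apply (DirectSum.decompose 𝒰).injective
  ext g
  exact h g

theorem eq_zero_of_homComponent {u : U} (h : ∀ g, homComponent 𝒰 g u = 0) : u = 0 :=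
  ext_homComponent 𝒰 fun g => by rw [h, map_zero]

theorem homogeneous_induction {p : U → Prop} (h0 : p 0) (hh : ∀ g, ∀ u ∈ 𝒰 g, p u)
    (ha : ∀ u v, p u → p v → p (u + v)) (u : U) : p u :=
  DirectSum.Decomposition.inductionOn 𝒰 h0 (fun m => hh _ m m.2) ha u

theorem linearMap_ext_homogeneous {f f' : U →ₗ[F] W} (h : ∀ g, ∀ u ∈ 𝒰 g, f u = f' u) :
    f = f' := by
  ext u
  induction u using homogeneous_induction 𝒰 with
  | h0 => simp
  | hh g u hu => exact h g u hu
  | ha u v hu hv => rw [map_add, map_add, hu, hv]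

theorem exists_homogeneous_ne_zero {f : U →ₗ[F] W} (h : f ≠ 0) : ∃ g, ∃ u ∈ 𝒰 g, f u ≠ 0 := by
  by_contra! h'
  exact h (linearMap_ext_homogeneous 𝒰 h')

theorem mem_of_homComponent {g : Γ} {u : U} (h : ∀ k, k ≠ g → homComponent 𝒰 k u = 0) :
    u ∈ 𝒰 g := by
  have : u = homComponent 𝒰 g u := by
    apply ext_homComponent 𝒰
    intro k
    rcases eq_or_ne k g with rfl | hk
    · rw [homComponent_same (homComponent_mem 𝒰 _ u)]
    · rw [h k hk, homComponent_ne (homComponent_mem 𝒰 g u) hk.symm]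
  rw [this]
  exact homComponent_mem 𝒰 g u

/-- The linear map multiplying `u` of degree `g` by the scalar `c g`. -/
def degreeScale (c : Γ → F) : U →ₗ[F] U :=
  (DirectSum.toModule F Γ U fun g => c g • (𝒰 g).subtype) ∘ₗ
    (DirectSum.decomposeLinearEquiv 𝒰).toLinearMap

variable {𝒰}

theorem degreeScale_of_mem (c : Γ → F) {g : Γ} {u : U} (hu : u ∈ 𝒰 g) :
    degreeScale 𝒰 c u = c g • u := by
  change DirectSum.toModule F Γ U (fun g => c g • (𝒰 g).subtype) (DirectSum.decompose 𝒰 u) = _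
  rw [DirectSum.decompose_of_mem 𝒰 hu]
  erw [DirectSum.toModule_lof]
  rfl

/-- A degree-preserving map commutes with the projections onto components, and so does its inverse.
-/
theorem symm_mem_of_graded {𝒲 : Γ → Submodule F W} [DirectSum.Decomposition 𝒲] (θ : U ≃ₗ[F] W)
    (h : ∀ g, ∀ u ∈ 𝒰 g, θ u ∈ 𝒲 g) (g : Γ) (w : W) (hw : w ∈ 𝒲 g) : θ.symm w ∈ 𝒰 g := by
  have key : ∀ k, homComponent 𝒲 k ∘ₗ θ.toLinearMap = θ.toLinearMap ∘ₗ homComponent 𝒰 k := by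
    intro k
    apply linearMap_ext_homogeneous 𝒰
    intro g u hu
    simp only [LinearMap.comp_apply, LinearEquiv.coe_coe, homComponent_of_mem k hu,
      homComponent_of_mem k (h g u hu)]
    split_ifs <;> simp
  apply mem_of_homComponent 𝒰
  intro k hk
  apply θ.injective
  have := LinearMap.congr_fun (key k) (θ.symm w)
  simp only [LinearMap.comp_apply, LinearEquiv.coe_coe, LinearEquiv.apply_symm_apply] at this
  rw [← this, homComponent_ne hw hk.symm, map_zero]

end Components

/-! ### Graded-division algebras: homogeneous inverses and one-dimensional components. -/

section GradedDivision

variable {F : Type*} [Field F] {G : Type*} [AddCommGroup G] [DecidableEq G]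
variable {D : Type*} [Ring D] [Algebra F D]
variable {𝒟 : G × ZMod 2 → Submodule F D} [GradedAlgebra 𝒟]

/-- Since 1 has degree 0, the component of degree -g of x⁻¹ is already a right inverse of x, hence
equals x⁻¹. -/
theorem IsGradedDivision.exists_inv (hD : IsGradedDivision 𝒟) {g : G × ZMod 2} {x : D}
    (hx : x ∈ 𝒟 g) (h0 : x ≠ 0) : ∃ y ∈ 𝒟 (-g), x * y = 1 ∧ y * x = 1 := by
  obtain ⟨v, rfl⟩ := hD.2 g x hx h0
  have h1 : (v : D) * homComponent 𝒟 (-g) (↑v⁻¹ : D) = 1 := by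
    rw [homComponent_apply, ← DirectSum.coe_decompose_mul_add_of_left_mem 𝒟 hx, add_neg_cancel,
      Units.mul_inv]
    exact DirectSum.decompose_of_mem_same 𝒟 (SetLike.GradedOne.one_mem)
  have h2 : (↑v⁻¹ : D) = homComponent 𝒟 (-g) (↑v⁻¹ : D) := by
    calc (↑v⁻¹ : D) = ↑v⁻¹ * ((v : D) * homComponent 𝒟 (-g) (↑v⁻¹ : D)) := by rw [h1, mul_one]
      _ = _ := by rw [← mul_assoc, Units.inv_mul, one_mul]
  exact ⟨(↑v⁻¹ : D), h2 ▸ homComponent_mem 𝒟 _ _, v.mul_inv, v.inv_mul⟩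

theorem IsGradedDivision.mul_ne_zero_left (hD : IsGradedDivision 𝒟) {g : G × ZMod 2} {x y : D}
    (hx : x ∈ 𝒟 g) (h0 : x ≠ 0) (hy : y ≠ 0) : x * y ≠ 0 := by
  obtain ⟨z, -, -, hz⟩ := hD.exists_inv hx h0
  intro h
  apply hy
  rw [← one_mul y, ← hz, mul_assoc, h, mul_zero]

variable [IsAlgClosed F] [FiniteDimensional F D]

/-- For c in the spectrum of x, the element x - c is homogeneous of degree 0 and not invertible,
hence zero. Dividing by a nonzero element then shows that every nonzero component is a line. -/
theorem IsGradedDivision.eq_smul_one (hD : IsGradedDivision 𝒟) {x : D} (hx : x ∈ 𝒟 0) :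
    ∃ c : F, x = c • (1 : D) := by
  have := hD.1
  obtain ⟨c, hc⟩ := spectrum.nonempty_of_isAlgClosed_of_finiteDimensional F x
  refine ⟨c, ?_⟩
  by_contra hne
  apply hc
  apply hD.2 0 _ ((𝒟 0).sub_mem _ hx)
  · intro h
    apply hne
    rw [Algebra.algebraMap_eq_smul_one] at h
    exact (sub_eq_zero.mp h).symm
  · rw [Algebra.algebraMap_eq_smul_one]
    exact (𝒟 0).smul_mem _ SetLike.GradedOne.one_mem

theorem IsGradedDivision.exists_smul (hD : IsGradedDivision 𝒟) {g : G × ZMod 2} {x y : D}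
    (hx : x ∈ 𝒟 g) (h0 : x ≠ 0) (hy : y ∈ 𝒟 g) : ∃ c : F, y = c • x := by
  obtain ⟨z, hz, -, hzx⟩ := hD.exists_inv hx h0
  have h := SetLike.GradedMul.mul_mem hy hz
  rw [add_neg_cancel] at h
  obtain ⟨c, hc⟩ := hD.eq_smul_one h
  refine ⟨c, ?_⟩
  rw [← mul_one y, ← hzx, ← mul_assoc, hc, smul_mul_assoc, one_mul]


/-- The support of a graded-division algebra. -/
def gradedSupport (hD : IsGradedDivision 𝒟) : AddSubgroup (G × ZMod 2) where
  carrier := {g | 𝒟 g ≠ ⊥}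
  zero_mem' h := by
    have := hD.1
    have h1 : (1 : D) ∈ 𝒟 0 := SetLike.GradedOne.one_mem
    rw [h] at h1
    exact one_ne_zero ((Submodule.mem_bot F).mp h1)
  add_mem' := by
    intro a b ha hb h
    obtain ⟨x, hx, hx0⟩ := Submodule.exists_mem_ne_zero_of_ne_bot ha
    obtain ⟨y, hy, hy0⟩ := Submodule.exists_mem_ne_zero_of_ne_bot hb
    have h1 := SetLike.GradedMul.mul_mem hx hy
    rw [h] at h1
    exact hD.mul_ne_zero_left hx hx0 hy0 ((Submodule.mem_bot F).mp h1)
  neg_mem' := by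
    intro a ha h
    have := hD.1
    obtain ⟨x, hx, hx0⟩ := Submodule.exists_mem_ne_zero_of_ne_bot ha
    obtain ⟨y, hy, hxy, -⟩ := hD.exists_inv hx hx0
    rw [h, Submodule.mem_bot] at hy
    rw [hy, mul_zero] at hxy
    exact zero_ne_one hxy

end GradedDivision

/-! ### Right actions of a graded-division algebra. -/

section RightModules

variable {F : Type*} [Field F] {G : Type*} [AddCommGroup G] [DecidableEq G]
variable {D : Type*} [Ring D] [Algebra F D]
variable {𝒟 : G × ZMod 2 → Submodule F D} [GradedAlgebra 𝒟]
variable {U : Type*} [AddCommGroup U] [Module F U] [Module Dᵐᵒᵖ U] [IsScalarTower F Dᵐᵒᵖ U]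
variable {𝒰 : G × ZMod 2 → Submodule F U}

theorem op_smul_op_smul (u : U) (d d' : D) : op d' • op d • u = op (d * d') • u := by
  rw [smul_smul, op_mul]

theorem op_smul_algebra (c : F) (d : D) (u : U) : op (c • d) • u = c • op d • u := by
  rw [op_smul, smul_assoc]

/-- The right multiplication `u ↦ u d` as an `F`-linear map in `u`. -/
def rightMul (F : Type*) [Field F] {D : Type*} [Ring D] [Algebra F D]
    {U : Type*} [AddCommGroup U] [Module F U] [Module Dᵐᵒᵖ U] [IsScalarTower F Dᵐᵒᵖ U] (d : D) :
    U →ₗ[F] U where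
  toFun u := op d • u
  map_add' := smul_add _
  map_smul' c u := (smul_comm c (op d) u).symm

/-- The orbit map `d ↦ u d` as an `F`-linear map in `d`. -/
def orbitMap (F : Type*) [Field F] {D : Type*} [Ring D] [Algebra F D]
    {U : Type*} [AddCommGroup U] [Module F U] [Module Dᵐᵒᵖ U] [IsScalarTower F Dᵐᵒᵖ U] (u : U) :
    D →ₗ[F] U where
  toFun d := op d • u
  map_add' d d' := by rw [op_add, add_smul]
  map_smul' c d := op_smul_algebra c d u

theorem IsGradedDivision.smul_eq_zero (hD : IsGradedDivision 𝒟) {g : G × ZMod 2} {d : D}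
    (hd : d ∈ 𝒟 g) (h0 : d ≠ 0) {u : U} (h : op d • u = 0) : u = 0 := by
  obtain ⟨y, -, hxy, -⟩ := hD.exists_inv hd h0
  rw [← one_smul Dᵐᵒᵖ u, ← op_one, ← hxy, ← op_smul_op_smul, h, smul_zero]

variable [DirectSum.Decomposition 𝒰]

theorem IsGradedRightModule.homComponent_smul (hU : IsGradedRightModule 𝒟 𝒰) {h : G × ZMod 2}
    {u : U} (hu : u ∈ 𝒰 h) (g : G × ZMod 2) (d : D) :
    homComponent 𝒰 g (op d • u) = op (homComponent 𝒟 (g - h) d) • u := by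
  have : homComponent 𝒰 g ∘ₗ orbitMap F u = orbitMap F u ∘ₗ homComponent 𝒟 (g - h) := by
    apply linearMap_ext_homogeneous 𝒟
    intro k d hd
    change homComponent 𝒰 g (op d • u) = op (homComponent 𝒟 (g - h) d) • u
    rw [homComponent_of_mem _ hd, homComponent_of_mem _ (hU h k u hu d hd)]
    by_cases e : h + k = g
    · rw [if_pos e, if_pos (by rw [← e]; abel)]
    · rw [if_neg e, if_neg (fun e' => e (by rw [e']; abel))]
      simp
  exact LinearMap.congr_fun this d

end RightModules

/-! ### Homogeneous bases of graded modules over D and the ranks of isotypic components. -/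

section HomogeneousBases

variable {F : Type*} [Field F] [IsAlgClosed F] {G : Type*} [AddCommGroup G] [DecidableEq G]
variable {D : Type*} [Ring D] [Algebra F D] [FiniteDimensional F D]
variable {𝒟 : G × ZMod 2 → Submodule F D} [GradedAlgebra 𝒟]
variable {U : Type*} [AddCommGroup U] [Module F U] [Module Dᵐᵒᵖ U] [IsScalarTower F Dᵐᵒᵖ U]
variable {𝒰 : G × ZMod 2 → Submodule F U} [DirectSum.Decomposition 𝒰]

/-- Multiplication by an invertible element of degree in T moves one component of a coset onto
another. One representative per coset therefore controls the whole module. -/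
theorem IsGradedRightModule.exists_factor (hD : IsGradedDivision 𝒟)
    (hU : IsGradedRightModule 𝒟 𝒰) {T : AddSubgroup (G × ZMod 2)} (hT : ∀ g, g ∈ T ↔ 𝒟 g ≠ ⊥)
    {g h : G × ZMod 2} (hgh : (QuotientAddGroup.mk g : (G × ZMod 2) ⧸ T) = QuotientAddGroup.mk h)
    {u : U} (hu : u ∈ 𝒰 g) : ∃ d ∈ 𝒟 (g - h), d ≠ 0 ∧ ∃ v ∈ 𝒰 h, u = op d • v := by
  have h1 : g - h ∈ T := by
    have := QuotientAddGroup.eq.mp hgh.symm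
    rwa [neg_add_eq_sub] at this
  obtain ⟨d, hd, hd0⟩ := Submodule.exists_mem_ne_zero_of_ne_bot ((hT _).mp h1)
  obtain ⟨y, hy, -, hyd⟩ := hD.exists_inv hd hd0
  refine ⟨d, hd, hd0, op y • u, ?_, ?_⟩
  · have := hU _ _ u hu y hy
    rwa [neg_sub, add_sub_cancel] at this
  · rw [op_smul_op_smul, hyd, op_one, one_smul]

theorem IsGradedRightModule.finrank_le [FiniteDimensional F U] (hD : IsGradedDivision 𝒟)
    (hU : IsGradedRightModule 𝒟 𝒰) {T : AddSubgroup (G × ZMod 2)} (hT : ∀ g, g ∈ T ↔ 𝒟 g ≠ ⊥)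
    {g h : G × ZMod 2} (hgh : (QuotientAddGroup.mk g : (G × ZMod 2) ⧸ T) = QuotientAddGroup.mk h) :
    Module.finrank F (𝒰 g) ≤ Module.finrank F (𝒰 h) := by
  have h1 : h - g ∈ T := by
    have := QuotientAddGroup.eq.mp hgh
    rwa [neg_add_eq_sub] at this
  obtain ⟨d, hd, hd0⟩ := Submodule.exists_mem_ne_zero_of_ne_bot ((hT _).mp h1)
  have hm : ∀ u ∈ 𝒰 g, rightMul F d u ∈ 𝒰 h := fun u hu => by
    have := hU _ _ u hu d hd
    rwa [add_sub_cancel] at this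
  apply LinearMap.finrank_le_finrank_of_injective (f := (rightMul F d).restrict hm)
  rw [← LinearMap.ker_eq_bot, LinearMap.ker_eq_bot']
  intro u hu
  apply Subtype.ext
  exact hD.smul_eq_zero hd hd0 (congrArg Subtype.val hu)

theorem IsGradedRightModule.finrank_eq [FiniteDimensional F U] (hD : IsGradedDivision 𝒟)
    (hU : IsGradedRightModule 𝒟 𝒰) {T : AddSubgroup (G × ZMod 2)} (hT : ∀ g, g ∈ T ↔ 𝒟 g ≠ ⊥)
    {g h : G × ZMod 2} (hgh : (QuotientAddGroup.mk g : (G × ZMod 2) ⧸ T) = QuotientAddGroup.mk h) :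
    Module.finrank F (𝒰 g) = Module.finrank F (𝒰 h) :=
  le_antisymm (hU.finrank_le hD hT hgh) (hU.finrank_le hD hT hgh.symm)

variable {T : AddSubgroup (G × ZMod 2)} {σ : (G × ZMod 2) ⧸ T → G × ZMod 2}
  {ι : (G × ZMod 2) ⧸ T → Type*}

/-- In degree σ y + t, with t ∈ T, only the vectors of the coset y contribute to a relation, and
their coefficients there are scalar multiples of a single X ∈ D_t. Cancelling X leaves an F-linear
relation inside one component. -/
theorem linearIndependent_homogeneous (hD : IsGradedDivision 𝒟) (hU : IsGradedRightModule 𝒟 𝒰)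
    (hT : ∀ g, g ∈ T ↔ 𝒟 g ≠ ⊥) (hσ : ∀ x, QuotientAddGroup.mk (σ x) = x)
    (e : ∀ x, Module.Basis (ι x) F (𝒰 (σ x))) :
    LinearIndependent Dᵐᵒᵖ (fun p : Σ x, ι x => (e p.1 p.2 : U)) := by
  classical
  rw [linearIndependent_iff']
  intro s c hc p hp
  obtain ⟨y, j⟩ := p
  apply unop_injective
  apply eq_zero_of_homComponent 𝒟
  intro t
  by_cases ht : t ∈ T
  swap
  · have hbot : 𝒟 t = ⊥ := by
      by_contra h
      exact ht ((hT t).mpr h)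
    have := homComponent_mem 𝒟 t (unop (c ⟨y, j⟩))
    rw [hbot] at this
    exact (Submodule.mem_bot F).mp this
  obtain ⟨X, hX, hX0⟩ := Submodule.exists_mem_ne_zero_of_ne_bot ((hT t).mp ht)
  have hsm : ∀ d : D, ∃ a : F, homComponent 𝒟 t d = a • X := fun d =>
    hD.exists_smul hX hX0 (homComponent_mem 𝒟 t d)
  choose a ha using hsm
  have h1 := congrArg (homComponent 𝒰 (σ y + t)) hc
  rw [map_sum, map_zero] at h1
  have h2 : ∀ p ∈ s, homComponent 𝒰 (σ y + t) (c p • (e p.1 p.2 : U)) =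
      op X • (if p.1 = y then a (unop (c p)) • (e p.1 p.2 : U) else 0) := by
    intro p _
    have h3 := hU.homComponent_smul (e p.1 p.2).2 (σ y + t) (unop (c p))
    rw [op_unop] at h3
    rw [h3]
    split_ifs with hpy
    · obtain ⟨x, i⟩ := p
      dsimp only at hpy
      subst hpy
      rw [add_sub_cancel_left, ha, op_smul_algebra, smul_comm]
    -- A vector of another coset would need a coefficient whose degree lies outside the support.
    · have hbot : 𝒟 (σ y + t - σ p.1) = ⊥ := by
        by_contra h
        have h4 := (hT _).mpr h
        apply hpy
        rw [← hσ p.1, ← hσ y, QuotientAddGroup.eq]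
        have := T.sub_mem h4 ht
        convert this using 1
        abel
      have := homComponent_mem 𝒟 (σ y + t - σ p.1) (unop (c p))
      rw [hbot, Submodule.mem_bot] at this
      rw [this, op_zero, zero_smul, smul_zero]
  rw [Finset.sum_congr rfl h2, ← Finset.smul_sum] at h1
  have h5 := hD.smul_eq_zero hX hX0 h1
  have h6 : ∑ i ∈ s.preimage (fun i : ι y => (⟨y, i⟩ : Σ x, ι x)) sigma_mk_injective.injOn,
      a (unop (c ⟨y, i⟩)) • e y i = 0 := by
    apply Subtype.ext
    rw [AddSubmonoidClass.coe_finsetSum, ZeroMemClass.coe_zero, ← h5]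
    refine Eq.trans ?_ (Finset.sum_preimage (fun i : ι y => (⟨y, i⟩ : Σ x, ι x)) s
      sigma_mk_injective.injOn
      (fun p => if p.1 = y then a (unop (c p)) • (e p.1 p.2 : U) else 0) ?_)
    · exact Finset.sum_congr rfl fun i _ => by simp
    · rintro ⟨x, i⟩ _ hp
      rw [if_neg]
      rintro rfl
      exact hp ⟨i, rfl⟩
  have h7 := linearIndependent_iff'.mp (e y).linearIndependent _ _ h6 j (by simpa using hp)
  rw [ha, h7, zero_smul]

theorem mem_span_homogeneous (hD : IsGradedDivision 𝒟) (hU : IsGradedRightModule 𝒟 𝒰)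
    (hT : ∀ g, g ∈ T ↔ 𝒟 g ≠ ⊥) (hσ : ∀ x, QuotientAddGroup.mk (σ x) = x)
    (e : ∀ x, Module.Basis (ι x) F (𝒰 (σ x))) {x : (G × ZMod 2) ⧸ T} {g : G × ZMod 2}
    (hg : QuotientAddGroup.mk g = x) {u : U} (hu : u ∈ 𝒰 g) :
    u ∈ Submodule.span Dᵐᵒᵖ (Set.range fun i => (e x i : U)) := by
  obtain ⟨d, -, -, v, hv, rfl⟩ := hU.exists_factor hD hT (hg.trans (hσ x).symm) hu
  apply Submodule.smul_mem
  have h1 : (⟨v, hv⟩ : 𝒰 (σ x)) ∈ Submodule.span F (Set.range (e x)) := (e x).mem_span _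
  have h2 : v ∈ (Submodule.span F (Set.range (e x))).map (𝒰 (σ x)).subtype := ⟨_, h1, rfl⟩
  rw [Submodule.map_span, ← Set.range_comp] at h2
  exact Submodule.span_le_restrictScalars F Dᵐᵒᵖ _ h2

theorem isotypic_eq_span (hD : IsGradedDivision 𝒟) (hU : IsGradedRightModule 𝒟 𝒰)
    (hT : ∀ g, g ∈ T ↔ 𝒟 g ≠ ⊥) (hσ : ∀ x, QuotientAddGroup.mk (σ x) = x)
    (e : ∀ x, Module.Basis (ι x) F (𝒰 (σ x))) (x : (G × ZMod 2) ⧸ T) :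
    isotypic (D := D) 𝒰 T x = Submodule.span Dᵐᵒᵖ (Set.range fun i => (e x i : U)) := by
  apply le_antisymm
  · apply Submodule.span_le.mpr
    rintro u ⟨g, hg, hu⟩
    exact mem_span_homogeneous hD hU hT hσ e hg hu
  · apply Submodule.span_mono
    rintro _ ⟨i, rfl⟩
    exact ⟨σ x, hσ x, (e x i).2⟩

/-- A basis of `U` over `D` obtained from `F`-bases of components representing the cosets of the
support. -/
noncomputable def homogeneousBasis (hD : IsGradedDivision 𝒟) (hU : IsGradedRightModule 𝒟 𝒰)
    (hT : ∀ g, g ∈ T ↔ 𝒟 g ≠ ⊥) (hσ : ∀ x, QuotientAddGroup.mk (σ x) = x)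
    (e : ∀ x, Module.Basis (ι x) F (𝒰 (σ x))) : Module.Basis (Σ x, ι x) Dᵐᵒᵖ U :=
  Module.Basis.mk (linearIndependent_homogeneous hD hU hT hσ e) (by
    intro u _
    induction u using homogeneous_induction 𝒰 with
    | h0 => exact Submodule.zero_mem _
    | hh g u hu =>
      refine Submodule.span_mono ?_
        (mem_span_homogeneous hD hU hT hσ e (x := QuotientAddGroup.mk g) rfl hu)
      rintro _ ⟨i, rfl⟩
      exact ⟨⟨_, i⟩, rfl⟩
    | ha u v hu hv => exact Submodule.add_mem _ (hu trivial) (hv trivial))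

theorem homogeneousBasis_apply (hD : IsGradedDivision 𝒟) (hU : IsGradedRightModule 𝒟 𝒰)
    (hT : ∀ g, g ∈ T ↔ 𝒟 g ≠ ⊥) (hσ : ∀ x, QuotientAddGroup.mk (σ x) = x)
    (e : ∀ x, Module.Basis (ι x) F (𝒰 (σ x))) (p : Σ x, ι x) :
    homogeneousBasis hD hU hT hσ e p = (e p.1 p.2 : U) :=
  Module.Basis.mk_apply _ _ p

/-- Finite dimension over F makes D noetherian, so ranks over D behave as expected. -/
theorem IsGradedDivision.strongRankCondition (hD : IsGradedDivision 𝒟) :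
    StrongRankCondition Dᵐᵒᵖ := by
  have := hD.1
  have : IsNoetherianRing Dᵐᵒᵖ := isNoetherian_of_tower F inferInstance
  exact IsNoetherianRing.strongRankCondition Dᵐᵒᵖ

/-- The rank of an isotypic component is the dimension of any of its homogeneous components. -/
theorem finrank_isotypic [FiniteDimensional F U] (hD : IsGradedDivision 𝒟)
    (hU : IsGradedRightModule 𝒟 𝒰) (hT : ∀ g, g ∈ T ↔ 𝒟 g ≠ ⊥) (g : G × ZMod 2) :
    Module.finrank Dᵐᵒᵖ (isotypic (D := D) 𝒰 T (QuotientAddGroup.mk g)) =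
      Module.finrank F (𝒰 g) := by
  have := hD.1
  have := hD.strongRankCondition
  have hσ : ∀ x : (G × ZMod 2) ⧸ T, QuotientAddGroup.mk (Quotient.out x) = x := Quotient.out_eq
  let e := fun x : (G × ZMod 2) ⧸ T => Module.finBasis F (𝒰 (Quotient.out x))
  rw [isotypic_eq_span hD hU hT hσ e, finrank_span_eq_card, Fintype.card_fin]
  · exact hU.finrank_eq hD hT (hσ _)
  · exact (linearIndependent_homogeneous hD hU hT hσ e).comp
      (fun i => (⟨_, i⟩ : Σ x, Fin (Module.finrank F (𝒰 (Quotient.out x)))))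
      (fun i j h => eq_of_heq (Sigma.mk.inj h).2)

end HomogeneousBases

/-! ### Symmetry, two-sided nondegeneracy and dual bases for B. -/

section Adjoints

variable {F : Type*} [Field F] {G : Type*} [AddCommGroup G]
variable {D : Type*} [Ring D] [Algebra F D]
variable {U : Type*} [AddCommGroup U] [Module F U] [Module Dᵐᵒᵖ U] [IsScalarTower F Dᵐᵒᵖ U]

/-- A nondegenerate (skew-)Hermitian sesquilinear form with prescribed `φ₀`, degree and sign. -/
structure IsHermitianTriple (𝒟 : G × ZMod 2 → Submodule F D) (𝒰 : G × ZMod 2 → Submodule F U)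
    (φ₀ : D ≃ₗ[F] D) (b : G × ZMod 2) (δ : Fˣ) (B : U →ₗ[F] U →ₗ[F] D) : Prop where
  division : IsGradedDivision 𝒟
  module : IsGradedRightModule 𝒟 𝒰
  anti : IsSuperAntiAut 𝒟 φ₀
  sesq : IsSesquilinear 𝒟 𝒰 φ₀ b B
  sign : δ = 1 ∨ δ = -1
  herm : IsSuperHermitian 𝒰 φ₀ δ B
  nondeg : IsNondegenerate B

variable {𝒟 : G × ZMod 2 → Submodule F D} {𝒰 : G × ZMod 2 → Submodule F U}
  {φ₀ : D ≃ₗ[F] D} {b : G × ZMod 2} {δ : Fˣ} {B : U →ₗ[F] U →ₗ[F] D}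

theorem map_sgn_smul {V W : Type*} [AddCommGroup V] [Module F V] [AddCommGroup W] [Module F W]
    (f : V →ₗ[F] W) (c : Fˣ) (v : V) : f (c • v) = c • f v := by
  rw [Units.smul_def, map_smul, Units.smul_def]

/-- The Hermitian condition with φ₀⁻¹ cleared; this is the form in which it transfers statements
about the left argument to the right one. -/
theorem IsHermitianTriple.flip (H : IsHermitianTriple 𝒟 𝒰 φ₀ b δ B) {g h : G × ZMod 2} {u v : U}
    (hu : u ∈ 𝒰 g) (hv : v ∈ 𝒰 h) : B v u = (sgn F (g.2 * h.2) * δ) • φ₀ (B u v) := by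
  have h1 := congrArg φ₀.toLinearMap (H.herm g h u hu v hv)
  rw [map_sgn_smul, map_sgn_smul] at h1
  simp only [LinearEquiv.coe_coe, LinearEquiv.apply_symm_apply] at h1
  rw [mul_smul, ← h1, smul_smul, sgn_mul_self, one_smul]

theorem IsHermitianTriple.flip' (H : IsHermitianTriple 𝒟 𝒰 φ₀ b δ B) {g h : G × ZMod 2} {u v : U}
    (hu : u ∈ 𝒰 g) (hv : v ∈ 𝒰 h) : φ₀ (B u v) = (sgn F (g.2 * h.2) * δ) • B v u := by
  rw [H.flip hu hv, smul_smul, mul_mul_mul_comm, sgn_mul_self, pm_sq H.sign, one_mul, one_smul]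

variable [DecidableEq G] [GradedAlgebra 𝒟] [DirectSum.Decomposition 𝒰]

theorem IsSesquilinear.homComponent_right (H : IsSesquilinear 𝒟 𝒰 φ₀ b B) {g : G × ZMod 2} {u : U}
    (hu : u ∈ 𝒰 g) (h : G × ZMod 2) (v : U) :
    B u (homComponent 𝒰 h v) = homComponent 𝒟 (b + g + h) (B u v) := by
  have : B u ∘ₗ homComponent 𝒰 h = homComponent 𝒟 (b + g + h) ∘ₗ B u := by
    apply linearMap_ext_homogeneous 𝒰
    intro k v hv
    simp only [LinearMap.comp_apply, homComponent_of_mem _ hv,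
      homComponent_of_mem _ (H.homogeneous g k u hu v hv), add_right_inj]
    split_ifs <;> simp
  exact LinearMap.congr_fun this v

theorem IsSesquilinear.homComponent_left (H : IsSesquilinear 𝒟 𝒰 φ₀ b B) {h : G × ZMod 2} {v : U}
    (hv : v ∈ 𝒰 h) (g : G × ZMod 2) (u : U) :
    B (homComponent 𝒰 g u) v = homComponent 𝒟 (b + g + h) (B u v) := by
  have : B.flip v ∘ₗ homComponent 𝒰 g = homComponent 𝒟 (b + g + h) ∘ₗ B.flip v := by
    apply linearMap_ext_homogeneous 𝒰
    intro k u hu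
    simp only [LinearMap.comp_apply, homComponent_of_mem _ hu, LinearMap.flip_apply,
      homComponent_of_mem _ (H.homogeneous k h u hu v hv), add_left_inj, add_right_inj]
    split_ifs <;> simp
  exact LinearMap.congr_fun this u

theorem IsHermitianTriple.nondeg_right (H : IsHermitianTriple 𝒟 𝒰 φ₀ b δ B) {v : U}
    (hv : ∀ g, ∀ u ∈ 𝒰 g, B u v = 0) : v = 0 := by
  apply eq_zero_of_homComponent 𝒰
  intro h
  apply H.nondeg
  intro w
  induction w using homogeneous_induction 𝒰 with
  | h0 => simp
  | hh g u hu =>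
    rw [H.flip hu (homComponent_mem 𝒰 h v), H.sesq.homComponent_right hu, hv g u hu]
    simp
  | ha u v hu hv => rw [map_add, hu, hv, add_zero]

theorem IsHermitianTriple.ext_right (H : IsHermitianTriple 𝒟 𝒰 φ₀ b δ B) {v w : U}
    (hv : ∀ g, ∀ u ∈ 𝒰 g, B u v = B u w) : v = w := by
  apply sub_eq_zero.mp
  apply H.nondeg_right
  intro g u hu
  rw [map_sub, hv g u hu, sub_self]

variable [IsAlgClosed F] [FiniteDimensional F D] [FiniteDimensional F U]

/-- For a homogeneous D-basis e_i, the map u ↦ (B(u, e_i))_i is injective by nondegeneracy, hence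
bijective onto Dⁿ because the F-dimensions agree. The preimages of the unit vectors form the dual
family. The relation between degrees is what later makes the signs of the adjoint cancel. -/
theorem IsHermitianTriple.exists_dual (H : IsHermitianTriple 𝒟 𝒰 φ₀ b δ B) :
    ∃ (n : ℕ) (e f : Fin n → U) (g k : Fin n → G × ZMod 2),
      (∀ i, e i ∈ 𝒰 (g i)) ∧ (∀ i, f i ∈ 𝒰 (k i)) ∧ (∀ i, b + k i + g i = 0) ∧
      ∀ u, u = ∑ i, op (B (f i) u) • e i := by
  classical
  have hD := H.division
  have := hD.1
  have := hD.strongRankCondition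
  let T := gradedSupport hD
  have hT : ∀ g, g ∈ T ↔ 𝒟 g ≠ ⊥ := fun g => Iff.rfl
  have hσ : ∀ x : (G × ZMod 2) ⧸ T, QuotientAddGroup.mk (Quotient.out x) = x := Quotient.out_eq
  let c := homogeneousBasis hD H.module hT hσ fun x => Module.finBasis F (𝒰 (Quotient.out x))
  have : Module.Finite Dᵐᵒᵖ U := Module.Finite.of_restrictScalars_finite F Dᵐᵒᵖ U
  have := Module.Finite.finite_basis c
  obtain ⟨n, ⟨ε⟩⟩ := Finite.exists_equiv_fin
    (Σ x : (G × ZMod 2) ⧸ T, Fin (Module.finrank F (𝒰 (Quotient.out x))))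
  let e := c.reindex ε
  have hdeg : ∀ i, ∃ g, e i ∈ 𝒰 g := fun i => ⟨_, by
    rw [Module.Basis.reindex_apply, homogeneousBasis_apply]
    exact Subtype.property _⟩
  choose g hg using hdeg
  let L : U →ₗ[F] Fin n → D := LinearMap.pi fun i => B.flip (e i)
  have hL : Function.Injective L := by
    rw [← LinearMap.ker_eq_bot, LinearMap.ker_eq_bot']
    intro u hu
    apply H.nondeg
    intro v
    rw [← e.sum_repr v, map_sum]
    apply Finset.sum_eq_zero
    intro i _
    have h1 := H.sesq.smul_right u (e i) (unop (e.repr v i))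
    rw [op_unop] at h1
    have h2 : B u (e i) = 0 := congrFun hu i
    rw [h1, h2, zero_mul]
  have hdim : Module.finrank F U = Module.finrank F (Fin n → D) := by
    rw [(e.equivFun.restrictScalars F).finrank_eq,
      (LinearEquiv.piCongrRight fun _ : Fin n => opLinearEquiv F (M := D)).finrank_eq]
  have hsurj : Function.Surjective L :=
    (LinearMap.injective_iff_surjective_of_finrank_eq_finrank hdim).mp hL
  choose f hf using fun j => hsurj (Pi.single j 1)
  -- The required values 0 and 1 have degree 0, so each dual vector may be replaced by its component
  -- of degree -b - g j.
  have hf1 : ∀ j i, B (homComponent 𝒰 (- b - g j) (f j)) (e i) = if i = j then 1 else 0 := by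
    intro j i
    rw [H.sesq.homComponent_left (hg i)]
    have h1 : B (f j) (e i) = _ := congrFun (hf j) i
    rw [h1, Pi.single_apply]
    split_ifs with hij
    · subst hij
      apply homComponent_same
      have : b + (-b - g i) + g i = 0 := by abel
      rw [this]
      exact SetLike.GradedOne.one_mem
    · rw [map_zero]
  refine ⟨n, e, fun j => homComponent 𝒰 (- b - g j) (f j), g, fun j => -b - g j, hg,
    fun j => homComponent_mem _ _ _,
    fun j => show b + (-b - g j) + g j = 0 by abel, fun u => ?_⟩
  conv_lhs => rw [← e.sum_repr u]
  apply Finset.sum_congr rfl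
  intro j _
  congr 1
  apply unop_injective
  rw [unop_op]
  conv_rhs => rw [← e.sum_repr u, map_sum]
  rw [Finset.sum_eq_single j]
  · have h1 := H.sesq.smul_right (homComponent 𝒰 (- b - g j) (f j)) (e j) (unop (e.repr u j))
    rw [op_unop] at h1
    rw [h1, hf1, if_pos rfl, one_mul]
  · intro i _ hij
    have h1 := H.sesq.smul_right (homComponent 𝒰 (- b - g j) (f j)) (e i) (unop (e.repr u i))
    rw [op_unop] at h1
    rw [h1, hf1, if_neg hij, zero_mul]
  · simp

end Adjoints

/-! ### Rank-one operators and the existence and uniqueness of the superadjunction. -/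

section Adjoints

variable {F : Type*} [Field F] {G : Type*} [AddCommGroup G]
variable {D : Type*} [Ring D] [Algebra F D]
variable {U : Type*} [AddCommGroup U] [Module F U] [Module Dᵐᵒᵖ U] [IsScalarTower F Dᵐᵒᵖ U]
variable {𝒟 : G × ZMod 2 → Submodule F D} {𝒰 : G × ZMod 2 → Submodule F U}
  {φ₀ : D ≃ₗ[F] D} {b : G × ZMod 2} {δ : Fˣ} {B : U →ₗ[F] U →ₗ[F] D}

theorem end_op_smul (r : Module.End Dᵐᵒᵖ U) (d : D) (u : U) : r (op d • u) = op d • r u :=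
  map_smul r _ _

/-- The rank-one operator `v ↦ w B(u, v)`. -/
def rankOne (H : IsSesquilinear 𝒟 𝒰 φ₀ b B) (w u : U) : Module.End Dᵐᵒᵖ U where
  toFun v := op (B u v) • w
  map_add' v v' := by rw [map_add, op_add, add_smul]
  map_smul' c v := by
    rw [← op_unop c, H.smul_right, RingHom.id_apply, op_smul_op_smul]

theorem rankOne_apply (H : IsSesquilinear 𝒟 𝒰 φ₀ b B) (w u v : U) :
    rankOne H w u v = op (B u v) • w := rfl

theorem rankOne_add_left (H : IsSesquilinear 𝒟 𝒰 φ₀ b B) (w w' u : U) :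
    rankOne H (w + w') u = rankOne H w u + rankOne H w' u := by
  ext v
  simp only [rankOne_apply, LinearMap.add_apply, smul_add]

theorem rankOne_smul_left (H : IsSesquilinear 𝒟 𝒰 φ₀ b B) (c : F) (w u : U) :
    rankOne H (c • w) u = c • rankOne H w u := by
  ext v
  simp only [rankOne_apply, LinearMap.smul_apply]
  rw [smul_comm]

theorem rankOne_mem (H : IsSesquilinear 𝒟 𝒰 φ₀ b B) (hU : IsGradedRightModule 𝒟 𝒰)
    {g h : G × ZMod 2} {w u : U} (hw : w ∈ 𝒰 g) (hu : u ∈ 𝒰 h) :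
    rankOne H w u ∈ endGrading 𝒰 (g + b + h) := by
  intro k v hv
  have := hU _ _ w hw _ (H.homogeneous h k u hu v hv)
  rw [rankOne_apply]
  convert this using 2
  abel

theorem mul_rankOne (H : IsSesquilinear 𝒟 𝒰 φ₀ b B) (r : Module.End Dᵐᵒᵖ U) (w u : U) :
    r * rankOne H w u = rankOne H (r w) u := by
  ext v
  rw [Module.End.mul_apply, rankOne_apply, rankOne_apply, end_op_smul]

variable [DecidableEq G] [GradedAlgebra 𝒟] [DirectSum.Decomposition 𝒰]
variable [IsAlgClosed F] [FiniteDimensional F D] [FiniteDimensional F U]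

/-- Applying r to u = Σ e_i B(f_i, u) gives r = Σ r(e_i) B(f_i, ·), so the homogeneous rank-one
operators span End_D(U). -/
theorem IsHermitianTriple.end_induction (H : IsHermitianTriple 𝒟 𝒰 φ₀ b δ B)
    {p : Module.End Dᵐᵒᵖ U → Prop}
    (hr : ∀ g h, ∀ w ∈ 𝒰 g, ∀ u ∈ 𝒰 h, p (rankOne H.sesq w u)) (h0 : p 0)
    (ha : ∀ r s, p r → p s → p (r + s)) (r : Module.End Dᵐᵒᵖ U) : p r := by
  obtain ⟨n, e, f, g, k, he, hf, -, hef⟩ := H.exists_dual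
  have h1 : r = ∑ i, rankOne H.sesq (r (e i)) (f i) := by
    ext u
    conv_lhs => rw [hef u, map_sum]
    rw [LinearMap.sum_apply]
    exact Finset.sum_congr rfl fun i _ => by rw [end_op_smul, rankOne_apply]
  rw [h1]
  have h2 : ∀ i w, p (rankOne H.sesq w (f i)) := by
    intro i w
    induction w using homogeneous_induction 𝒰 with
    | h0 =>
      have : rankOne H.sesq 0 (f i) = 0 := by ext; simp [rankOne_apply]
      rwa [this]
    | hh g w hw => exact hr g _ w hw _ (hf i)
    | ha u v hu hv => rw [rankOne_add_left]; exact ha _ _ hu hv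
  exact Finset.sum_induction _ p ha h0 fun i _ => h2 i _

theorem IsHermitianTriple.end_induction' (H : IsHermitianTriple 𝒟 𝒰 φ₀ b δ B)
    {p : Module.End Dᵐᵒᵖ U → Prop}
    (hr : ∀ g, ∀ r ∈ endGrading 𝒰 g, p r)
    (ha : ∀ r s, p r → p s → p (r + s)) (r : Module.End Dᵐᵒᵖ U) : p r :=
  H.end_induction (fun _ _ _ hw _ hu => hr _ _ (rankOne_mem H.sesq H.module hw hu))
    (hr 0 0 (Submodule.zero_mem _)) ha r

/-- Expanding u in the dual bases and moving the coefficients across B forces Φ(r)v = Σ ± f_i B(r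
e_i, v). -/
theorem IsHermitianTriple.exists_adjoint (H : IsHermitianTriple 𝒟 𝒰 φ₀ b δ B) :
    ∃ Φ : Module.End Dᵐᵒᵖ U →ₗ[F] Module.End Dᵐᵒᵖ U,
      ∀ g h, ∀ r ∈ endGrading (D := D) 𝒰 g, ∀ u ∈ 𝒰 h, ∀ v,
        B (r u) v = sgn F (g.2 * h.2) • B u (Φ r v) := by
  obtain ⟨n, e, f, g, k, he, hf, hkg, hef⟩ := H.exists_dual
  -- The sign in the i-th summand depends on the degree of r(e_i). Scaling each component of r(e_i)
  -- by `s i` supplies it linearly, also when r is not homogeneous; `c i` is the part of the sign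
  -- independent of r.
  let s (i : Fin n) (h : G × ZMod 2) : F := (sgn F (h.2 * (g i).2) : Fˣ)
  let c (i : Fin n) : Fˣ := δ * sgn F (b.2 * (g i).2)
  let Φ : Module.End Dᵐᵒᵖ U →ₗ[F] Module.End Dᵐᵒᵖ U :=
    { toFun := fun r => ∑ i, c i • rankOne H.sesq (f i) (degreeScale 𝒰 (s i) (r (e i)))
      map_add' := fun r r' => by
        ext v
        simp [rankOne_apply, add_smul, Finset.sum_add_distrib]
      map_smul' := fun a r => by
        ext v
        simp only [LinearMap.sum_apply, LinearMap.smul_apply, rankOne_apply, map_smul,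
          op_smul_algebra, Finset.smul_sum, RingHom.id_apply]
        exact Finset.sum_congr rfl fun i _ => smul_comm _ _ _ }
  refine ⟨Φ, ?_⟩
  intro a h r hr u hu v
  have h1 : Φ r v = ∑ i, (c i * sgn F ((a.2 + (g i).2) * (g i).2)) • op (B (r (e i)) v) • f i := by
    change (∑ i, c i • rankOne H.sesq (f i) (degreeScale 𝒰 (s i) (r (e i)))) v = _
    rw [LinearMap.sum_apply]
    refine Finset.sum_congr rfl fun i _ => ?_
    rw [degreeScale_of_mem _ (hr _ _ (he i)), LinearMap.smul_apply, rankOne_apply, map_smul,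
      LinearMap.smul_apply, op_smul_algebra, mul_smul (c i)]
    rfl
  rw [h1]
  conv_lhs => rw [hef u, map_sum, map_sum, LinearMap.sum_apply]
  rw [map_sum, Finset.smul_sum]
  refine Finset.sum_congr rfl fun i _ => ?_
  rw [end_op_smul, H.sesq.smul_left _ _ _ (hr _ _ (he i)) _ (H.sesq.homogeneous _ _ _ (hf i) _ hu),
    H.flip' (hf i) hu, map_sgn_smul, H.sesq.smul_right, smul_mul_assoc, smul_smul, smul_smul]
  congr 1
  have h2 : b.2 + (k i).2 + (g i).2 = 0 := congrArg Prod.snd (hkg i)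
  simp only [c, Prod.snd_add]
  -- The exponents agree modulo 2 because |b| + |k i| + |g i| = 0, the degree relation of the dual
  -- bases.
  have h3 : (b.2 + (a.2 + (g i).2)) * (b.2 + (k i).2 + h.2) + (k i).2 * h.2 =
      a.2 * h.2 + (b.2 * (g i).2 + (a.2 + (g i).2) * (g i).2) := by
    generalize b.2 = b at *
    generalize (k i).2 = k at *
    generalize (g i).2 = g at *
    generalize h.2 = h
    generalize a.2 = a
    revert a b g h k
    decide
  rw [← mul_assoc, ← sgn_add, h3, sgn_add, sgn_add]
  simp only [mul_comm, mul_left_comm, mul_assoc]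

/-- As in linear algebra, the adjoint of w B(u,·) is u B(w,·) up to sign. The sign is symmetric in
the two degrees, so the adjoint is an involution. -/
theorem IsHermitianTriple.adjoint_rankOne (H : IsHermitianTriple 𝒟 𝒰 φ₀ b δ B)
    {Φ : Module.End Dᵐᵒᵖ U →ₗ[F] Module.End Dᵐᵒᵖ U}
    (hΦ : ∀ g h, ∀ r ∈ endGrading (D := D) 𝒰 g, ∀ u ∈ 𝒰 h, ∀ v,
        B (r u) v = sgn F (g.2 * h.2) • B u (Φ r v)) {g h : G × ZMod 2} {w u : U} (hw : w ∈ 𝒰 g)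
    (hu : u ∈ 𝒰 h) :
    Φ (rankOne H.sesq w u) = (δ * sgn F ((b.2 + g.2) * (b.2 + h.2))) • rankOne H.sesq u w := by
  ext v
  apply H.ext_right
  intro k x hx
  have h1 := hΦ _ _ _ (rankOne_mem H.sesq H.module hw hu) x hx v
  rw [rankOne_apply, H.sesq.smul_left _ _ _ hw _ (H.sesq.homogeneous _ _ _ hu _ hx), H.flip' hu hx,
    smul_mul_assoc, smul_smul] at h1
  rw [LinearMap.smul_apply, map_sgn_smul, rankOne_apply, H.sesq.smul_right]
  have h2 := congrArg (fun z => sgn F ((g + b + h).2 * k.2) • z) h1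
  rw [smul_smul, smul_smul, sgn_mul_self, one_smul] at h2
  rw [← h2]
  congr 1
  simp only [Prod.snd_add]
  have h3 : (g.2 + b.2 + h.2) * k.2 + ((b.2 + g.2) * (b.2 + h.2 + k.2) + h.2 * k.2) =
      (b.2 + g.2) * (b.2 + h.2) := by
    generalize b.2 = b
    generalize k.2 = k
    generalize g.2 = g
    generalize h.2 = h
    revert b g h k
    decide
  rw [← h3, sgn_add, sgn_add]
  simp only [mul_comm, mul_left_comm, mul_assoc]

theorem IsHermitianTriple.adjoint_adjoint (H : IsHermitianTriple 𝒟 𝒰 φ₀ b δ B)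
    {Φ : Module.End Dᵐᵒᵖ U →ₗ[F] Module.End Dᵐᵒᵖ U}
    (hΦ : ∀ g h, ∀ r ∈ endGrading (D := D) 𝒰 g, ∀ u ∈ 𝒰 h, ∀ v,
        B (r u) v = sgn F (g.2 * h.2) • B u (Φ r v)) (r : Module.End Dᵐᵒᵖ U) : Φ (Φ r) = r := by
  induction r using H.end_induction with
  | hr g h w hw u hu =>
    rw [H.adjoint_rankOne hΦ hw hu, map_sgn_smul, H.adjoint_rankOne hΦ hu hw, smul_smul,
      mul_mul_mul_comm, pm_sq H.sign, mul_comm (b.2 + h.2), sgn_mul_self, one_mul, one_smul]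
  | h0 => rw [map_zero, map_zero]
  | ha r s hr hs => rw [map_add, map_add, hr, hs]

/-- By right nondegeneracy φ(r)v is determined by the values B(u, φ(r)v) with u homogeneous. Their
degrees give the degree of φ(r)v, and moving r and s across B one at a time gives the rule for
products. -/
theorem IsHermitianTriple.isSuperAntiAut_of_adjoint (H : IsHermitianTriple 𝒟 𝒰 φ₀ b δ B)
    {φ : Module.End Dᵐᵒᵖ U ≃ₗ[F] Module.End Dᵐᵒᵖ U}
    (hφ : ∀ g h, ∀ r ∈ endGrading (D := D) 𝒰 g, ∀ u ∈ 𝒰 h, ∀ v,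
        B (r u) v = sgn F (g.2 * h.2) • B u (φ r v)) : IsSuperAntiAut (endGrading 𝒰) φ where
  map_mem g r hr h v hv := by
    apply mem_of_homComponent 𝒰
    intro k hk
    apply H.nondeg_right
    intro l u hu
    have h1 := hφ _ _ _ hr u hu v
    have h2 := H.sesq.homogeneous _ _ _ (hr _ _ hu) v hv
    rw [h1] at h2
    have h3 : B u (φ r v) ∈ 𝒟 (b + l + (g + h)) := by
      have := (𝒟 (b + (g + l) + h)).smul_mem (sgn F (g.2 * l.2) : Fˣ).1 h2
      rw [← Units.smul_def, smul_smul, sgn_mul_self, one_smul] at this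
      convert this using 2
      abel
    rw [H.sesq.homComponent_right hu, homComponent_ne h3]
    simpa using hk.symm
  map_mul g h r hr s hs := by
    ext v
    apply H.ext_right
    intro k u hu
    have hrs : r * s ∈ endGrading (D := D) 𝒰 (g + h) := fun l x hx => by
      rw [add_assoc]; exact hr _ _ (hs _ _ hx)
    have h1 := hφ _ _ _ hrs u hu v
    rw [Module.End.mul_apply, hφ _ _ _ hr _ (hs _ _ hu), hφ _ _ _ hs _ hu, smul_smul] at h1
    have h2 := congrArg (fun z => sgn F ((g + h).2 * k.2) • z) h1
    rw [smul_smul, smul_smul, sgn_mul_self, one_smul] at h2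
    rw [← h2, LinearMap.smul_apply, map_sgn_smul, Module.End.mul_apply]
    congr 1
    rw [← sgn_add, ← sgn_add]
    congr 1
    simp only [Prod.snd_add]
    generalize k.2 = k
    generalize g.2 = g
    generalize h.2 = h
    revert g h k
    decide

theorem IsHermitianTriple.existsUnique_superadjunction (H : IsHermitianTriple 𝒟 𝒰 φ₀ b δ B) :
    ∃! φ, IsSuperadjunction 𝒰 B φ := by
  obtain ⟨Φ, hΦ⟩ := H.exists_adjoint
  refine ⟨LinearEquiv.ofInvolutive Φ (H.adjoint_adjoint hΦ),
    ⟨H.isSuperAntiAut_of_adjoint hΦ, hΦ⟩, ?_⟩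
  intro φ hφ
  ext1 r
  induction r using H.end_induction' with
  | hr g r hr =>
    ext v
    apply H.ext_right
    intro h u hu
    have h1 := (hφ.adjoint g h r hr u hu v).symm.trans (hΦ g h r hr u hu v)
    exact smul_left_cancel _ h1
  | ha r s hr hs => rw [map_add, map_add, hr, hs]

end Adjoints

/-! ### Uniqueness of the parameters. -/

section Uniqueness

variable {F : Type*} [Field F] {G : Type*} [AddCommGroup G] [DecidableEq G]
variable {D : Type*} [Ring D] [Algebra F D]
variable {U : Type*} [AddCommGroup U] [Module F U] [Module Dᵐᵒᵖ U] [IsScalarTower F Dᵐᵒᵖ U]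
variable {𝒟 : G × ZMod 2 → Submodule F D} {𝒰 : G × ZMod 2 → Submodule F U}
  {B : U →ₗ[F] U →ₗ[F] D}

theorem SuperBicharacter.ext {T : AddSubgroup (G × ZMod 2)} {β β' : SuperBicharacter F T}
    (h : ∀ t s, β.toFun t s = β'.toFun t s) : β = β' := by
  cases β
  cases β'
  congr
  funext t s
  exact h t s

theorem units_smul_right_cancel {V : Type*} [AddCommGroup V] [Module F V] {c c' : Fˣ} {v : V}
    (hv : v ≠ 0) (h : c • v = c' • v) : c = c' := by
  rw [Units.smul_def, Units.smul_def] at h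
  exact Units.ext (smul_left_injective F hv h)

variable [DirectSum.Decomposition 𝒰]

theorem IsNondegenerate.exists_homogeneous [Nontrivial U] (hB : IsNondegenerate B) :
    ∃ g h, ∃ u ∈ 𝒰 g, ∃ v ∈ 𝒰 h, B u v ≠ 0 := by
  obtain ⟨w, hw⟩ := exists_ne (0 : U)
  have h1 : B ≠ 0 := by
    rintro rfl
    exact hw (hB w fun v => rfl)
  obtain ⟨g, u, hu, h2⟩ := exists_homogeneous_ne_zero 𝒰 h1
  obtain ⟨h, v, hv, h3⟩ := exists_homogeneous_ne_zero 𝒰 h2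
  exact ⟨g, h, u, hu, v, hv, h3⟩

variable [GradedAlgebra 𝒟]

/-- One nonzero value B(u,v) at homogeneous vectors decides everything about the form: its degree
gives g₀, the identity for B(ud,v) gives φ₀ after cancelling the invertible B(u,v), and comparison
with B(v,u) gives δ. The remaining data are read off from D and from ranks. -/
theorem HasParameters.unique [Nontrivial U] (hD : IsGradedDivision 𝒟) (hB : IsNondegenerate B)
    {P P' : Parameters F G} (hP : HasParameters 𝒟 𝒰 B P) (hP' : HasParameters 𝒟 𝒰 B P') :
    P = P' := by
  obtain ⟨T, β, q⟩ := P
  obtain ⟨T', β', q'⟩ := P'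
  have hT : T = T' := by
    ext g
    exact (hP.support g).trans (hP'.support g).symm
  subst hT
  have hX : ∀ t : T, ∃ x ∈ 𝒟 t, x ≠ 0 := fun t =>
    Submodule.exists_mem_ne_zero_of_ne_bot ((hP.support t).mp t.2)
  have hβ : β = β' := by
    apply SuperBicharacter.ext
    intro t s
    obtain ⟨x, hx, hx0⟩ := hX t
    obtain ⟨y, hy, hy0⟩ := hX s
    have h := (hP.commutation t s x hx y hy).symm.trans (hP'.commutation t s x hx y hy)
    exact mul_left_cancel (units_smul_right_cancel (hD.mul_ne_zero_left hy hy0 hx0) h)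
  subst hβ
  congr
  obtain ⟨φ, hφ, hs, hh, hη⟩ := hP.form
  obtain ⟨φ', hφ', hs', hh', hη'⟩ := hP'.form
  obtain ⟨g, h, u, hu, v, hv, huv⟩ := hB.exists_homogeneous (𝒰 := 𝒰)
  have hb : q.g₀ = q'.g₀ := by
    have := DirectSum.degree_eq_of_mem_mem 𝒟 (hs.homogeneous g h u hu v hv)
      (hs'.homogeneous g h u hu v hv) huv
    simpa using this
  have hφφ : φ.toLinearMap = φ'.toLinearMap := by
    apply linearMap_ext_homogeneous 𝒟
    intro k d hd
    have h1 := (hs.smul_left g k u hu d hd v).symm.trans (hs'.smul_left g k u hu d hd v)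
    dsimp only at hb h1
    rw [hb] at h1
    have h2 := smul_left_cancel _ h1
    exact (hD.2 _ _ (hs.homogeneous g h u hu v hv) huv).mul_right_cancel h2
  have hφφ : φ = φ' := LinearEquiv.toLinearMap_injective hφφ
  subst hφφ
  apply Inertia.ext
  · funext t
    obtain ⟨x, hx, hx0⟩ := hX t
    exact units_smul_right_cancel hx0 ((hη t x hx).symm.trans (hη' t x hx))
  · funext x
    exact (hP.multiplicity x).trans (hP'.multiplicity x).symm
  · exact hb
  · exact units_smul_right_cancel huv ((hh g h u hu v hv).symm.trans (hh' g h u hu v hv))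

end Uniqueness

/-! ### Scalar pairings between homogeneous components. -/

section Pairings

variable {F : Type*} [Field F] {G : Type*} [AddCommGroup G]
variable {D : Type*} [Ring D] [Algebra F D]
variable {U : Type*} [AddCommGroup U] [Module F U] [Module Dᵐᵒᵖ U] [IsScalarTower F Dᵐᵒᵖ U]
variable {𝒟 : G × ZMod 2 → Submodule F D} {𝒰 : G × ZMod 2 → Submodule F U}
  {φ₀ : D ≃ₗ[F] D} {b : G × ZMod 2} {δ : Fˣ} {B : U →ₗ[F] U →ₗ[F] D}

/-- The scalar-valued pairing between two homogeneous components obtained from `B` and a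
functional on `D`. -/
def componentPairing (𝒰 : G × ZMod 2 → Submodule F U) (B : U →ₗ[F] U →ₗ[F] D) (ℓ : D →ₗ[F] F)
    (g h : G × ZMod 2) : 𝒰 g →ₗ[F] 𝒰 h →ₗ[F] F :=
  (B.domRestrict₁₂ (𝒰 g) (𝒰 h)).compr₂ ℓ

theorem componentPairing_apply (ℓ : D →ₗ[F] F) (g h : G × ZMod 2) (u : 𝒰 g) (v : 𝒰 h) :
    componentPairing 𝒰 B ℓ g h u v = ℓ (B u v) := rfl

variable [DecidableEq G] [GradedAlgebra 𝒟] [DirectSum.Decomposition 𝒰] [IsAlgClosed F]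
  [FiniteDimensional F D] [FiniteDimensional F U]

theorem IsGradedDivision.exists_coordinate (hD : IsGradedDivision 𝒟) {t : G × ZMod 2} {X : D}
    (hX : X ∈ 𝒟 t) (h0 : X ≠ 0) : ∃ ℓ : D →ₗ[F] F, ∀ y ∈ 𝒟 t, y = ℓ y • X := by
  obtain ⟨f, hf⟩ : ∃ f : Module.Dual F D, f X ≠ 0 := by
    by_contra! h
    exact h0 ((Module.forall_dual_apply_eq_zero_iff F X).mp h)
  refine ⟨(f X)⁻¹ • f, fun y hy => ?_⟩
  obtain ⟨c, rfl⟩ := hD.exists_smul hX h0 hy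
  rw [LinearMap.smul_apply, map_smul, smul_eq_mul, smul_eq_mul, mul_comm c,
    inv_mul_cancel_left₀ hf]

/-- If B(u,v) ≠ 0 with v of degree k, then b + g + k lies in T, so k and h are in the same coset and
v is a D-multiple of an element of U_h. -/
theorem IsHermitianTriple.nondeg_left_component (H : IsHermitianTriple 𝒟 𝒰 φ₀ b δ B)
    {g h : G × ZMod 2} (hgh : 𝒟 (b + g + h) ≠ ⊥) {u : U} (hu : u ∈ 𝒰 g)
    (huv : ∀ v ∈ 𝒰 h, B u v = 0) : u = 0 := by
  apply H.nondeg
  intro v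
  induction v using homogeneous_induction 𝒰 with
  | h0 => rw [map_zero]
  | ha v w hv hw => rw [map_add, hv, hw, add_zero]
  | hh k v hv =>
    by_contra hne
    have hT : ∀ g, g ∈ gradedSupport H.division ↔ 𝒟 g ≠ ⊥ := fun g => Iff.rfl
    have h1 := H.sesq.homogeneous _ _ _ hu _ hv
    have h2 : b + g + k ∈ gradedSupport H.division := (hT _).mpr fun h => by
      rw [h] at h1
      exact hne ((Submodule.mem_bot F).mp h1)
    have h3 := (gradedSupport H.division).sub_mem h2 ((hT _).mpr hgh)
    have h4 : (QuotientAddGroup.mk k : (G × ZMod 2) ⧸ gradedSupport H.division) =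
        QuotientAddGroup.mk h := by
      apply Eq.symm
      rw [QuotientAddGroup.eq]
      convert h3 using 1
      abel
    obtain ⟨d, -, -, w, hw, rfl⟩ := H.module.exists_factor H.division hT h4 hv
    apply hne
    rw [H.sesq.smul_right, huv w hw, zero_mul]

theorem IsHermitianTriple.nondeg_right_component (H : IsHermitianTriple 𝒟 𝒰 φ₀ b δ B)
    {g h : G × ZMod 2} (hgh : 𝒟 (b + g + h) ≠ ⊥) {v : U} (hv : v ∈ 𝒰 h)
    (huv : ∀ u ∈ 𝒰 g, B u v = 0) : v = 0 := by
  apply H.nondeg_left_component (h := g) (by rwa [add_right_comm]) hv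
  intro u hu
  rw [H.flip hu hv, huv u hu, map_zero, smul_zero]

theorem IsHermitianTriple.componentPairing_left (H : IsHermitianTriple 𝒟 𝒰 φ₀ b δ B)
    {g h : G × ZMod 2} {X : D} (h0 : X ≠ 0) {ℓ : D →ₗ[F] F} (hX : X ∈ 𝒟 (b + g + h))
    (hℓ : ∀ y ∈ 𝒟 (b + g + h), y = ℓ y • X) (u : 𝒰 g)
    (huv : ∀ v, componentPairing 𝒰 B ℓ g h u v = 0) : u = 0 := by
  apply Subtype.ext
  apply H.nondeg_left_component (h := h) (fun h => h0 (by rwa [h, Submodule.mem_bot] at hX)) u.2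
  intro v hv
  rw [hℓ _ (H.sesq.homogeneous _ _ _ u.2 _ hv)]
  have h1 : ℓ (B u v) = 0 := huv ⟨v, hv⟩
  rw [h1, zero_smul]

theorem IsHermitianTriple.componentPairing_right (H : IsHermitianTriple 𝒟 𝒰 φ₀ b δ B)
    {g h : G × ZMod 2} {X : D} (h0 : X ≠ 0) {ℓ : D →ₗ[F] F} (hX : X ∈ 𝒟 (b + g + h))
    (hℓ : ∀ y ∈ 𝒟 (b + g + h), y = ℓ y • X) (v : 𝒰 h)
    (huv : ∀ u, componentPairing 𝒰 B ℓ g h u v = 0) : v = 0 := by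
  apply Subtype.ext
  apply H.nondeg_right_component (g := g) (fun h => h0 (by rwa [h, Submodule.mem_bot] at hX)) v.2
  intro u hu
  rw [hℓ _ (H.sesq.homogeneous _ _ _ hu _ v.2)]
  have h1 : ℓ (B u v) = 0 := huv ⟨u, hu⟩
  rw [h1, zero_smul]

theorem IsHermitianTriple.finrank_component_le (H : IsHermitianTriple 𝒟 𝒰 φ₀ b δ B)
    {g h : G × ZMod 2} (hgh : 𝒟 (b + g + h) ≠ ⊥) :
    Module.finrank F (𝒰 g) ≤ Module.finrank F (𝒰 h) := by
  obtain ⟨X, hX, h0⟩ := Submodule.exists_mem_ne_zero_of_ne_bot hgh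
  obtain ⟨ℓ, hℓ⟩ := H.division.exists_coordinate hX h0
  rw [← Subspace.dual_finrank_eq (V := 𝒰 h)]
  apply LinearMap.finrank_le_finrank_of_injective (f := componentPairing 𝒰 B ℓ g h)
  rw [← LinearMap.ker_eq_bot, LinearMap.ker_eq_bot']
  exact fun u hu => H.componentPairing_left h0 hX hℓ u fun v => LinearMap.congr_fun hu v

theorem IsHermitianTriple.finrank_component_eq (H : IsHermitianTriple 𝒟 𝒰 φ₀ b δ B)
    {g h : G × ZMod 2} (hgh : 𝒟 (b + g + h) ≠ ⊥) :
    Module.finrank F (𝒰 g) = Module.finrank F (𝒰 h) :=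
  le_antisymm (H.finrank_component_le hgh)
    (H.finrank_component_le (by rwa [add_right_comm]))

/-- On a self-dual component, `B` is symmetric or skew-symmetric. -/
theorem IsHermitianTriple.flip_self (H : IsHermitianTriple 𝒟 𝒰 φ₀ b δ B)
    {g : G × ZMod 2} {η : Fˣ} (hη : ∀ x ∈ 𝒟 (b + 2 • g), φ₀ x = η • x) {u v : U} (hu : u ∈ 𝒰 g)
    (hv : v ∈ 𝒰 g) : B v u = (sgn F g.2 * η * δ) • B u v := by
  have h1 := H.sesq.homogeneous _ _ _ hu _ hv
  rw [add_assoc, ← two_nsmul] at h1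
  rw [H.flip hu hv, hη _ h1, smul_smul]
  congr 1
  have h2 : g.2 * g.2 = g.2 := by
    generalize g.2 = i
    revert i; decide
  rw [h2, mul_right_comm]

/-- With sign -1 the scalar pairing of U_g with itself is alternating and nondegenerate. This is the
origin of the parity condition on κ. -/
theorem IsHermitianTriple.even_finrank (H : IsHermitianTriple 𝒟 𝒰 φ₀ b δ B) (h2 : (2 : F) ≠ 0)
    {g : G × ZMod 2} (hg : 𝒟 (b + 2 • g) ≠ ⊥)
    {η : Fˣ} (hη : ∀ x ∈ 𝒟 (b + 2 • g), φ₀ x = η • x) (hs : sgn F g.2 * η * δ = -1) :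
    Even (Module.finrank F (𝒰 g)) := by
  obtain ⟨X, hX, h0⟩ := Submodule.exists_mem_ne_zero_of_ne_bot hg
  obtain ⟨ℓ, hℓ⟩ := H.division.exists_coordinate hX h0
  rw [two_nsmul, ← add_assoc] at hX hℓ
  apply even_finrank_of_alternating (componentPairing 𝒰 B ℓ g g)
  · intro u
    rw [componentPairing_apply]
    have h3 := congrArg ℓ (H.flip_self hη u.2 u.2)
    rw [hs, map_sgn_smul, Units.smul_def] at h3
    simp only [Units.val_neg, Units.val_one, neg_smul, one_smul] at h3
    have h4 : (2 : F) * ℓ (B u u) = 0 := by linear_combination h3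
    exact (mul_eq_zero.mp h4).resolve_left h2
  · exact H.componentPairing_left h0 hX hℓ

/-- Flipping the arguments twice shows that φ₀² fixes every value B(u,w) at homogeneous vectors. As
φ₀² is multiplicative, comparing B(u,vd) = B(u,v)d with B(u,v) and cancelling the latter shows that
it fixes d. Hence the eigenvalues of φ₀ are ±1. -/
theorem IsHermitianTriple.anti_involutive [Nontrivial U] (H : IsHermitianTriple 𝒟 𝒰 φ₀ b δ B)
    {h : G × ZMod 2} {d : D} (hd : d ∈ 𝒟 h) : φ₀ (φ₀ d) = d := by
  obtain ⟨g, k, u, hu, v, hv, huv⟩ := H.nondeg.exists_homogeneous (𝒰 := 𝒰)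
  have key : ∀ l, ∀ w ∈ 𝒰 l, φ₀ (φ₀ (B u w)) = B u w := by
    intro l w hw
    have h1 := congrArg φ₀.toLinearMap (H.flip' hu hw)
    rw [map_sgn_smul] at h1
    simp only [LinearEquiv.coe_coe] at h1
    rw [h1, H.flip' hw hu, smul_smul, mul_mul_mul_comm, pm_sq H.sign, mul_comm l.2, sgn_mul_self,
      one_mul, one_smul]
  have h1 := key _ _ (H.module _ _ v hv d hd)
  have hy := H.sesq.homogeneous _ _ _ hu _ hv
  rw [H.sesq.smul_right, H.anti.map_mul _ _ _ hy _ hd] at h1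
  have h2 := map_sgn_smul φ₀.toLinearMap (sgn F ((b + g + k).2 * h.2)) (φ₀ d * φ₀ (B u v))
  simp only [LinearEquiv.coe_coe] at h2
  rw [h2, H.anti.map_mul _ _ _ (H.anti.map_mem _ _ hd) _ (H.anti.map_mem _ _ hy), key _ _ hv,
    smul_smul, mul_comm h.2, sgn_mul_self, one_smul] at h1
  exact (H.division.2 _ _ hy huv).mul_left_cancel h1

end Pairings

/-! ### Existence and admissibility of the parameters. -/

section Existence

variable {F : Type*} [Field F] {G : Type*} [AddCommGroup G] [DecidableEq G]
variable {D : Type*} [Ring D] [Algebra F D]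
variable {U : Type*} [AddCommGroup U] [Module F U] [Module Dᵐᵒᵖ U] [IsScalarTower F Dᵐᵒᵖ U]
variable {𝒟 : G × ZMod 2 → Submodule F D} [GradedAlgebra 𝒟]
  {𝒰 : G × ZMod 2 → Submodule F U} [DirectSum.Decomposition 𝒰]
  {φ₀ : D ≃ₗ[F] D} {b : G × ZMod 2} {δ : Fˣ} {B : U →ₗ[F] U →ₗ[F] D}
  [IsAlgClosed F] [FiniteDimensional F D] [FiniteDimensional F U]

/-- The products xy and yx lie on the same line D_{t+s}. -/
theorem IsGradedDivision.exists_commutation (hD : IsGradedDivision 𝒟) :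
    ∃ γ : gradedSupport hD → gradedSupport hD → Fˣ,
      ∀ t s : gradedSupport hD, ∀ x ∈ 𝒟 t, ∀ y ∈ 𝒟 s, x * y = γ t s • (y * x) := by
  have hX : ∀ t : gradedSupport hD, ∃ x ∈ 𝒟 (t : G × ZMod 2), x ≠ 0 := fun t =>
    Submodule.exists_mem_ne_zero_of_ne_bot t.2
  choose X hX hX0 using hX
  have h1 : ∀ t s, ∃ c : Fˣ, X t * X s = c • (X s * X t) := by
    intro t s
    have h2 := SetLike.GradedMul.mul_mem (hX s) (hX t)
    rw [add_comm] at h2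
    obtain ⟨c, hc⟩ := hD.exists_smul h2 (hD.mul_ne_zero_left (hX s) (hX0 s) (hX0 t))
      (SetLike.GradedMul.mul_mem (hX t) (hX s))
    have hc0 : c ≠ 0 := by
      rintro rfl
      rw [zero_smul] at hc
      exact hD.mul_ne_zero_left (hX t) (hX0 t) (hX0 s) hc
    exact ⟨Units.mk0 c hc0, hc⟩
  choose γ hγ using h1
  refine ⟨γ, fun t s x hx y hy => ?_⟩
  obtain ⟨a, rfl⟩ := hD.exists_smul (hX t) (hX0 t) hx
  obtain ⟨c, rfl⟩ := hD.exists_smul (hX s) (hX0 s) hy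
  simp only [smul_mul_assoc, mul_smul_comm, hγ t s]
  simp only [smul_smul, Units.smul_def]
  congr 1
  ring

/-- The commutation factor of a graded-division superalgebra. -/
theorem IsGradedDivision.exists_bicharacter (hD : IsGradedDivision 𝒟) :
    ∃ β : SuperBicharacter F (gradedSupport hD),
      ∀ t s : gradedSupport hD, ∀ x ∈ 𝒟 t, ∀ y ∈ 𝒟 s,
        x * y = (sgn F (t.1.2 * s.1.2) * β.toFun t s) • (y * x) := by
  obtain ⟨γ, hγ⟩ := hD.exists_commutation
  have hX : ∀ t : gradedSupport hD, ∃ x ∈ 𝒟 (t : G × ZMod 2), x ≠ 0 := fun t =>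
    Submodule.exists_mem_ne_zero_of_ne_bot t.2
  have hl : ∀ s t r, γ (s + t) r = γ s r * γ t r := by
    intro s t r
    obtain ⟨x, hx, hx0⟩ := hX s
    obtain ⟨y, hy, hy0⟩ := hX t
    obtain ⟨z, hz, hz0⟩ := hX r
    have h1 := hγ (s + t) r _ (SetLike.GradedMul.mul_mem hx hy) z hz
    rw [mul_assoc, hγ t r y hy z hz, mul_smul_comm, ← mul_assoc, hγ s r x hx z hz,
      smul_mul_assoc, smul_smul, mul_assoc z] at h1
    rw [mul_comm (γ s r)]
    exact (units_smul_right_cancel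
      (hD.mul_ne_zero_left hz hz0 (hD.mul_ne_zero_left hx hx0 hy0)) h1).symm
  have hinv : ∀ s t, γ s t * γ t s = 1 := by
    intro s t
    obtain ⟨x, hx, hx0⟩ := hX s
    obtain ⟨y, hy, hy0⟩ := hX t
    have h1 := hγ s t x hx y hy
    rw [hγ t s y hy x hx, smul_smul] at h1
    exact units_smul_right_cancel (hD.mul_ne_zero_left hx hx0 hy0) (by rw [← h1, one_smul])
  have hr : ∀ r s t, γ r (s + t) = γ r s * γ r t := by
    intro r s t
    rw [eq_inv_of_mul_eq_one_left (hinv r (s + t)), hl, mul_inv,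
      eq_inv_of_mul_eq_one_left (hinv r s), eq_inv_of_mul_eq_one_left (hinv r t)]
  -- Here γ is the ordinary commutation factor, an alternating bicharacter since x commutes with
  -- itself; β̃ differs from it by the super sign.
  refine ⟨⟨fun t s => sgn F (t.1.2 * s.1.2) * γ t s, ?_, ?_, ?_⟩, ?_⟩
  · intro s t r
    rw [hl, AddSubgroup.coe_add, Prod.snd_add, add_mul, sgn_add, mul_mul_mul_comm]
  · intro r s t
    rw [hr, AddSubgroup.coe_add, Prod.snd_add, mul_add, sgn_add, mul_mul_mul_comm]
  · intro t
    rw [← mul_assoc, sgn_mul_self, one_mul]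
    obtain ⟨x, hx, hx0⟩ := hX t
    exact units_smul_right_cancel (hD.mul_ne_zero_left hx hx0 hx0)
      (by rw [← hγ t t x hx x hx, one_smul])
  · intro t s x hx y hy
    rw [← mul_assoc, sgn_mul_self, one_mul, hγ t s x hx y hy]

theorem IsHermitianTriple.exists_eigenvalues [Nontrivial U]
    (H : IsHermitianTriple 𝒟 𝒰 φ₀ b δ B) :
    ∃ η : gradedSupport H.division → Fˣ, (∀ t, η t = 1 ∨ η t = -1) ∧
      ∀ t : gradedSupport H.division, ∀ x ∈ 𝒟 t, φ₀ x = η t • x := by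
  have hX : ∀ t : gradedSupport H.division, ∃ x ∈ 𝒟 (t : G × ZMod 2), x ≠ 0 := fun t =>
    Submodule.exists_mem_ne_zero_of_ne_bot t.2
  choose X hX hX0 using hX
  choose c hc using fun t => H.division.exists_smul (hX t) (hX0 t) (H.anti.map_mem _ _ (hX t))
  have h1 : ∀ t, c t * c t = 1 := by
    intro t
    have h2 := H.anti_involutive (hX t)
    rw [hc, map_smul, hc, smul_smul] at h2
    exact smul_left_injective F (hX0 t) (h2.trans (one_smul F _).symm)
  refine ⟨fun t => ⟨c t, c t, h1 t, h1 t⟩, fun t => ?_, fun t x hx => ?_⟩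
  · rcases mul_self_eq_one_iff.mp (h1 t) with h | h
    · exact Or.inl (Units.ext h)
    · exact Or.inr (Units.ext h)
  · obtain ⟨a, rfl⟩ := H.division.exists_smul (hX t) (hX0 t) hx
    rw [map_smul, hc, Units.smul_def, smul_comm]

theorem IsHermitianTriple.exists_parameters [Nontrivial U] (h2 : (2 : F) ≠ 0)
    (H : IsHermitianTriple 𝒟 𝒰 φ₀ b δ B) : ∃ P, HasParameters 𝒟 𝒰 B P := by
  obtain ⟨β, hβ⟩ := H.division.exists_bicharacter
  obtain ⟨η, hη, hφ⟩ := H.exists_eigenvalues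
  have hD := H.division
  have hT : ∀ g, g ∈ gradedSupport hD ↔ 𝒟 g ≠ ⊥ := fun g => Iff.rfl
  have hX : ∀ t : gradedSupport hD, ∃ x ∈ 𝒟 (t : G × ZMod 2), x ≠ 0 := fun t =>
    Submodule.exists_mem_ne_zero_of_ne_bot t.2
  -- Applying φ₀ to a product gives η(s+t) β̃(s,t) = η(s) η(t), so the coboundary is the inverse of
  -- β̃. It has values ±1 and hence also equals β̃.
  have hco : ∀ s t, η (s + t) * (η s)⁻¹ * (η t)⁻¹ = β.toFun s t := by
    intro s t
    obtain ⟨x, hx, hx0⟩ := hX s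
    obtain ⟨y, hy, hy0⟩ := hX t
    have h1 := H.anti.map_mul _ _ x hx y hy
    rw [hφ (s + t) _ (SetLike.GradedMul.mul_mem hx hy), hφ s x hx, hφ t y hy, smul_mul_smul_comm,
      smul_smul, hβ s t x hx y hy, smul_smul] at h1
    have h3 := units_smul_right_cancel (hD.mul_ne_zero_left hy hy0 hx0) h1
    have h4 : η (s + t) * β.toFun s t = η t * η s := by
      rw [mul_left_comm] at h3
      exact mul_left_cancel h3
    have h5 : η (s + t) * (η s)⁻¹ * (η t)⁻¹ * β.toFun s t = 1 := by
      calc _ = (η (s + t) * β.toFun s t) * (η s)⁻¹ * (η t)⁻¹ := by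
            simp only [mul_comm, mul_left_comm, mul_assoc]
        _ = 1 := by rw [h4]; simp
    have h6 : (η (s + t) * (η s)⁻¹ * (η t)⁻¹) * (η (s + t) * (η s)⁻¹ * (η t)⁻¹) = 1 := by
      rw [pm_inv (hη s), pm_inv (hη t)]
      exact pm_sq (pm_mul (pm_mul (hη _) (hη _)) (hη _))
    exact mul_left_cancel (h6.trans h5.symm)
  have hκ : ∀ g, Module.finrank Dᵐᵒᵖ (isotypic (D := D) 𝒰 (gradedSupport hD)
      (QuotientAddGroup.mk g)) = Module.finrank F (𝒰 g) := finrank_isotypic hD H.module hT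
  refine ⟨⟨gradedSupport hD, β, ⟨η, fun x => Module.finrank Dᵐᵒᵖ
    (isotypic (D := D) 𝒰 (gradedSupport hD) x), b, δ, hη, H.sign, hco, ?_, ?_, ?_⟩⟩, hT, hβ,
    ⟨φ₀, H.anti, H.sesq, H.herm, hφ⟩, fun _ => rfl⟩
  -- A finite-dimensional space has only finitely many nonzero independent summands.
  · have hfin : {g | 𝒰 g ≠ ⊥}.Finite :=
      WellFoundedGT.finite_ne_bot_of_iSupIndep
        (DirectSum.Decomposition.isInternal 𝒰).submodule_iSupIndep
    refine (hfin.image QuotientAddGroup.mk).subset ?_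
    intro x hx
    induction x using QuotientAddGroup.induction_on with
    | H g =>
      refine ⟨g, fun h => ?_, rfl⟩
      rw [Function.mem_support, hκ, h] at hx
      exact hx (finrank_bot F U)
  · intro x
    induction x using QuotientAddGroup.induction_on with
    | H g =>
      rw [← QuotientAddGroup.mk_neg, ← QuotientAddGroup.mk_sub, hκ, hκ]
      apply H.finrank_component_eq
      have : b + g + (-b - g) = 0 := by abel
      rw [this]
      exact (hT 0).mp (gradedSupport hD).zero_mem
  · intro g hg hs
    rw [hκ]
    exact H.even_finrank h2 hg (hφ ⟨_, hg⟩) hs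

theorem HasParameters.exists_triple {P : Parameters F G} (hP : HasParameters 𝒟 𝒰 B P)
    (hD : IsGradedDivision 𝒟) (hU : IsGradedRightModule 𝒟 𝒰) (hB : IsNondegenerate B) :
    ∃ φ₀, IsHermitianTriple 𝒟 𝒰 φ₀ P.inertia.g₀ P.inertia.δ B ∧
      ∀ t : P.T, ∀ x ∈ 𝒟 t, φ₀ x = P.inertia.η t • x := by
  obtain ⟨φ₀, h1, h2, h3, h4⟩ := hP.form
  exact ⟨φ₀, ⟨hD, hU, h1, h2, P.inertia.δ_sign, h3, hB⟩, h4⟩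

theorem HasParameters.κ_mk {P : Parameters F G} (hP : HasParameters 𝒟 𝒰 B P)
    (hD : IsGradedDivision 𝒟) (hU : IsGradedRightModule 𝒟 𝒰) (g : G × ZMod 2) :
    P.inertia.κ (QuotientAddGroup.mk g) = Module.finrank F (𝒰 g) := by
  rw [hP.multiplicity, finrank_isotypic hD hU hP.support]

end Existence

/-! ### Shifting the grading of U: the action of G^#. -/

section Shift

variable {F : Type*} [Field F] {G : Type*} [AddCommGroup G]
variable {D : Type*} [Ring D] [Algebra F D]
variable {U : Type*} [AddCommGroup U] [Module F U] [Module Dᵐᵒᵖ U] [IsScalarTower F Dᵐᵒᵖ U]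

/-- The grading of `U` shifted by `s`. -/
def shiftGrading (s : G × ZMod 2) (𝒰 : G × ZMod 2 → Submodule F U) :
    G × ZMod 2 → Submodule F U := fun g => 𝒰 (g - s)

variable [DecidableEq G] (𝒰 : G × ZMod 2 → Submodule F U) [DirectSum.Decomposition 𝒰]

noncomputable instance shiftGrading.decomposition (s : G × ZMod 2) :
    DirectSum.Decomposition (shiftGrading s 𝒰) := by
  apply DirectSum.IsInternal.chooseDecomposition
  have h := (DirectSum.isInternal_submodule_iff_iSupIndep_and_iSup_eq_top 𝒰).mp
    (DirectSum.Decomposition.isInternal 𝒰)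
  rw [DirectSum.isInternal_submodule_iff_iSupIndep_and_iSup_eq_top]
  exact ⟨h.1.comp (sub_left_injective (b := s)),
    ((Equiv.subRight s).iSup_comp (g := 𝒰)).trans h.2⟩

/-- The form `(-1)^{|s||u|} B(u, v)`. -/
noncomputable def shiftForm (s : G × ZMod 2) (B : U →ₗ[F] U →ₗ[F] D) : U →ₗ[F] U →ₗ[F] D :=
  B ∘ₗ degreeScale 𝒰 fun g => (sgn F (s.2 * g.2) : F)

variable {𝒰} {𝒟 : G × ZMod 2 → Submodule F D} {φ₀ : D ≃ₗ[F] D} {b : G × ZMod 2} {δ : Fˣ}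
  {B : U →ₗ[F] U →ₗ[F] D}

theorem shiftForm_apply (s : G × ZMod 2) {g : G × ZMod 2} {u : U} (hu : u ∈ shiftGrading s 𝒰 g)
    (v : U) : shiftForm 𝒰 s B u v = sgn F (s.2 * (g.2 + s.2)) • B u v := by
  rw [shiftForm, LinearMap.comp_apply, degreeScale_of_mem _ (show u ∈ 𝒰 (g - s) from hu), map_smul,
    LinearMap.smul_apply, Prod.snd_sub, CharTwo.sub_eq_add]
  rfl

theorem shiftForm_nondegenerate (s : G × ZMod 2) (hB : IsNondegenerate B) :
    IsNondegenerate (shiftForm 𝒰 s B) := by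
  intro u hu
  have h1 := hB _ hu
  let c : G × ZMod 2 → F := fun g => (sgn F (s.2 * g.2) : F)
  have h2 : degreeScale 𝒰 c ∘ₗ degreeScale 𝒰 c = LinearMap.id := by
    apply linearMap_ext_homogeneous 𝒰
    intro g u hu
    rw [LinearMap.comp_apply, degreeScale_of_mem c hu, map_smul, degreeScale_of_mem c hu,
      smul_smul, ← Units.val_mul, sgn_mul_self, Units.val_one, one_smul, LinearMap.id_apply]
  have h3 := LinearMap.congr_fun h2 u
  rw [LinearMap.comp_apply, h1, map_zero] at h3
  exact h3.symm

theorem IsGradedRightModule.shift (hU : IsGradedRightModule 𝒟 𝒰) (s : G × ZMod 2) :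
    IsGradedRightModule 𝒟 (shiftGrading s 𝒰) := by
  intro g h u hu d hd
  have := hU _ _ u hu d hd
  rwa [sub_add_eq_add_sub] at this

theorem endGrading_shift (s g : G × ZMod 2) :
    endGrading (D := D) (shiftGrading s 𝒰) g = endGrading 𝒰 g := by
  ext r
  constructor
  · intro hr h u hu
    have := hr (h + s) u (by change u ∈ 𝒰 (h + s - s); rwa [add_sub_cancel_right])
    change r u ∈ 𝒰 (g + (h + s) - s) at this
    rwa [← add_assoc, add_sub_cancel_right] at this
  · intro hr h u hu
    change r u ∈ 𝒰 (g + h - s)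
    rw [add_sub_assoc]
    exact hr _ _ hu

/-- The shift changes the sign in the adjoint identity by (-1)^{|r||s|}. The sign built into
`shiftForm` changes by the same factor from u to ru, so φ remains the superadjunction. -/
theorem IsSuperadjunction.shift {φ : Module.End Dᵐᵒᵖ U ≃ₗ[F] Module.End Dᵐᵒᵖ U}
    (hφ : IsSuperadjunction 𝒰 B φ) (s : G × ZMod 2) :
    IsSuperadjunction (shiftGrading s 𝒰) (shiftForm 𝒰 s B) φ where
  antiAut := by
    have : endGrading (D := D) (shiftGrading s 𝒰) = endGrading 𝒰 :=
      funext fun g => endGrading_shift s g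
    rw [this]
    exact hφ.antiAut
  adjoint g h r hr u hu v := by
    have hru : r u ∈ shiftGrading s 𝒰 (g + h) := hr h u hu
    rw [endGrading_shift] at hr
    rw [shiftForm_apply s hru, shiftForm_apply s hu, hφ.adjoint g _ r hr u hu v, smul_smul,
      smul_smul, ← sgn_add, ← sgn_add]
    congr 2
    rw [Prod.snd_add, Prod.snd_sub, CharTwo.sub_eq_add]
    generalize g.2 = g
    generalize h.2 = h
    generalize s.2 = s
    revert g h s
    decide

theorem IsSesquilinear.shift (H : IsSesquilinear 𝒟 𝒰 φ₀ b B) (hU : IsGradedRightModule 𝒟 𝒰)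
    (s : G × ZMod 2) :
    IsSesquilinear 𝒟 (shiftGrading s 𝒰) φ₀ (b - 2 • s) (shiftForm 𝒰 s B) where
  homogeneous g h u hu v hv := by
    rw [shiftForm_apply s hu]
    apply (𝒟 _).smul_mem
    have := H.homogeneous _ _ u hu v hv
    convert this using 2
    abel
  smul_right u v d := H.smul_right _ v d
  smul_left g h u hu d hd v := by
    rw [shiftForm_apply s (hU.shift s _ _ u hu d hd), shiftForm_apply s hu,
      H.smul_left _ _ u hu d hd, smul_smul, mul_smul_comm, smul_smul, ← sgn_add, ← sgn_add]
    congr 2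
    have h1 : (b - 2 • s).2 = b.2 := by
      rw [Prod.snd_sub, Prod.smul_snd, two_nsmul, CharTwo.add_self_eq_zero, sub_zero]
    rw [h1, Prod.snd_add, Prod.snd_sub, CharTwo.sub_eq_add]
    generalize g.2 = g
    generalize h.2 = h
    generalize s.2 = s
    generalize b.2 = b
    revert g h s b
    decide

theorem IsSuperHermitian.shift (H : IsSuperHermitian 𝒰 φ₀ δ B) (s : G × ZMod 2) :
    IsSuperHermitian (shiftGrading s 𝒰) φ₀ (sgn F s.2 * δ) (shiftForm 𝒰 s B) := by
  intro g h u hu v hv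
  have h1 := H _ _ u hu v hv
  have h2 : φ₀.symm (B v u) = (sgn F ((g - s).2 * (h - s).2) * δ) • B u v := by
    rw [mul_smul, ← h1, smul_smul, sgn_mul_self, one_smul]
  have h3 := map_sgn_smul φ₀.symm.toLinearMap (sgn F (s.2 * (h.2 + s.2))) (B v u)
  simp only [LinearEquiv.coe_coe] at h3
  rw [shiftForm_apply s hu, shiftForm_apply s hv, h3, h2, smul_smul, smul_smul, smul_smul]
  congr 1
  have h4 : g.2 * h.2 + s.2 * (h.2 + s.2) + (g.2 + s.2) * (h.2 + s.2) =
      s.2 + s.2 * (g.2 + s.2) := by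
    generalize g.2 = g
    generalize h.2 = h
    generalize s.2 = s
    revert g h s
    decide
  rw [Prod.snd_sub, Prod.snd_sub, CharTwo.sub_eq_add, CharTwo.sub_eq_add, ← mul_assoc, ← sgn_add,
    ← sgn_add, h4, sgn_add]
  simp only [mul_comm, mul_assoc]

theorem isotypic_shift (s : G × ZMod 2) (T : AddSubgroup (G × ZMod 2)) (x : (G × ZMod 2) ⧸ T) :
    isotypic (D := D) (shiftGrading s 𝒰) T x =
      isotypic 𝒰 T (-(QuotientAddGroup.mk s : (G × ZMod 2) ⧸ T) + x) := by
  rw [isotypic, isotypic]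
  congr 1
  ext u
  constructor
  · rintro ⟨g, rfl, hu⟩
    refine ⟨g - s, ?_, hu⟩
    rw [QuotientAddGroup.mk_sub]
    abel
  · rintro ⟨g, hg, hu⟩
    refine ⟨g + s, ?_, ?_⟩
    · rw [QuotientAddGroup.mk_add, hg]
      abel
    · change u ∈ 𝒰 (g + s - s)
      rwa [add_sub_cancel_right]

/-- Both arguments of B move by s, so its degree drops by 2s; φ₀ is unchanged, and the sign in
`shiftForm` multiplies δ by (-1)^{|s|}. -/
theorem HasParameters.shift {T : AddSubgroup (G × ZMod 2)} {β : SuperBicharacter F T}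
    {q : Inertia T β} (hP : HasParameters 𝒟 𝒰 B ⟨T, β, q⟩) (hU : IsGradedRightModule 𝒟 𝒰)
    (s : G × ZMod 2) :
    HasParameters 𝒟 (shiftGrading s 𝒰) (shiftForm 𝒰 s B) ⟨T, β, Inertia.actG s q⟩ where
  support := hP.support
  commutation := hP.commutation
  form := by
    obtain ⟨φ₀, h1, h2, h3, h4⟩ := hP.form
    exact ⟨φ₀, h1, h2.shift hU s, h3.shift s, h4⟩
  multiplicity x := by
    rw [isotypic_shift]
    exact hP.multiplicity _

end Shift

/-! ### Multiplying B by a homogeneous element of D: the action of T. -/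

section Twist

variable {F : Type*} [Field F] {G : Type*} [AddCommGroup G]
variable {D : Type*} [Ring D] [Algebra F D]
variable {U : Type*} [AddCommGroup U] [Module F U] [Module Dᵐᵒᵖ U] [IsScalarTower F Dᵐᵒᵖ U]

/-- The form `d B(u, v)`. -/
def twistForm (d : D) (B : U →ₗ[F] U →ₗ[F] D) : U →ₗ[F] U →ₗ[F] D :=
  B.compr₂ (LinearMap.mulLeft F d)

theorem twistForm_apply (d : D) (B : U →ₗ[F] U →ₗ[F] D) (u v : U) :
    twistForm d B u v = d * B u v := rfl

variable [DecidableEq G] {𝒟 : G × ZMod 2 → Submodule F D} [GradedAlgebra 𝒟]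
  {𝒰 : G × ZMod 2 → Submodule F U} [DirectSum.Decomposition 𝒰]
  {B : U →ₗ[F] U →ₗ[F] D} {T : AddSubgroup (G × ZMod 2)} {β : SuperBicharacter F T}

/-- Let φ act on D_t by η(t): the coboundary condition says exactly that φ reverses products with
the super sign. -/
theorem Inertia.exists_antiAut (q : Inertia T β) (hT : ∀ g, g ∈ T ↔ 𝒟 g ≠ ⊥)
    (hc : ∀ t s : T, ∀ x ∈ 𝒟 t, ∀ y ∈ 𝒟 s,
      x * y = (sgn F (t.1.2 * s.1.2) * β.toFun t s) • (y * x)) :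
    ∃ φ : D ≃ₗ[F] D, IsSuperAntiAut 𝒟 φ ∧ ∀ t : T, ∀ x ∈ 𝒟 t, φ x = q.η t • x := by
  classical
  -- The value outside T is immaterial, because the components there vanish.
  let c : G × ZMod 2 → F := fun g => if h : g ∈ T then (q.η ⟨g, h⟩ : F) else 1
  have hη : ∀ t : T, ∀ x ∈ 𝒟 t, degreeScale 𝒟 c x = q.η t • x := by
    intro t x hx
    have h1 : c t = q.η t := dif_pos t.2
    rw [degreeScale_of_mem c hx, h1]
    rfl
  have hT' : ∀ g, ∀ x ∈ 𝒟 g, x ≠ 0 → g ∈ T := fun g x hx h0 =>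
    (hT g).mpr fun h => h0 (by rwa [h, Submodule.mem_bot] at hx)
  have hinv : Function.Involutive (degreeScale 𝒟 c) := by
    have : degreeScale 𝒟 c ∘ₗ degreeScale 𝒟 c = LinearMap.id := by
      apply linearMap_ext_homogeneous 𝒟
      intro g x hx
      by_cases h0 : x = 0
      · rw [h0, map_zero, map_zero]
      rw [LinearMap.comp_apply, hη ⟨g, hT' g x hx h0⟩ x hx, map_sgn_smul,
        hη ⟨g, hT' g x hx h0⟩ x hx, smul_smul, pm_sq (q.η_sign _), one_smul, LinearMap.id_apply]
    exact LinearMap.congr_fun this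
  refine ⟨LinearEquiv.ofInvolutive _ hinv, ⟨?_, ?_⟩, hη⟩
  · intro g x hx
    change degreeScale 𝒟 c x ∈ _
    rw [degreeScale_of_mem c hx]
    exact (𝒟 g).smul_mem _ hx
  · intro g h x hx y hy
    by_cases hx0 : x = 0
    · simp [hx0]
    by_cases hy0 : y = 0
    · simp [hy0]
    have h1 := hη (⟨g, hT' g x hx hx0⟩ + ⟨h, hT' h y hy hy0⟩) _ (SetLike.GradedMul.mul_mem hx hy)
    change degreeScale 𝒟 c (x * y) = _ • (degreeScale 𝒟 c y * degreeScale 𝒟 c x)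
    rw [h1, hη ⟨g, hT' g x hx hx0⟩ x hx, hη ⟨h, hT' h y hy hy0⟩ y hy,
      hc ⟨g, hT' g x hx hx0⟩ ⟨h, hT' h y hy hy0⟩ x hx y hy, q.η_add, smul_mul_smul_comm, smul_smul,
      smul_smul]
    congr 1
    have h2 := pm_sq (q.β_sign ⟨g, hT' g x hx hx0⟩ ⟨h, hT' h y hy hy0⟩)
    generalize β.toFun ⟨g, hT' g x hx hx0⟩ ⟨h, hT' h y hy hy0⟩ = z at *
    calc _ = (z * z) * (sgn F (g.2 * h.2) *
          (q.η ⟨h, hT' h y hy hy0⟩ * q.η ⟨g, hT' g x hx hx0⟩)) := by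
            simp only [mul_comm, mul_left_comm, mul_assoc]
      _ = _ := by rw [h2, one_mul]

theorem twistForm_nondegenerate (hD : IsGradedDivision 𝒟) (hB : IsNondegenerate B)
    {t : G × ZMod 2} {d : D} (hd : d ∈ 𝒟 t) (h0 : d ≠ 0) : IsNondegenerate (twistForm d B) := by
  intro u hu
  apply hB
  intro v
  by_contra h
  exact hD.mul_ne_zero_left hd h0 h (hu v)

theorem IsSuperadjunction.twist {φ : Module.End Dᵐᵒᵖ U ≃ₗ[F] Module.End Dᵐᵒᵖ U}
    (hφ : IsSuperadjunction 𝒰 B φ) (d : D) : IsSuperadjunction 𝒰 (twistForm d B) φ where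
  antiAut := hφ.antiAut
  adjoint g h r hr u hu v := by
    rw [twistForm_apply, twistForm_apply, hφ.adjoint g h r hr u hu v, mul_smul_comm]

/-- Moving d past φ₀(x) costs the commutation factor, so φ₀ is replaced by the map with eigenvalues
β̃(t,·)η. In comparing dB(u,v) with dB(v,u) the factor β̃(t,t)η(t) = (-1)^{|t|}η(t) appears and
changes δ. -/
theorem HasParameters.twist {q : Inertia T β} (hP : HasParameters 𝒟 𝒰 B ⟨T, β, q⟩) (t : T) {d : D}
    (hd : d ∈ 𝒟 t) : HasParameters 𝒟 𝒰 (twistForm d B) ⟨T, β, Inertia.actT t q⟩ where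
  support := hP.support
  commutation := hP.commutation
  multiplicity := hP.multiplicity
  form := by
    obtain ⟨φ₀, h1, h2, h3, h4⟩ := hP.form
    obtain ⟨φ, hφ, hη⟩ := (Inertia.actT t q).exists_antiAut hP.support hP.commutation
    have hT' : ∀ g, ∀ x ∈ 𝒟 g, x ≠ 0 → g ∈ T := fun g x hx h0 =>
      (hP.support g).mpr fun h => h0 (by rwa [h, Submodule.mem_bot] at hx)
    refine ⟨φ, hφ, ⟨?_, ?_, ?_⟩, ?_, hη⟩
    · intro g h u hu v hv
      have := SetLike.GradedMul.mul_mem hd (h2.homogeneous g h u hu v hv)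
      rw [twistForm_apply]
      convert this using 2
      change (t : G × ZMod 2) + q.g₀ + g + h = t + (q.g₀ + g + h)
      abel
    · intro u v x
      rw [twistForm_apply, twistForm_apply, h2.smul_right, mul_assoc]
    · intro g h u hu x hx v
      by_cases hx0 : x = 0
      · simp [hx0]
      have hs := hT' h x hx hx0
      have hc := hP.commutation t ⟨h, hs⟩ d hd x hx
      dsimp only at hc
      rw [twistForm_apply, twistForm_apply, h2.smul_left g h u hu x hx v, hη ⟨h, hs⟩ x hx,
        h4 ⟨h, hs⟩ x hx, smul_mul_assoc, mul_smul_comm, mul_smul_comm, ← mul_assoc, hc,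
        smul_mul_assoc, smul_mul_assoc, smul_smul, smul_smul, smul_smul, mul_assoc x]
      congr 1
      change sgn F ((q.g₀.2 + g.2) * h.2) * q.η ⟨h, hs⟩ *
        (sgn F (t.1.2 * h.2) * β.toFun t ⟨h, hs⟩) =
        sgn F ((t.1.2 + q.g₀.2 + g.2) * h.2) * (β.toFun t ⟨h, hs⟩ * q.η ⟨h, hs⟩)
      have h5 : (t.1.2 + q.g₀.2 + g.2) * h.2 = (q.g₀.2 + g.2) * h.2 + t.1.2 * h.2 := by ring
      rw [h5, sgn_add]
      simp only [mul_comm, mul_left_comm, mul_assoc]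
    · intro g h u hu v hv
      have h5 := congrArg φ₀.toLinearMap (h3 g h u hu v hv)
      rw [map_sgn_smul, map_sgn_smul] at h5
      simp only [LinearEquiv.coe_coe, LinearEquiv.apply_symm_apply] at h5
      apply φ.injective
      have h6 := map_sgn_smul φ.toLinearMap
      simp only [LinearEquiv.coe_coe] at h6
      rw [h6, h6, LinearEquiv.apply_symm_apply, twistForm_apply, twistForm_apply, ← mul_smul_comm,
        h5]
      by_cases hx0 : B u v = 0
      · simp [hx0]
      have hx := h2.homogeneous g h u hu v hv
      have hs := hT' _ _ hx hx0
      rw [h4 ⟨_, hs⟩ _ hx, hη (t + ⟨_, hs⟩) _ (SetLike.GradedMul.mul_mem hd hx), mul_smul_comm,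
        mul_smul_comm, smul_smul, smul_smul]
      congr 1
      change q.δ * q.η ⟨_, hs⟩ = sgn F t.1.2 * q.η t * q.δ *
        (β.toFun t (t + ⟨_, hs⟩) * q.η (t + ⟨_, hs⟩))
      rw [β.add_right, q.η_add, β.self]
      have h7 := pm_sq (q.β_sign t ⟨_, hs⟩)
      have h8 := pm_sq (q.η_sign t)
      have h9 := sgn_mul_self F t.1.2
      generalize β.toFun t ⟨_, hs⟩ = z at *
      generalize q.η t = y at *
      generalize sgn F t.1.2 = w at *
      calc _ = (w * w) * (z * z) * (y * y) * (q.δ * q.η ⟨_, hs⟩) := by rw [h7, h8, h9]; simp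
        _ = _ := by simp only [mul_comm, mul_left_comm, mul_assoc]

end Twist

/-! ### Transport of structure along isomorphisms of pairs (D, U). -/

section Transport

variable {F : Type*} [Field F] {G : Type*} [AddCommGroup G] [DecidableEq G]
variable {D : Type*} [Ring D] [Algebra F D]
variable {U : Type*} [AddCommGroup U] [Module F U] [Module Dᵐᵒᵖ U] [IsScalarTower F Dᵐᵒᵖ U]
variable {D' : Type*} [Ring D'] [Algebra F D']
variable {U' : Type*} [AddCommGroup U'] [Module F U'] [Module D'ᵐᵒᵖ U'] [IsScalarTower F D'ᵐᵒᵖ U']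
variable {𝒟 : G × ZMod 2 → Submodule F D} {𝒰 : G × ZMod 2 → Submodule F U}
  {𝒟' : G × ZMod 2 → Submodule F D'} {𝒰' : G × ZMod 2 → Submodule F U'}
  {α : D ≃ₐ[F] D'} {θ : U ≃ₗ[F] U'}
  {B : U →ₗ[F] U →ₗ[F] D} {B' : U' →ₗ[F] U' →ₗ[F] D'}

/-- An isomorphism of graded pairs `(D, U)`. -/
structure IsGradedPairEquiv (𝒟 : G × ZMod 2 → Submodule F D) (𝒰 : G × ZMod 2 → Submodule F U)
    (𝒟' : G × ZMod 2 → Submodule F D') (𝒰' : G × ZMod 2 → Submodule F U') (α : D ≃ₐ[F] D')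
    (θ : U ≃ₗ[F] U') : Prop where
  algebra_mem : ∀ g, ∀ d ∈ 𝒟 g, α d ∈ 𝒟' g
  module_mem : ∀ g, ∀ u ∈ 𝒰 g, θ u ∈ 𝒰' g
  semilinear : ∀ u d, θ (op d • u) = op (α d) • θ u

variable [GradedAlgebra 𝒟] [DirectSum.Decomposition 𝒰] [GradedAlgebra 𝒟']
  [DirectSum.Decomposition 𝒰']

theorem IsGradedPairEquiv.symm (E : IsGradedPairEquiv 𝒟 𝒰 𝒟' 𝒰' α θ) :
    IsGradedPairEquiv 𝒟' 𝒰' 𝒟 𝒰 α.symm θ.symm where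
  algebra_mem := symm_mem_of_graded α.toLinearEquiv E.algebra_mem
  module_mem := symm_mem_of_graded θ E.module_mem
  semilinear u d := by
    apply θ.injective
    rw [E.semilinear, LinearEquiv.apply_symm_apply, LinearEquiv.apply_symm_apply,
      AlgEquiv.apply_symm_apply]

theorem IsGradedPairEquiv.ne_bot (E : IsGradedPairEquiv 𝒟 𝒰 𝒟' 𝒰' α θ) {g : G × ZMod 2}
    (h : 𝒟 g ≠ ⊥) : 𝒟' g ≠ ⊥ := by
  obtain ⟨x, hx, hx0⟩ := Submodule.exists_mem_ne_zero_of_ne_bot h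
  intro h'
  have := E.algebra_mem g x hx
  rw [h', Submodule.mem_bot] at this
  exact hx0 (α.injective (this.trans (map_zero α).symm))

theorem IsGradedPairEquiv.finrank_le [FiniteDimensional F U']
    (E : IsGradedPairEquiv 𝒟 𝒰 𝒟' 𝒰' α θ) (g : G × ZMod 2) :
    Module.finrank F (𝒰 g) ≤ Module.finrank F (𝒰' g) :=
  LinearMap.finrank_le_finrank_of_injective (f := θ.toLinearMap.restrict (E.module_mem g))
    fun _ _ h => Subtype.ext (θ.injective (congrArg Subtype.val h))

theorem HasParameters.transport [IsAlgClosed F] [FiniteDimensional F D] [FiniteDimensional F U]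
    [FiniteDimensional F D'] [FiniteDimensional F U'] (E : IsGradedPairEquiv 𝒟 𝒰 𝒟' 𝒰' α θ)
    (hB : ∀ u v, α (B u v) = B' (θ u) (θ v))
    (hD : IsGradedDivision 𝒟) (hU : IsGradedRightModule 𝒟 𝒰)
    (hD' : IsGradedDivision 𝒟') (hU' : IsGradedRightModule 𝒟' 𝒰')
    {P : Parameters F G} (hP : HasParameters 𝒟 𝒰 B P) : HasParameters 𝒟' 𝒰' B' P := by
  have hB' : ∀ u v, B' u v = α (B (θ.symm u) (θ.symm v)) := fun u v => by
    rw [hB, LinearEquiv.apply_symm_apply, LinearEquiv.apply_symm_apply]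
  have hsupp : ∀ g, g ∈ P.T ↔ 𝒟' g ≠ ⊥ := fun g =>
    (hP.support g).trans ⟨E.ne_bot, E.symm.ne_bot⟩
  have hα : ∀ (c : Fˣ) d, α (c • d) = c • α d := map_sgn_smul α.toLinearEquiv.toLinearMap
  refine ⟨hsupp, ?_, ?_, ?_⟩
  · intro t s x hx y hy
    apply α.symm.injective
    rw [map_mul, hP.commutation t s _ (E.symm.algebra_mem _ x hx) _ (E.symm.algebra_mem _ y hy)]
    apply α.injective
    rw [hα, map_mul]
    simp
  · obtain ⟨φ₀, h1, h2, h3, h4⟩ := hP.form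
    let φ : D' ≃ₗ[F] D' := (α.symm.toLinearEquiv.trans φ₀).trans α.toLinearEquiv
    have hφ : ∀ x, φ x = α (φ₀ (α.symm x)) := fun x => rfl
    have hφs : ∀ x, φ.symm x = α (φ₀.symm (α.symm x)) := fun x => rfl
    refine ⟨φ, ⟨?_, ?_⟩, ⟨?_, ?_, ?_⟩, ?_, ?_⟩
    · intro g a ha
      exact E.algebra_mem _ _ (h1.map_mem _ _ (E.symm.algebra_mem _ _ ha))
    · intro g h a ha c hc
      rw [hφ, map_mul, h1.map_mul _ _ _ (E.symm.algebra_mem _ a ha) _ (E.symm.algebra_mem _ c hc),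
        hα, map_mul, hφ, hφ]
    · intro g h u hu v hv
      rw [hB']
      exact E.algebra_mem _ _ (h2.homogeneous _ _ _ (E.symm.module_mem _ _ hu) _
        (E.symm.module_mem _ _ hv))
    · intro u v d
      rw [hB', hB', E.symm.semilinear, h2.smul_right, map_mul, AlgEquiv.apply_symm_apply]
    · intro g h u hu d hd v
      rw [hB', hB', E.symm.semilinear, h2.smul_left _ _ _ (E.symm.module_mem _ _ hu) _
        (E.symm.algebra_mem _ _ hd), hα, map_mul, hφ]
    · intro g h u hu v hv
      rw [hB', hB', hφs, AlgEquiv.symm_apply_apply, ← hα, ← hα,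
        h3 _ _ _ (E.symm.module_mem _ _ hu) _ (E.symm.module_mem _ _ hv)]
    · intro t x hx
      rw [hφ, h4 t _ (E.symm.algebra_mem _ _ hx), hα, AlgEquiv.apply_symm_apply]
  · intro x
    induction x using QuotientAddGroup.induction_on with
    | H g =>
      rw [finrank_isotypic hD' hU' hsupp, hP.κ_mk hD hU]
      exact le_antisymm (E.finrank_le g) (E.symm.finrank_le g)

/-- Conjugation by `θ` as a linear map on `End_D(U)`. -/
def IsGradedPairEquiv.conjFun (E : IsGradedPairEquiv 𝒟 𝒰 𝒟' 𝒰' α θ) (r : Module.End Dᵐᵒᵖ U) :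
    Module.End D'ᵐᵒᵖ U' where
  toFun u := θ (r (θ.symm u))
  map_add' u v := by rw [map_add, map_add, map_add]
  map_smul' c u := by
    rw [← op_unop c, E.symm.semilinear, end_op_smul, E.semilinear, AlgEquiv.apply_symm_apply,
      RingHom.id_apply]

/-- Conjugation by `θ` as an isomorphism of algebras `End_D(U) ≃ End_{D'}(U')`. -/
def IsGradedPairEquiv.conj (E : IsGradedPairEquiv 𝒟 𝒰 𝒟' 𝒰' α θ) :
    Module.End Dᵐᵒᵖ U ≃ₐ[F] Module.End D'ᵐᵒᵖ U' where
  toFun := E.conjFun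
  invFun := E.symm.conjFun
  left_inv r := by ext u; simp [conjFun]
  right_inv r := by ext u; simp [conjFun]
  map_mul' r s := by ext; simp [conjFun]
  map_add' r s := by ext u; simp [conjFun]
  commutes' c := by ext u; simp [conjFun]

theorem IsGradedPairEquiv.conj_apply (E : IsGradedPairEquiv 𝒟 𝒰 𝒟' 𝒰' α θ)
    (r : Module.End Dᵐᵒᵖ U) (u : U) : E.conj r (θ u) = θ (r u) := by
  change θ (r (θ.symm (θ u))) = _
  rw [LinearEquiv.symm_apply_apply]

theorem IsGradedPairEquiv.conj_mem (E : IsGradedPairEquiv 𝒟 𝒰 𝒟' 𝒰' α θ) {g : G × ZMod 2}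
    {r : Module.End Dᵐᵒᵖ U} (hr : r ∈ endGrading 𝒰 g) : E.conj r ∈ endGrading 𝒰' g :=
  fun h _ hu => E.module_mem _ _ (hr h _ (E.symm.module_mem _ _ hu))

theorem IsSuperadjunction.isomorphic [IsAlgClosed F] [FiniteDimensional F D]
    [FiniteDimensional F U] {φ₀ : D ≃ₗ[F] D} {b : G × ZMod 2} {δ : Fˣ}
    {φ₀' : D' ≃ₗ[F] D'} {b' : G × ZMod 2} {δ' : Fˣ}
    (E : IsGradedPairEquiv 𝒟 𝒰 𝒟' 𝒰' α θ)
    (hB : ∀ u v, α (B u v) = B' (θ u) (θ v)) (H : IsHermitianTriple 𝒟 𝒰 φ₀ b δ B)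
    (H' : IsHermitianTriple 𝒟' 𝒰' φ₀' b' δ' B')
    {φ : Module.End Dᵐᵒᵖ U ≃ₗ[F] Module.End Dᵐᵒᵖ U}
    {φ' : Module.End D'ᵐᵒᵖ U' ≃ₗ[F] Module.End D'ᵐᵒᵖ U'}
    (hφ : IsSuperadjunction 𝒰 B φ) (hφ' : IsSuperadjunction 𝒰' B' φ') :
    IsomorphicSuper (endGrading 𝒰) φ (endGrading 𝒰') φ' := by
  refine ⟨E.conj, fun g r hr => E.conj_mem hr, fun r => ?_⟩
  induction r using H.end_induction' with
  | ha r s hr hs => simp only [map_add, hr, hs]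
  | hr g r hr =>
    ext v
    apply H'.ext_right
    intro h u hu
    have h1 := hφ'.adjoint g h _ (E.conj_mem hr) u hu v
    have h2 := congrArg α (hφ.adjoint g h r hr _ (E.symm.module_mem _ _ hu) (θ.symm v))
    have hα : ∀ (c : Fˣ) d, α (c • d) = c • α d := map_sgn_smul α.toLinearEquiv.toLinearMap
    rw [hB, hα, hB, LinearEquiv.apply_symm_apply, LinearEquiv.apply_symm_apply,
      ← E.conj_apply, ← E.conj_apply, LinearEquiv.apply_symm_apply, LinearEquiv.apply_symm_apply,
      h1] at h2
    exact (smul_left_cancel _ h2).symm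

end Transport

/-! ### Forms with the same superadjunction are proportional. -/

section Proportionality

variable {F : Type*} [Field F] {G : Type*} [AddCommGroup G] [DecidableEq G]
variable {D : Type*} [Ring D] [Algebra F D]
variable {U : Type*} [AddCommGroup U] [Module F U] [Module Dᵐᵒᵖ U] [IsScalarTower F Dᵐᵒᵖ U]
variable {𝒟 : G × ZMod 2 → Submodule F D} {𝒰 : G × ZMod 2 → Submodule F U}
  [GradedAlgebra 𝒟] [DirectSum.Decomposition 𝒰]
  {φ₁ φ₂ : D ≃ₗ[F] D} {b₁ b₂ : G × ZMod 2} {δ₁ δ₂ : Fˣ}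
  {B₁ B₂ : U →ₗ[F] U →ₗ[F] D}
  [IsAlgClosed F] [FiniteDimensional F D] [FiniteDimensional F U]

/-- The adjoint identity of B₂, applied at x to the operator w B₁(u,·), whose adjoint is ± u
B₁(w,·), reads φ₂(B₁(u,x)) B₂(w,v) = ± B₂(x,u) B₁(w,v). Fixing u and x with B₁(u,x) ≠ 0 yields d = ±
φ₂(B₁(u,x))⁻¹ B₂(x,u). -/
theorem IsHermitianTriple.exists_twist [Nontrivial U] (H₁ : IsHermitianTriple 𝒟 𝒰 φ₁ b₁ δ₁ B₁)
    (H₂ : IsHermitianTriple 𝒟 𝒰 φ₂ b₂ δ₂ B₂)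
    {φ : Module.End Dᵐᵒᵖ U ≃ₗ[F] Module.End Dᵐᵒᵖ U}
    (h₁ : IsSuperadjunction 𝒰 B₁ φ) (h₂ : IsSuperadjunction 𝒰 B₂ φ) :
    ∃ t, ∃ d ∈ 𝒟 t, d ≠ 0 ∧ B₂ = twistForm d B₁ := by
  obtain ⟨h, k, u, hu, x, hx, hux⟩ := H₁.nondeg.exists_homogeneous (𝒰 := 𝒰)
  have hy := H₁.sesq.homogeneous _ _ _ hu _ hx
  have hy0 : φ₂ (B₁ u x) ≠ 0 := fun h => hux (φ₂.injective (h.trans (map_zero φ₂).symm))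
  obtain ⟨z, hz, -, hzy⟩ := H₂.division.exists_inv (H₂.anti.map_mem _ _ hy) hy0
  let c : Fˣ := sgn F ((b₂.2 * (b₁.2 + h.2 + k.2)) + ((b₁.2 + h.2) * k.2) +
    (b₁.2 * (b₁.2 + h.2))) * δ₁
  have key : ∀ w v, B₂ w v = (c • (z * B₂ x u)) * B₁ w v := by
    intro w v
    induction w using homogeneous_induction 𝒰 with
    | h0 => simp
    | ha w w' hw hw' => simp only [map_add, LinearMap.add_apply, hw, hw', mul_add]
    | hh g w hw =>
      have h3 := h₂.adjoint _ _ _ (rankOne_mem H₁.sesq H₁.module hw hu) x hx v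
      rw [rankOne_apply, H₂.sesq.smul_left _ _ _ hw _ hy] at h3
      have h4 := H₁.adjoint_rankOne (Φ := φ.toLinearMap) h₁.adjoint hw hu
      rw [LinearEquiv.coe_coe] at h4
      rw [h4, LinearMap.smul_apply, map_sgn_smul, rankOne_apply, H₂.sesq.smul_right, smul_smul]
        at h3
      have h5 := congrArg (fun y => sgn F ((b₂.2 + g.2) * (b₁ + h + k).2) • (z * y)) h3
      rw [mul_smul_comm, mul_smul_comm, smul_smul, smul_smul, sgn_mul_self, one_smul, ← mul_assoc,
        hzy, one_mul] at h5
      rw [h5, smul_mul_assoc, mul_assoc]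
      congr 1
      simp only [Prod.snd_add, c]
      -- The terms containing the parity of w cancel modulo 2, so the same d serves all w.
      have h6 : b₂.2 * (b₁.2 + h.2 + k.2) + (b₁.2 + h.2) * k.2 + b₁.2 * (b₁.2 + h.2) =
          (b₂.2 + g.2) * (b₁.2 + h.2 + k.2) + (g.2 + b₁.2 + h.2) * k.2 +
            (b₁.2 + g.2) * (b₁.2 + h.2) := by
        generalize g.2 = g
        generalize h.2 = h
        generalize k.2 = k
        generalize b₁.2 = b
        generalize b₂.2 = b'
        revert g h k b b'
        decide
      rw [h6, sgn_add, sgn_add]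
      simp only [mul_comm, mul_left_comm, mul_assoc]
  refine ⟨_, c • (z * B₂ x u), (𝒟 _).smul_mem _ (SetLike.GradedMul.mul_mem hz
    (H₂.sesq.homogeneous _ _ _ hx _ hu)), ?_, LinearMap.ext₂ key⟩
  intro h0
  obtain ⟨_, _, w, -, v, -, hwv⟩ := H₂.nondeg.exists_homogeneous (𝒰 := 𝒰)
  exact hwv (by rw [key, h0, zero_mul])

end Proportionality

/-! ### Recovering (D, U) and B, up to shift and twist, from the endomorphism algebra. -/

section Reconstruction

variable {F : Type*} [Field F] {G : Type*} [AddCommGroup G] [DecidableEq G]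
variable {D : Type*} [Ring D] [Algebra F D]
variable {U : Type*} [AddCommGroup U] [Module F U] [Module Dᵐᵒᵖ U] [IsScalarTower F Dᵐᵒᵖ U]
variable {D' : Type*} [Ring D'] [Algebra F D']
variable {U' : Type*} [AddCommGroup U'] [Module F U'] [Module D'ᵐᵒᵖ U'] [IsScalarTower F D'ᵐᵒᵖ U']
variable {𝒟 : G × ZMod 2 → Submodule F D} {𝒰 : G × ZMod 2 → Submodule F U}
  {𝒟' : G × ZMod 2 → Submodule F D'} {𝒰' : G × ZMod 2 → Submodule F U'}
  {B : U →ₗ[F] U →ₗ[F] D} {B' : U' →ₗ[F] U' →ₗ[F] D'}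
  {φ₀ : D ≃ₗ[F] D} {b : G × ZMod 2} {δ : Fˣ}
  {φ₀' : D' ≃ₗ[F] D'} {b' : G × ZMod 2} {δ' : Fˣ}
  [GradedAlgebra 𝒟] [DirectSum.Decomposition 𝒰] [GradedAlgebra 𝒟'] [DirectSum.Decomposition 𝒰']

theorem injective_of_graded {f : U →ₗ[F] U'} (hf : ∀ g, ∀ u ∈ 𝒰 g, f u ∈ 𝒰' g)
    (h : ∀ g, ∀ u ∈ 𝒰 g, f u = 0 → u = 0) : Function.Injective f := by
  rw [← LinearMap.ker_eq_bot, LinearMap.ker_eq_bot']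
  intro u hu
  apply eq_zero_of_homComponent 𝒰
  intro k
  apply h k _ (homComponent_mem 𝒰 k u)
  have key : homComponent 𝒰' k ∘ₗ f = f ∘ₗ homComponent 𝒰 k := by
    apply linearMap_ext_homogeneous 𝒰
    intro g u hu
    simp only [LinearMap.comp_apply, homComponent_of_mem k hu, homComponent_of_mem k (hf g u hu)]
    split_ifs <;> simp
  have := LinearMap.congr_fun key u
  rw [LinearMap.comp_apply, hu, map_zero] at this
  exact this.symm

variable [IsAlgClosed F] [FiniteDimensional F D] [FiniteDimensional F U]
  [FiniteDimensional F D'] [FiniteDimensional F U']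

/-- In degree -b - h the values B(w,u) lie in D_0 = F·1, so a nonzero value can be normalized to 1.
-/
theorem IsHermitianTriple.exists_dual_vector (H : IsHermitianTriple 𝒟 𝒰 φ₀ b δ B)
    {h : G × ZMod 2} {u : U} (hu : u ∈ 𝒰 h) (h0 : u ≠ 0) : ∃ w ∈ 𝒰 (-b - h), B w u = 1 := by
  have he : b + (-b - h) + h = 0 := by abel
  have h1 : ∃ w ∈ 𝒰 (-b - h), B w u ≠ 0 := by
    by_contra! hw
    refine h0 (H.nondeg_right_component ?_ hu hw)
    rw [he]
    exact (gradedSupport H.division).zero_mem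
  obtain ⟨w, hw, hwu⟩ := h1
  have h2 := H.sesq.homogeneous _ _ _ hw _ hu
  rw [he] at h2
  obtain ⟨c, hc⟩ := H.division.eq_smul_one h2
  have hc0 : c ≠ 0 := by
    rintro rfl
    exact hwu (by rw [hc, zero_smul])
  refine ⟨c⁻¹ • w, (𝒰 _).smul_mem _ hw, ?_⟩
  rw [map_smul, LinearMap.smul_apply, hc, smul_smul, inv_mul_cancel₀ hc0, one_smul]

/-- A graded isomorphism `End_D(U) ≃ End_{D'}(U')` is induced by an isomorphism of pairs, up to a
shift of the grading. -/
theorem IsHermitianTriple.exists_pairEquiv [Nontrivial U] (H : IsHermitianTriple 𝒟 𝒰 φ₀ b δ B)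
    (H' : IsHermitianTriple 𝒟' 𝒰' φ₀' b' δ' B')
    (ψ : Module.End Dᵐᵒᵖ U ≃ₐ[F] Module.End D'ᵐᵒᵖ U')
    (hψ : ∀ g, ∀ r ∈ endGrading (D := D) 𝒰 g, ψ r ∈ endGrading 𝒰' g) :
    ∃ (s : G × ZMod 2) (α : D ≃ₐ[F] D') (θ : U ≃ₗ[F] U'),
      IsGradedPairEquiv 𝒟 (shiftGrading s 𝒰) 𝒟' 𝒰' α θ ∧ ∀ r u, θ (r u) = ψ r (θ u) := by
  obtain ⟨-, h, x, -, u, hu, hBu⟩ := H.nondeg.exists_homogeneous (𝒰 := 𝒰)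
  have hu0 : u ≠ 0 := by
    rintro rfl
    exact hBu (map_zero _)
  obtain ⟨w, hw, hwu⟩ := H.exists_dual_vector hu hu0
  -- Since B(w,u) = 1, the operator e = u B(w,·) is an idempotent of degree 0 fixing u. A nonzero
  -- homogeneous vector u' in the image of ψ(e) will be the image of u.
  have he0 : ψ (rankOne H.sesq u w) ≠ 0 := by
    intro h0
    have h1 : rankOne H.sesq u w = 0 := ψ.injective (h0.trans (map_zero ψ).symm)
    have h2 := LinearMap.congr_fun h1 u
    rw [rankOne_apply, hwu, op_one, one_smul] at h2
    exact hu0 h2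
  have he0' : (ψ (rankOne H.sesq u w)).restrictScalars F ≠ 0 := fun h0 =>
    he0 (LinearMap.restrictScalars_injective F h0)
  obtain ⟨k, v, hv, hev⟩ := exists_homogeneous_ne_zero 𝒰' he0'
  change ψ (rankOne H.sesq u w) v ≠ 0 at hev
  have hee : ψ (rankOne H.sesq u w) (ψ (rankOne H.sesq u w) v) = ψ (rankOne H.sesq u w) v := by
    rw [← Module.End.mul_apply, ← map_mul, mul_rankOne, rankOne_apply, hwu, op_one, one_smul]
  have hvk : ψ (rankOne H.sesq u w) v ∈ 𝒰' k := by
    have := hψ _ _ (rankOne_mem H.sesq H.module hu hw) k v hv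
    have e : h + b + (-b - h) + k = k := by abel
    rwa [e] at this
  generalize ψ (rankOne H.sesq u w) v = u' at *
  clear hv v he0 he0'
  obtain ⟨w', hw', hwu'⟩ := H'.exists_dual_vector hvk hev
  -- Identify U with the left ideal End_D(U)·e by x ↦ x B(w,·), and evaluate the image under ψ at
  -- u'.
  let Θ : U →ₗ[F] U' :=
    { toFun := fun x => ψ (rankOne H.sesq x w) u'
      map_add' := fun x y => by rw [rankOne_add_left, map_add, LinearMap.add_apply]
      map_smul' := fun c x => by
        rw [rankOne_smul_left, map_smul, LinearMap.smul_apply, RingHom.id_apply] }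
  have hΘ : ∀ r x, Θ (r x) = ψ r (Θ x) := by
    intro r x
    change ψ (rankOne H.sesq (r x) w) u' = ψ r (ψ (rankOne H.sesq x w) u')
    rw [← mul_rankOne, map_mul, Module.End.mul_apply]
  have hΘu : Θ u = u' := hee
  have hgr : ∀ g, ∀ x ∈ shiftGrading (k - h) 𝒰 g, Θ x ∈ 𝒰' g := by
    intro g x hx
    have := hψ _ _ (rankOne_mem H.sesq H.module hx hw) k u' hvk
    change ψ (rankOne H.sesq x w) u' ∈ _
    convert this using 2
    abel
  have hinj : Function.Injective Θ := by
    apply injective_of_graded hgr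
    intro g x hx hx0
    by_contra hne
    -- The operator u B(y,·) carries x to u, so Θ x = 0 would force u' = Θ u = 0.
    obtain ⟨y, -, hyx⟩ := H.exists_dual_vector (show x ∈ 𝒰 (g - (k - h)) from hx) hne
    have h1 := hΘ (rankOne H.sesq u y) x
    rw [hx0, map_zero, rankOne_apply, hyx, op_one, one_smul, hΘu] at h1
    exact hev h1
  have hlift : ∀ v', Θ (ψ.symm (rankOne H'.sesq v' w') u) = v' := by
    intro v'
    rw [hΘ, AlgEquiv.apply_symm_apply, hΘu, rankOne_apply, hwu', op_one, one_smul]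
  let θ : U ≃ₗ[F] U' := LinearEquiv.ofBijective Θ ⟨hinj, fun v' => ⟨_, hlift v'⟩⟩
  -- The coefficient a(d) in Θ(ud) = u' a(d) is extracted by pairing with w', because B'(w',u') = 1.
  let a : D →ₗ[F] D' := B' w' ∘ₗ Θ ∘ₗ orbitMap F u
  have ha : ∀ d, a d = B' w' (Θ (op d • u)) := fun d => rfl
  have hsemi : ∀ x d, Θ (op d • x) = op (a d) • Θ x := by
    intro x d
    -- Every x is the image of u under an endomorphism, and endomorphisms commute with d; the
    -- computation of Θ(xd) thus reduces to Θ(ud).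
    have h1 : ψ.symm (rankOne H'.sesq (Θ x) w') u = x := hinj (hlift (Θ x))
    conv_lhs => rw [← h1, ← end_op_smul, hΘ, AlgEquiv.apply_symm_apply, rankOne_apply]
    rw [ha]
  have ha1 : a 1 = 1 := by rw [ha, op_one, one_smul, hΘu, hwu']
  have hamul : ∀ d d', a (d * d') = a d * a d' := by
    intro d d'
    rw [ha, ← op_smul_op_smul, hsemi, H'.sesq.smul_right, ← ha]
  have hainj : Function.Injective a := by
    rw [← LinearMap.ker_eq_bot, LinearMap.ker_eq_bot']
    intro d hd
    have h1 := hsemi u d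
    rw [hd, op_zero, zero_smul] at h1
    have h2 : op d • u = 0 := hinj (h1.trans (map_zero Θ).symm)
    have h3 := H.sesq.smul_right w u d
    rw [h2, map_zero, hwu, one_mul] at h3
    exact h3.symm
  have hasurj : Function.Surjective a := by
    intro d'
    obtain ⟨x, hx⟩ : ∃ x, Θ x = op d' • u' := ⟨_, hlift _⟩
    -- The vector u'd' is fixed by ψ(e), so its preimage x is fixed by e, that is, x = u B(w,x).
    have h1 : rankOne H.sesq u w x = x := by
      apply hinj
      have h2 : ψ (rankOne H.sesq u w) u' = u' := hee
      rw [hΘ, hx, end_op_smul, h2]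
    refine ⟨B w x, ?_⟩
    rw [ha, ← rankOne_apply H.sesq u w x, h1, hx, H'.sesq.smul_right, hwu', one_mul]
  let α : D ≃ₐ[F] D' := AlgEquiv.ofBijective (AlgHom.ofLinearMap a ha1 hamul) ⟨hainj, hasurj⟩
  refine ⟨k - h, α, θ, ⟨?_, hgr, hsemi⟩, hΘ⟩
  intro g d hd
  have h1 : Θ (op d • u) ∈ 𝒰' (k + g) := by
    apply hgr
    have := H.module _ _ u hu d hd
    change op d • u ∈ 𝒰 (k + g - (k - h))
    convert this using 2
    abel
  have := H'.sesq.homogeneous _ _ _ hw' _ h1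
  change B' w' (Θ (op d • u)) ∈ 𝒟' g
  convert this using 2
  abel

/-- Isomorphic superalgebras with superadjunction have parameters in the same orbit. -/
theorem HasParameters.eq_act_of_isomorphic [Nontrivial U]
    (hD : IsGradedDivision 𝒟) (hU : IsGradedRightModule 𝒟 𝒰) (hB : IsNondegenerate B)
    (hD' : IsGradedDivision 𝒟') (hU' : IsGradedRightModule 𝒟' 𝒰') (hB' : IsNondegenerate B')
    {T : AddSubgroup (G × ZMod 2)} {β : SuperBicharacter F T} {q : Inertia T β}
    {P' : Parameters F G} (hP : HasParameters 𝒟 𝒰 B ⟨T, β, q⟩) (hP' : HasParameters 𝒟' 𝒰' B' P')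
    {φ : Module.End Dᵐᵒᵖ U ≃ₗ[F] Module.End Dᵐᵒᵖ U}
    {φ' : Module.End D'ᵐᵒᵖ U' ≃ₗ[F] Module.End D'ᵐᵒᵖ U'}
    (hφ : IsSuperadjunction 𝒰 B φ) (hφ' : IsSuperadjunction 𝒰' B' φ')
    (hiso : IsomorphicSuper (endGrading 𝒰) φ (endGrading 𝒰') φ') :
    ∃ (t : T) (s : G × ZMod 2), P' = ⟨T, β, Inertia.actT t (Inertia.actG s q)⟩ := by
  obtain ⟨ψ, hψ, hψφ⟩ := hiso
  obtain ⟨φ₀, H, -⟩ := hP.exists_triple hD hU hB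
  obtain ⟨φ₀', H', -⟩ := hP'.exists_triple hD' hU' hB'
  obtain ⟨s, α, θ, E, hθ⟩ := H.exists_pairEquiv H' ψ hψ
  -- Pull B' back to the shifted U. Because ψ intertwines the superadjunctions, this form and the
  -- shifted B have the same superadjunction φ and hence differ by a twist.
  let B₂ : U →ₗ[F] U →ₗ[F] D := (B'.compl₁₂ θ.toLinearMap θ.toLinearMap).compr₂
    α.symm.toLinearEquiv.toLinearMap
  have hB₂ : ∀ u v, B₂ u v = α.symm (B' (θ u) (θ v)) := fun u v => rfl
  have hB₂' : ∀ u v, α.symm (B' u v) = B₂ (θ.symm u) (θ.symm v) := fun u v => by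
    rw [hB₂, LinearEquiv.apply_symm_apply, LinearEquiv.apply_symm_apply]
  have hn₂ : IsNondegenerate B₂ := by
    intro u hu
    apply θ.injective
    rw [map_zero]
    apply hB'
    intro v
    apply α.symm.injective
    rw [hB₂', LinearEquiv.symm_apply_apply, hu, map_zero]
  have hP₂ := hP'.transport E.symm hB₂' hD' hU' hD (hU.shift s)
  have hP₁ := hP.shift hU s
  obtain ⟨φ₁, H₁, -⟩ := hP₁.exists_triple hD (hU.shift s) (shiftForm_nondegenerate s hB)
  obtain ⟨φ₂, H₂, -⟩ := hP₂.exists_triple hD (hU.shift s) hn₂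
  have hφ₂ : IsSuperadjunction (shiftGrading s 𝒰) B₂ φ := by
    refine ⟨(hφ.shift s).antiAut, fun g h r hr u hu v => ?_⟩
    have hr' : ψ r ∈ endGrading 𝒰' g := hψ g r (by rwa [endGrading_shift] at hr)
    have hα : ∀ (c : Fˣ) d, α.symm (c • d) = c • α.symm d :=
      map_sgn_smul α.symm.toLinearEquiv.toLinearMap
    rw [hB₂, hθ, hφ'.adjoint g h _ hr' _ (E.module_mem _ _ hu), ← hψφ, hα, ← hθ, hB₂]
  obtain ⟨t, d, hd, hd0, hBd⟩ := H₁.exists_twist H₂ (hφ.shift s) hφ₂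
  have ht : t ∈ T := (hP.support t).mpr fun h => hd0 (by rwa [h, Submodule.mem_bot] at hd)
  refine ⟨⟨t, ht⟩, s, ?_⟩
  have hP₃ := hP₁.twist ⟨t, ht⟩ hd
  rw [← hBd] at hP₃
  exact hP₂.unique hD hn₂ hP₃

end Reconstruction

/-! ### Common eigenvectors of commuting operators. -/

section CommonEigenvector

variable {F : Type*} [Field F] [IsAlgClosed F] {V : Type*} [AddCommGroup V] [Module F V]
  [FiniteDimensional F V] [Nontrivial V]

/-- On a minimal nonzero subspace invariant under all f_i, any eigenspace of one f_i is nonzero and,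
by commutativity, again invariant; it is therefore the whole subspace. -/
theorem exists_common_eigenvector {ι : Type*} (f : ι → Module.End F V)
    (hf : ∀ i j, Commute (f i) (f j)) : ∃ v, v ≠ 0 ∧ ∀ i, ∃ c : F, f i v = c • v := by
  obtain ⟨W, ⟨hW0, hWf⟩, hmin⟩ := (wellFounded_lt (α := Submodule F V)).has_min
    {W | W ≠ ⊥ ∧ ∀ i, ∀ v ∈ W, f i v ∈ W} ⟨⊤, top_ne_bot, fun _ _ _ => trivial⟩
  obtain ⟨v, hv, hv0⟩ := Submodule.exists_mem_ne_zero_of_ne_bot hW0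
  refine ⟨v, hv0, fun i => ?_⟩
  have : Nontrivial W := Submodule.nontrivial_iff_ne_bot.mpr hW0
  obtain ⟨c, hc⟩ := Module.End.exists_eigenvalue ((f i).restrict (hWf i))
  obtain ⟨w, hw⟩ := hc.exists_hasEigenvector
  let W' : Submodule F V := W ⊓ Module.End.eigenspace (f i) c
  have hw' : (w : V) ∈ W' := by
    refine ⟨w.2, ?_⟩
    rw [SetLike.mem_coe, Module.End.mem_eigenspace_iff]
    exact congrArg Subtype.val hw.apply_eq_smul
  have hW' : W' = W := by
    by_contra hne
    refine hmin W' ⟨?_, ?_⟩ (lt_of_le_of_ne inf_le_left hne)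
    · intro h
      rw [h, Submodule.mem_bot] at hw'
      exact hw.2 (Subtype.ext hw')
    · rintro j x ⟨hx, hx'⟩
      refine ⟨hWf j x hx, ?_⟩
      rw [SetLike.mem_coe, Module.End.mem_eigenspace_iff] at hx' ⊢
      rw [← Module.End.mul_apply, (hf i j).eq, Module.End.mul_apply, hx', map_smul]
  have h1 : v ∈ W' := hW' ▸ hv
  exact ⟨c, Module.End.mem_eigenspace_iff.mp h1.2⟩

end CommonEigenvector

/-! ### Graded-division algebras are determined by support and commutation factor. -/

section GradedDivisionIsomorphism

variable {F : Type*} [Field F] [IsAlgClosed F] {G : Type*} [AddCommGroup G] [DecidableEq G]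
variable {D : Type*} [Ring D] [Algebra F D] [FiniteDimensional F D]
variable {D' : Type*} [Ring D'] [Algebra F D'] [FiniteDimensional F D']
variable {𝒟 : G × ZMod 2 → Submodule F D} [GradedAlgebra 𝒟]
  {𝒟' : G × ZMod 2 → Submodule F D'} [GradedAlgebra 𝒟']

/-- The degree-preserving linear maps. -/
def gradedHom (𝒟 : G × ZMod 2 → Submodule F D) (𝒟' : G × ZMod 2 → Submodule F D') :
    Submodule F (D →ₗ[F] D') where
  carrier := {f | ∀ g, ∀ x ∈ 𝒟 g, f x ∈ 𝒟' g}
  add_mem' hf hf' g x hx := (𝒟' g).add_mem (hf g x hx) (hf' g x hx)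
  zero_mem' g _ _ := (𝒟' g).zero_mem
  smul_mem' c _ hf g x hx := (𝒟' g).smul_mem c (hf g x hx)

/-- The operator `f ↦ y f(x ·)` on degree-preserving maps. -/
def gradedHomOperator {t : G × ZMod 2} {x : D} {y : D'} (hx : x ∈ 𝒟 t) (hy : y ∈ 𝒟' (-t)) :
    Module.End F (gradedHom 𝒟 𝒟') where
  toFun f := ⟨LinearMap.mulLeft F y ∘ₗ f.1 ∘ₗ LinearMap.mulLeft F x, fun g z hz => by
    have := SetLike.GradedMul.mul_mem hy (f.2 _ _ (SetLike.GradedMul.mul_mem hx hz))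
    rwa [neg_add_cancel_left] at this⟩
  map_add' f f' := by
    ext z
    simp [mul_add]
  map_smul' c f := by
    ext z
    simp

theorem gradedHomOperator_apply {t : G × ZMod 2} {x : D} {y : D'} (hx : x ∈ 𝒟 t)
    (hy : y ∈ 𝒟' (-t)) (f : gradedHom 𝒟 𝒟') (z : D) :
    (gradedHomOperator hx hy f).1 z = y * f.1 (x * z) := rfl

/-- A graded-division algebra over an algebraically closed field is determined by its support and
commutation factor. -/
theorem IsGradedDivision.exists_algEquiv (hD : IsGradedDivision 𝒟) (hD' : IsGradedDivision 𝒟')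
    {T : AddSubgroup (G × ZMod 2)} (γ : T → T → Fˣ)
    (hT : ∀ g, g ∈ T ↔ 𝒟 g ≠ ⊥) (hT' : ∀ g, g ∈ T ↔ 𝒟' g ≠ ⊥)
    (hc : ∀ t s : T, ∀ x ∈ 𝒟 t, ∀ y ∈ 𝒟 s, x * y = γ t s • (y * x))
    (hc' : ∀ t s : T, ∀ x ∈ 𝒟' t, ∀ y ∈ 𝒟' s, x * y = γ t s • (y * x)) :
    ∃ α : D ≃ₐ[F] D', ∀ g, ∀ x ∈ 𝒟 g, α x ∈ 𝒟' g := by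
  have := hD.1
  have := hD'.1
  have hX : ∀ t : T, ∃ x ∈ 𝒟 (t : G × ZMod 2), x ≠ 0 := fun t =>
    Submodule.exists_mem_ne_zero_of_ne_bot ((hT t).mp t.2)
  have hX' : ∀ t : T, ∃ x ∈ 𝒟' (t : G × ZMod 2), x ≠ 0 := fun t =>
    Submodule.exists_mem_ne_zero_of_ne_bot ((hT' t).mp t.2)
  choose X hX hX0 using hX
  choose X' hX' hX0' using hX'
  choose Y hY hXY hYX using fun t => hD'.exists_inv (hX' t) (hX0' t)
  have hspan : ∀ g, ∀ x ∈ 𝒟 g, x = 0 ∨ ∃ (t : T) (c : F), x = c • X t := by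
    intro g x hx
    by_cases h0 : x = 0
    · exact Or.inl h0
    have hg : g ∈ T := (hT g).mpr fun h => h0 (by rwa [h, Submodule.mem_bot] at hx)
    exact Or.inr ⟨⟨g, hg⟩, hD.exists_smul (hX ⟨g, hg⟩) (hX0 _) hx⟩
  have hone : (1 : D) ∈ 𝒟 0 := SetLike.GradedOne.one_mem
  have hone' : (1 : D') ∈ 𝒟' 0 := SetLike.GradedOne.one_mem
  obtain ⟨ℓ, hℓ⟩ := hD.exists_coordinate hone one_ne_zero
  -- This map only serves to show that the space of graded maps is nonzero.
  let f₀ : gradedHom 𝒟 𝒟' := ⟨(ℓ ∘ₗ homComponent 𝒟 0).smulRight (1 : D'), fun g x hx => by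
    rw [LinearMap.smulRight_apply, LinearMap.comp_apply, homComponent_of_mem 0 hx]
    split_ifs with h
    · rw [h]
      exact (𝒟' 0).smul_mem _ hone'
    · rw [map_zero, zero_smul]
      exact (𝒟' g).zero_mem⟩
  have hf₀ : f₀ ≠ 0 := by
    intro h
    have h1 : f₀.1 1 = 0 := by rw [h]; rfl
    change ℓ (homComponent 𝒟 0 1) • (1 : D') = 0 at h1
    rw [homComponent_same hone] at h1
    have h2 := hℓ 1 hone
    rw [(_root_.smul_eq_zero.mp h1).resolve_right one_ne_zero, zero_smul] at h2
    exact one_ne_zero h2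
  have : Nontrivial (gradedHom 𝒟 𝒟') := ⟨f₀, 0, hf₀⟩
  -- A graded isomorphism is an eigenvector of every operator f ↦ X'_t⁻¹ f(X_t ·). These operators
  -- commute because D and D' have the same commutation factor, and a common eigenvector satisfies
  -- f(X_t z) = c_t X'_t f(z).
  obtain ⟨f, hf0, hf⟩ := exists_common_eigenvector (V := gradedHom 𝒟 𝒟')
    (fun t : T => gradedHomOperator (hX t) (hY t)) (by
      intro t s
      apply LinearMap.ext
      intro f
      apply Subtype.ext
      apply LinearMap.ext
      intro z
      rw [Module.End.mul_apply, Module.End.mul_apply, gradedHomOperator_apply,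
        gradedHomOperator_apply, gradedHomOperator_apply, gradedHomOperator_apply, ← mul_assoc,
        ← mul_assoc, ← mul_assoc, ← mul_assoc, hc t s _ (hX t) _ (hX s), smul_mul_assoc,
        map_sgn_smul, mul_smul_comm, ← smul_mul_assoc]
      congr 1
      have h1 : (Y s * Y t) * (X' t * X' s) = 1 := by
        rw [mul_assoc, ← mul_assoc (Y t), hYX, one_mul, hYX]
      have h2 : (X' s * X' t) * (Y t * Y s) = 1 := by
        rw [mul_assoc, ← mul_assoc (X' t), hXY, one_mul, hXY]
      rw [hc' t s _ (hX' t) _ (hX' s), mul_smul_comm, ← smul_mul_assoc] at h1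
      exact (left_inv_eq_right_inv h1 h2).symm)
  choose c hc using hf
  have hfX : ∀ t z, f.1 (X t * z) = c t • (X' t * f.1 z) := by
    intro t z
    have h1 : Y t * f.1 (X t * z) = c t • f.1 z :=
      LinearMap.congr_fun (congrArg Subtype.val (hc t)) z
    rw [← mul_smul_comm, ← h1, ← mul_assoc, hXY, one_mul]
  obtain ⟨a, ha⟩ := hD'.eq_smul_one (f.2 0 1 hone)
  -- The eigenvector relations determine f from f(1). Hence f(1) ≠ 0, and after normalization f(1) =
  -- 1 the same relations say that f is multiplicative.
  have ha0 : a ≠ 0 := by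
    rintro rfl
    apply hf0
    apply Subtype.ext
    apply linearMap_ext_homogeneous 𝒟
    intro g x hx
    rcases hspan g x hx with rfl | ⟨t, k, rfl⟩
    · rw [map_zero, map_zero]
    · rw [map_smul, ← mul_one (X t), hfX, ha]
      simp
  let A : D →ₗ[F] D' := a⁻¹ • f.1
  have hA1 : A 1 = 1 := by
    rw [LinearMap.smul_apply, ha, smul_smul, inv_mul_cancel₀ ha0, one_smul]
  have hAX : ∀ t z, A (X t * z) = c t • (X' t * A z) := by
    intro t z
    rw [LinearMap.smul_apply, hfX, LinearMap.smul_apply, mul_smul_comm, smul_comm]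
  have hAX1 : ∀ t, A (X t) = c t • X' t := by
    intro t
    rw [← mul_one (X t), hAX, hA1, mul_one]
  have hAmul : ∀ x y, A (x * y) = A x * A y := by
    intro x y
    induction x using homogeneous_induction 𝒟 with
    | h0 => simp
    | ha x x' hx hx' => rw [add_mul, map_add, hx, hx', map_add, add_mul]
    | hh g x hx =>
      rcases hspan g x hx with rfl | ⟨t, k, rfl⟩
      · simp
      · rw [smul_mul_assoc, map_smul, hAX, map_smul, hAX1, smul_mul_assoc, smul_mul_assoc]
  have hAgr : ∀ g, ∀ x ∈ 𝒟 g, A x ∈ 𝒟' g := fun g x hx => (𝒟' g).smul_mem _ (f.2 g x hx)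
  have hA0 : ∀ g, ∀ x ∈ 𝒟 g, A x = 0 → x = 0 := by
    intro g x hx h
    by_contra h0
    obtain ⟨y, -, hxy, -⟩ := hD.exists_inv hx h0
    have := hAmul x y
    rw [hxy, hA1, h, zero_mul] at this
    exact one_ne_zero this
  have hsurj : Function.Surjective A := by
    intro y
    induction y using homogeneous_induction 𝒟' with
    | h0 => exact ⟨0, map_zero A⟩
    | ha y y' hy hy' =>
      obtain ⟨x, rfl⟩ := hy
      obtain ⟨x', rfl⟩ := hy'
      exact ⟨x + x', map_add A x x'⟩
    | hh g y hy =>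
      by_cases hy0 : y = 0
      · exact ⟨0, by rw [map_zero, hy0]⟩
      have hg : g ∈ T := (hT' g).mpr fun h => hy0 (by rwa [h, Submodule.mem_bot] at hy)
      obtain ⟨k, rfl⟩ := hD'.exists_smul (hAgr _ _ (hX ⟨g, hg⟩))
        (fun h => hX0 _ (hA0 _ _ (hX ⟨g, hg⟩) h)) hy
      exact ⟨k • X ⟨g, hg⟩, map_smul A _ _⟩
  exact ⟨AlgEquiv.ofBijective (AlgHom.ofLinearMap A hA1 hAmul)
    ⟨injective_of_graded hAgr hA0, hsurj⟩, hAgr⟩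

end GradedDivisionIsomorphism

/-! ### Triples with equal parameters are isometric. -/

section Isometry

variable {F : Type*} [Field F] [IsAlgClosed F] {G : Type*} [AddCommGroup G] [DecidableEq G]
variable {D : Type*} [Ring D] [Algebra F D] [FiniteDimensional F D]
variable {U : Type*} [AddCommGroup U] [Module F U] [Module Dᵐᵒᵖ U] [IsScalarTower F Dᵐᵒᵖ U]
  [FiniteDimensional F U]
variable {D' : Type*} [Ring D'] [Algebra F D'] [FiniteDimensional F D']
variable {U' : Type*} [AddCommGroup U'] [Module F U'] [Module D'ᵐᵒᵖ U'] [IsScalarTower F D'ᵐᵒᵖ U']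
  [FiniteDimensional F U']
variable {𝒟 : G × ZMod 2 → Submodule F D} {𝒰 : G × ZMod 2 → Submodule F U}
  {𝒟' : G × ZMod 2 → Submodule F D'} {𝒰' : G × ZMod 2 → Submodule F U'}
  {B : U →ₗ[F] U →ₗ[F] D} {B' : U' →ₗ[F] U' →ₗ[F] D'}
  {φ₀ : D ≃ₗ[F] D} {b : G × ZMod 2} {δ : Fˣ} {φ₀' : D' ≃ₗ[F] D'}
  [GradedAlgebra 𝒟] [DirectSum.Decomposition 𝒰] [GradedAlgebra 𝒟'] [DirectSum.Decomposition 𝒰']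
  {α : D ≃ₐ[F] D'}

/-- Measuring D_t by X and D'_t by α X turns α into the identity on coordinates, so isometries of
scalar pairings become isometries of B and B'. -/
theorem IsGradedDivision.exists_coordinates (hD : IsGradedDivision 𝒟) (hD' : IsGradedDivision 𝒟')
    (hα : ∀ g, ∀ x ∈ 𝒟 g, α x ∈ 𝒟' g) {t : G × ZMod 2} (ht : 𝒟 t ≠ ⊥) :
    ∃ (X : D) (ℓ : D →ₗ[F] F) (ℓ' : D' →ₗ[F] F), X ∈ 𝒟 t ∧ X ≠ 0 ∧ α X ∈ 𝒟' t ∧ α X ≠ 0 ∧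
      (∀ y ∈ 𝒟 t, y = ℓ y • X) ∧ ∀ y ∈ 𝒟' t, y = ℓ' y • α X := by
  obtain ⟨X, hX, h0⟩ := Submodule.exists_mem_ne_zero_of_ne_bot ht
  have h0' : α X ≠ 0 := fun h => h0 (α.injective (h.trans (map_zero α).symm))
  obtain ⟨ℓ, hℓ⟩ := hD.exists_coordinate hX h0
  obtain ⟨ℓ', hℓ'⟩ := hD'.exists_coordinate (hα _ _ hX) h0'
  exact ⟨X, ℓ, ℓ', hX, h0, hα _ _ hX, h0', hℓ, hℓ'⟩

theorem IsHermitianTriple.exists_component_equiv (H : IsHermitianTriple 𝒟 𝒰 φ₀ b δ B)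
    (H' : IsHermitianTriple 𝒟' 𝒰' φ₀' b δ B') (hα : ∀ g, ∀ x ∈ 𝒟 g, α x ∈ 𝒟' g)
    {g h : G × ZMod 2} (hgh : 𝒟 (b + g + h) ≠ ⊥)
    (hd : Module.finrank F (𝒰 g) = Module.finrank F (𝒰' g)) (a : 𝒰 h ≃ₗ[F] 𝒰' h) :
    ∃ θ : 𝒰 g ≃ₗ[F] 𝒰' g, ∀ (u : 𝒰 g) (v : 𝒰 h), α (B u v) = B' (θ u) (a v) := by
  obtain ⟨X, ℓ, ℓ', hX, h0, hX', h0', hℓ, hℓ'⟩ := H.division.exists_coordinates H'.division hα hgh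
  obtain ⟨θ, hθ⟩ := exists_equiv_of_pairing (componentPairing 𝒰 B ℓ g h)
    (componentPairing 𝒰' B' ℓ' g h) (H.componentPairing_left h0 hX hℓ)
    (H'.componentPairing_left h0' hX' hℓ') (H'.componentPairing_right h0' hX' hℓ') hd a
  refine ⟨θ, fun u v => ?_⟩
  have h1 : ℓ' (B' (θ u) (a v)) = ℓ (B u v) := hθ u v
  rw [hℓ _ (H.sesq.homogeneous _ _ _ u.2 _ v.2), map_smul,
    hℓ' _ (H'.sesq.homogeneous _ _ _ (θ u).2 _ (a v).2), h1]

/-- The sign (-1)^{|g|}ηδ is the same for both forms and makes the two scalar pairings both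
symmetric or both alternating; equal dimensions then suffice. -/
theorem IsHermitianTriple.exists_component_isometry (h2 : (2 : F) ≠ 0)
    (H : IsHermitianTriple 𝒟 𝒰 φ₀ b δ B)
    (H' : IsHermitianTriple 𝒟' 𝒰' φ₀' b δ B') (hα : ∀ g, ∀ x ∈ 𝒟 g, α x ∈ 𝒟' g)
    {g : G × ZMod 2} (hg : 𝒟 (b + 2 • g) ≠ ⊥) {η : Fˣ} (hs : η = 1 ∨ η = -1)
    (hη : ∀ x ∈ 𝒟 (b + 2 • g), φ₀ x = η • x) (hη' : ∀ x ∈ 𝒟' (b + 2 • g), φ₀' x = η • x)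
    (hd : Module.finrank F (𝒰 g) = Module.finrank F (𝒰' g)) :
    ∃ θ : 𝒰 g ≃ₗ[F] 𝒰' g, ∀ u v : 𝒰 g, α (B u v) = B' (θ u) (θ v) := by
  have e : b + 2 • g = b + g + g := by rw [two_nsmul, add_assoc]
  obtain ⟨X, ℓ, ℓ', hX, h0, hX', h0', hℓ, hℓ'⟩ := H.division.exists_coordinates H'.division hα hg
  rw [e] at hX hX' hℓ hℓ'
  have hf : ∀ u v, componentPairing 𝒰 B ℓ g g v u =
      ((sgn F g.2 * η * δ : Fˣ) : F) * componentPairing 𝒰 B ℓ g g u v := by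
    intro u v
    rw [componentPairing_apply, componentPairing_apply, H.flip_self hη u.2 v.2, map_sgn_smul]
    rfl
  have hf' : ∀ u v, componentPairing 𝒰' B' ℓ' g g v u =
      ((sgn F g.2 * η * δ : Fˣ) : F) * componentPairing 𝒰' B' ℓ' g g u v := by
    intro u v
    rw [componentPairing_apply, componentPairing_apply, H'.flip_self hη' u.2 v.2, map_sgn_smul]
    rfl
  have hex : ∃ θ : 𝒰 g ≃ₗ[F] 𝒰' g, ∀ u v, componentPairing 𝒰' B' ℓ' g g (θ u) (θ v) =
      componentPairing 𝒰 B ℓ g g u v := by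
    rcases pm_mul (pm_mul (sgn_eq F g.2) hs) H.sign with h | h
    · apply exists_isometry_of_symm h2 _ _ _ _ (H.componentPairing_left h0 hX hℓ)
        (H'.componentPairing_left h0' hX' hℓ') hd
      · intro u v
        rw [hf v u, h, Units.val_one, one_mul]
      · intro u v
        rw [hf' v u, h, Units.val_one, one_mul]
    · apply exists_isometry_of_alternating _ _ _ _ (H.componentPairing_left h0 hX hℓ)
        (H'.componentPairing_left h0' hX' hℓ') hd
      · intro u
        have h3 := hf u u
        rw [h, Units.val_neg, Units.val_one] at h3
        have h4 : (2 : F) * componentPairing 𝒰 B ℓ g g u u = 0 := by linear_combination h3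
        exact (mul_eq_zero.mp h4).resolve_left h2
      · intro u
        have h3 := hf' u u
        rw [h, Units.val_neg, Units.val_one] at h3
        have h4 : (2 : F) * componentPairing 𝒰' B' ℓ' g g u u = 0 := by linear_combination h3
        exact (mul_eq_zero.mp h4).resolve_left h2
  obtain ⟨θ, hθ⟩ := hex
  refine ⟨θ, fun u v => ?_⟩
  have h1 : ℓ' (B' (θ u) (θ v)) = ℓ (B u v) := hθ u v
  rw [hℓ _ (H.sesq.homogeneous _ _ _ u.2 _ v.2), map_smul,
    hℓ' _ (H'.sesq.homogeneous _ _ _ (θ u).2 _ (θ v).2), h1]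

theorem IsHermitianTriple.isometry_flip (H : IsHermitianTriple 𝒟 𝒰 φ₀ b δ B)
    (H' : IsHermitianTriple 𝒟' 𝒰' φ₀' b δ B')
    (hφ : ∀ x, α (φ₀ x) = φ₀' (α x)) {g h : G × ZMod 2} {u v : U} {u' v' : U'}
    (hu : u ∈ 𝒰 g) (hv : v ∈ 𝒰 h) (hu' : u' ∈ 𝒰' g) (hv' : v' ∈ 𝒰' h)
    (huv : α (B u v) = B' u' v') : α (B v u) = B' v' u' := by
  have hα : ∀ (c : Fˣ) d, α (c • d) = c • α d := map_sgn_smul α.toLinearEquiv.toLinearMap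
  rw [H.flip hu hv, H'.flip hu' hv', hα, hφ, huv]

/-- Isometries between the components of representatives of the cosets of the support. -/
theorem IsHermitianTriple.exists_component_isometries (h2 : (2 : F) ≠ 0)
    (H : IsHermitianTriple 𝒟 𝒰 φ₀ b δ B)
    (H' : IsHermitianTriple 𝒟' 𝒰' φ₀' b δ B') (hα : ∀ g, ∀ x ∈ 𝒟 g, α x ∈ 𝒟' g)
    (hφ : ∀ x, α (φ₀ x) = φ₀' (α x))
    {T : AddSubgroup (G × ZMod 2)} (hT : ∀ g, g ∈ T ↔ 𝒟 g ≠ ⊥) {η : T → Fˣ}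
    (hs : ∀ t, η t = 1 ∨ η t = -1) (hη : ∀ t : T, ∀ x ∈ 𝒟 t, φ₀ x = η t • x)
    (hη' : ∀ t : T, ∀ x ∈ 𝒟' t, φ₀' x = η t • x)
    (hd : ∀ g, Module.finrank F (𝒰 g) = Module.finrank F (𝒰' g))
    {σ : (G × ZMod 2) ⧸ T → G × ZMod 2} (hσ : ∀ x, QuotientAddGroup.mk (σ x) = x) :
    ∃ θ : ∀ x, 𝒰 (σ x) ≃ₗ[F] 𝒰' (σ x), ∀ x y (u : 𝒰 (σ x)) (v : 𝒰 (σ y)),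
      α (B u v) = B' (θ x u) (θ y v) := by
  classical
  -- An arbitrary order selects one coset from each pair {x, dual x}: on the smaller one the
  -- isomorphism is free, on the larger one it is forced, and a self-dual coset needs an isometry.
  let _ : LinearOrder ((G × ZMod 2) ⧸ T) := linearOrderOfSTO WellOrderingRel
  let dual : (G × ZMod 2) ⧸ T → (G × ZMod 2) ⧸ T := fun x => -QuotientAddGroup.mk b - x
  have hdual : ∀ x, dual (dual x) = x := fun x => by simp only [dual]; abel
  have hmk : ∀ x y, 𝒟 (b + σ x + σ y) ≠ ⊥ ↔ y = dual x := by
    intro x y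
    rw [← hT, ← QuotientAddGroup.eq_zero_iff, QuotientAddGroup.mk_add, QuotientAddGroup.mk_add,
      hσ, hσ]
    constructor
    · intro h
      rw [eq_neg_of_add_eq_zero_right h]
      simp only [dual]
      abel
    · rintro rfl
      simp only [dual]
      abel
  let a : ∀ x, 𝒰 (σ x) ≃ₗ[F] 𝒰' (σ x) := fun x => LinearEquiv.ofFinrankEq _ _ (hd (σ x))
  have hex : ∀ x, ∃ θ : 𝒰 (σ x) ≃ₗ[F] 𝒰' (σ x), (x < dual x → θ = a x) ∧
      (dual x < x → ∀ (u : 𝒰 (σ x)) (v : 𝒰 (σ (dual x))),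
        α (B u v) = B' (θ u) (a (dual x) v)) ∧
      (dual x = x → ∀ u v : 𝒰 (σ x), α (B u v) = B' (θ u) (θ v)) := by
    intro x
    rcases lt_trichotomy x (dual x) with h | h | h
    · exact ⟨a x, fun _ => rfl, fun h' => absurd h h'.not_gt, fun h' => absurd h'.symm h.ne⟩
    · have h1 := (hmk x x).mpr h
      rw [add_assoc, ← two_nsmul] at h1
      obtain ⟨θ, hθ⟩ := H.exists_component_isometry h2 H' hα h1 (hs ⟨_, (hT _).mpr h1⟩)
        (hη ⟨_, (hT _).mpr h1⟩) (hη' ⟨_, (hT _).mpr h1⟩) (hd _)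
      exact ⟨θ, fun h' => absurd h h'.ne, fun h' => absurd h h'.ne', fun _ => hθ⟩
    · obtain ⟨θ, hθ⟩ := H.exists_component_equiv H' hα ((hmk x (dual x)).mpr rfl) (hd _)
        (a (dual x))
      exact ⟨θ, fun h' => absurd h h'.not_gt, fun _ => hθ, fun h' => absurd h' h.ne⟩
  choose θ h1 h2 h3 using hex
  have hgt : ∀ x, dual x < x → ∀ (u : 𝒰 (σ x)) (v : 𝒰 (σ (dual x))),
      α (B u v) = B' (θ x u) (θ (dual x) v) := by
    intro x h u v
    rw [h1 (dual x) (by rwa [hdual])]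
    exact h2 x h u v
  refine ⟨θ, fun x y u v => ?_⟩
  by_cases hy : y = dual x
  · rcases lt_trichotomy x (dual x) with h | h | h
    · have hx : x = dual y := by rw [hy, hdual]
      rw [← hy] at h
      subst hx
      -- The order of the two arguments is reversed by Hermitian symmetry.
      exact H.isometry_flip H' hφ v.2 u.2 (θ _ v).2 (θ _ u).2 (hgt y h v u)
    · have hyx := hy.trans h.symm
      subst hyx
      exact h3 y hy.symm u v
    · subst hy
      exact hgt x h u v
  -- Components of cosets that are not dual to each other are orthogonal for both forms.
  · have hbot : 𝒟 (b + σ x + σ y) = ⊥ := by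
      by_contra h
      exact hy ((hmk x y).mp h)
    have h4 := H.sesq.homogeneous _ _ _ u.2 _ v.2
    have h5 := symm_mem_of_graded α.toLinearEquiv hα _ _
      (H'.sesq.homogeneous _ _ _ (θ x u).2 _ (θ y v).2)
    rw [hbot, Submodule.mem_bot] at h4 h5
    rw [h4, map_zero]
    exact (α.symm.injective (h5.trans (map_zero α.symm).symm)).symm

/-- A family of isomorphisms between the components of representatives of the cosets of the
support extends to an isomorphism of pairs. -/
theorem exists_pairEquiv_of_components (hD : IsGradedDivision 𝒟) (hU : IsGradedRightModule 𝒟 𝒰)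
    (hD' : IsGradedDivision 𝒟') (hU' : IsGradedRightModule 𝒟' 𝒰')
    (hα : ∀ g, ∀ x ∈ 𝒟 g, α x ∈ 𝒟' g) {T : AddSubgroup (G × ZMod 2)}
    (hT : ∀ g, g ∈ T ↔ 𝒟 g ≠ ⊥) (hT' : ∀ g, g ∈ T ↔ 𝒟' g ≠ ⊥)
    {σ : (G × ZMod 2) ⧸ T → G × ZMod 2} (hσ : ∀ x, QuotientAddGroup.mk (σ x) = x)
    (θ : ∀ x, 𝒰 (σ x) ≃ₗ[F] 𝒰' (σ x)) :
    ∃ Θ : U ≃ₗ[F] U', IsGradedPairEquiv 𝒟 𝒰 𝒟' 𝒰' α Θ ∧ ∀ x (u : 𝒰 (σ x)), Θ u = θ x u := by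
  let e := fun x => Module.finBasis F (𝒰 (σ x))
  let E := homogeneousBasis hD hU hT hσ e
  let E' := homogeneousBasis hD' hU' hT' hσ fun x => (e x).map (θ x)
  -- The extension matches the basis vectors through θ and applies α to the coordinates.
  let m : (_ →₀ Dᵐᵒᵖ) ≃ₗ[F] (_ →₀ D'ᵐᵒᵖ) :=
    Finsupp.mapRange.linearEquiv (α := Σ x, Fin (Module.finrank F (𝒰 (σ x))))
      (AlgEquiv.op α).toLinearEquiv
  let Θ : U ≃ₗ[F] U' := (E.repr.restrictScalars F).trans
    (m.trans (E'.repr.restrictScalars F).symm)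
  have hΘ : ∀ u, Θ u = E'.repr.symm (m (E.repr u)) := fun u => rfl
  have hm : ∀ i f, m f i = op (α (unop (f i))) := fun i f => rfl
  have hsemi : ∀ u d, Θ (op d • u) = op (α d) • Θ u := by
    intro u d
    rw [hΘ, hΘ, ← map_smul E'.repr.symm, map_smul]
    congr 1
    ext i
    rw [hm, Finsupp.smul_apply, Finsupp.smul_apply, hm, smul_eq_mul, smul_eq_mul, unop_mul,
      map_mul, op_mul, unop_op]
  have hE : ∀ i, Θ (E i) = E' i := by
    intro i
    rw [hΘ, Module.Basis.repr_self, LinearEquiv.symm_apply_eq, Module.Basis.repr_self]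
    classical
    ext j
    rw [hm, Finsupp.single_apply, Finsupp.single_apply]
    split_ifs <;> simp
  have hΘθ : ∀ x (u : 𝒰 (σ x)), Θ u = θ x u := by
    intro x u
    have : Θ.toLinearMap ∘ₗ (𝒰 (σ x)).subtype = (𝒰' (σ x)).subtype ∘ₗ (θ x).toLinearMap := by
      apply (e x).ext
      intro i
      have h1 := hE ⟨x, i⟩
      rw [homogeneousBasis_apply, homogeneousBasis_apply, Module.Basis.map_apply] at h1
      exact h1
    exact LinearMap.congr_fun this u
  refine ⟨Θ, ⟨hα, ?_, hsemi⟩, hΘθ⟩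
  intro g u hu
  obtain ⟨d, hd, -, v, hv, rfl⟩ := hU.exists_factor hD hT (hσ (QuotientAddGroup.mk g)).symm hu
  rw [hsemi, hΘθ _ ⟨v, hv⟩]
  have := hU' _ _ _ (θ _ ⟨v, hv⟩).2 _ (hα _ _ hd)
  rwa [add_sub_cancel] at this

/-- Triples with the same parameters are isometric. -/
theorem HasParameters.exists_isometry (h2 : (2 : F) ≠ 0)
    (hD : IsGradedDivision 𝒟) (hU : IsGradedRightModule 𝒟 𝒰) (hB : IsNondegenerate B)
    (hD' : IsGradedDivision 𝒟') (hU' : IsGradedRightModule 𝒟' 𝒰') (hB' : IsNondegenerate B')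
    {P : Parameters F G} (hP : HasParameters 𝒟 𝒰 B P) (hP' : HasParameters 𝒟' 𝒰' B' P) :
    ∃ (α : D ≃ₐ[F] D') (θ : U ≃ₗ[F] U'), IsGradedPairEquiv 𝒟 𝒰 𝒟' 𝒰' α θ ∧
      ∀ u v, α (B u v) = B' (θ u) (θ v) := by
  obtain ⟨φ₀, H, hη⟩ := hP.exists_triple hD hU hB
  obtain ⟨φ₀', H', hη'⟩ := hP'.exists_triple hD' hU' hB'
  obtain ⟨α, hα⟩ := hD.exists_algEquiv hD' _ hP.support hP'.support hP.commutation hP'.commutation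
  have hα' : ∀ (c : Fˣ) d, α (c • d) = c • α d := map_sgn_smul α.toLinearEquiv.toLinearMap
  -- Both anti-automorphisms act on the component of degree g by the same scalar η(g).
  have hφ : ∀ x, α (φ₀ x) = φ₀' (α x) := by
    intro x
    induction x using homogeneous_induction 𝒟 with
    | h0 => simp
    | ha x y hx hy => simp only [map_add, hx, hy]
    | hh g x hx =>
      by_cases h0 : x = 0
      · simp [h0]
      have hg : g ∈ P.T := (hP.support g).mpr fun h => h0 (by rwa [h, Submodule.mem_bot] at hx)
      rw [hη ⟨g, hg⟩ x hx, hη' ⟨g, hg⟩ _ (hα g x hx), hα']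
  have hd : ∀ g, Module.finrank F (𝒰 g) = Module.finrank F (𝒰' g) := fun g =>
    (hP.κ_mk hD hU g).symm.trans (hP'.κ_mk hD' hU' g)
  have hσ : ∀ x : (G × ZMod 2) ⧸ P.T, QuotientAddGroup.mk (Quotient.out x) = x := Quotient.out_eq
  obtain ⟨θ, hθ⟩ := H.exists_component_isometries h2 H' hα hφ hP.support P.inertia.η_sign hη hη' hd
    hσ
  obtain ⟨Θ, E, hΘ⟩ := exists_pairEquiv_of_components hD hU hD' hU' hα hP.support hP'.support hσ θ
  refine ⟨α, Θ, E, fun u v => ?_⟩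
  induction u using homogeneous_induction 𝒰 with
  | h0 => simp
  | ha u w hu hw => simp only [map_add, LinearMap.add_apply, hu, hw]
  | hh g u hu =>
    induction v using homogeneous_induction 𝒰 with
    | h0 => simp
    | ha u w hu hw => simp only [map_add, hu, hw]
    | hh h v hv =>
      -- Sesquilinearity reduces the comparison to the representative components, where it holds by
      -- construction.
      obtain ⟨d, hd, -, x, hx, rfl⟩ :=
        hU.exists_factor hD hP.support (hσ (QuotientAddGroup.mk g)).symm hu
      obtain ⟨d', -, -, y, hy, rfl⟩ :=
        hU.exists_factor hD hP.support (hσ (QuotientAddGroup.mk h)).symm hv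
      rw [E.semilinear, E.semilinear, H.sesq.smul_right, H'.sesq.smul_right,
        H.sesq.smul_left _ _ x hx d hd, H'.sesq.smul_left _ _ _ (E.module_mem _ _ hx) _ (hα _ _ hd),
        map_mul, hα', map_mul, hφ]
      have h3 := hθ _ _ ⟨x, hx⟩ ⟨y, hy⟩
      rw [← hΘ, ← hΘ] at h3
      rw [h3]

/-- Triples with parameters in the same orbit have isomorphic superalgebras with superadjunction. -/
theorem HasParameters.isomorphic_of_eq_act (h2 : (2 : F) ≠ 0)
    (hD : IsGradedDivision 𝒟) (hU : IsGradedRightModule 𝒟 𝒰) (hB : IsNondegenerate B)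
    (hD' : IsGradedDivision 𝒟') (hU' : IsGradedRightModule 𝒟' 𝒰') (hB' : IsNondegenerate B')
    {T : AddSubgroup (G × ZMod 2)} {β : SuperBicharacter F T} {q : Inertia T β} {t : T}
    {s : G × ZMod 2} (hP : HasParameters 𝒟 𝒰 B ⟨T, β, q⟩)
    (hP' : HasParameters 𝒟' 𝒰' B' ⟨T, β, Inertia.actT t (Inertia.actG s q)⟩)
    {φ : Module.End Dᵐᵒᵖ U ≃ₗ[F] Module.End Dᵐᵒᵖ U}
    {φ' : Module.End D'ᵐᵒᵖ U' ≃ₗ[F] Module.End D'ᵐᵒᵖ U'}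
    (hφ : IsSuperadjunction 𝒰 B φ) (hφ' : IsSuperadjunction 𝒰' B' φ') :
    IsomorphicSuper (endGrading 𝒰) φ (endGrading 𝒰') φ' := by
  obtain ⟨d, hd, hd0⟩ := Submodule.exists_mem_ne_zero_of_ne_bot ((hP.support t).mp t.2)
  have hP₁ := (hP.shift hU s).twist t hd
  have hn := twistForm_nondegenerate hD (shiftForm_nondegenerate (𝒰 := 𝒰) s hB) hd hd0
  obtain ⟨α, θ, E, hE⟩ := hP₁.exists_isometry h2 hD (hU.shift s) hn hD' hU' hB' hP'
  obtain ⟨φ₁, H₁, -⟩ := hP₁.exists_triple hD (hU.shift s) hn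
  obtain ⟨φ₁', H₁', -⟩ := hP'.exists_triple hD' hU' hB'
  have := IsSuperadjunction.isomorphic E hE H₁ H₁' ((hφ.shift s).twist d) hφ'
  rwa [show endGrading (D := D) (shiftGrading s 𝒰) = endGrading 𝒰 from
    funext fun g => endGrading_shift s g] at this

end Isometry

end GrSuper

/-! ### The classification theorem. -/

open GrSuper
theorem mainTheorem10
    {F : Type*} [Field F] [IsAlgClosed F] (hF : ringChar F ≠ 2)
    {G : Type*} [AddCommGroup G] [DecidableEq G]
    -- the first triple `(D, U, B)`
    {D : Type*} [Ring D] [Algebra F D] [FiniteDimensional F D]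
    (𝒟 : G × ZMod 2 → Submodule F D) [GradedAlgebra 𝒟] (hD : IsGradedDivision 𝒟)
    {U : Type*} [AddCommGroup U] [Module F U] [Module Dᵐᵒᵖ U] [IsScalarTower F Dᵐᵒᵖ U]
    [Nontrivial U] [Module.Finite Dᵐᵒᵖ U]
    (𝒰 : G × ZMod 2 → Submodule F U) [DirectSum.Decomposition 𝒰]
    (hU : IsGradedRightModule 𝒟 𝒰)
    (B : U →ₗ[F] U →ₗ[F] D) (hB : IsNondegenerateHermitianForm 𝒟 𝒰 B)
    -- the second triple `(D', U', B')`
    {D' : Type*} [Ring D'] [Algebra F D'] [FiniteDimensional F D']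
    (𝒟' : G × ZMod 2 → Submodule F D') [GradedAlgebra 𝒟'] (hD' : IsGradedDivision 𝒟')
    {U' : Type*} [AddCommGroup U'] [Module F U'] [Module D'ᵐᵒᵖ U'] [IsScalarTower F D'ᵐᵒᵖ U']
    [Nontrivial U'] [Module.Finite D'ᵐᵒᵖ U']
    (𝒰' : G × ZMod 2 → Submodule F U') [DirectSum.Decomposition 𝒰']
    (hU' : IsGradedRightModule 𝒟' 𝒰')
    (B' : U' →ₗ[F] U' →ₗ[F] D') (hB' : IsNondegenerateHermitianForm 𝒟' 𝒰' B') :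
    -- the superadjunctions, hence `E(D, U, B)` and `E(D', U', B')`, are well defined
    (∃! φ, IsSuperadjunction 𝒰 B φ) ∧ (∃! φ', IsSuperadjunction 𝒰' B' φ') ∧
    -- the parameters of the two triples are well defined
    (∃! P, HasParameters 𝒟 𝒰 B P) ∧ (∃! P', HasParameters 𝒟' 𝒰' B' P') ∧
    -- the classification
    ∀ φ φ' P P', IsSuperadjunction 𝒰 B φ → IsSuperadjunction 𝒰' B' φ' →
      HasParameters 𝒟 𝒰 B P → HasParameters 𝒟' 𝒰' B' P' →
      (IsomorphicSuper (endGrading 𝒰) φ (endGrading 𝒰') φ' ↔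
        ∃ (T : AddSubgroup (G × ZMod 2)) (β : SuperBicharacter F T) (q q' : Inertia T β),
          P = ⟨T, β, q⟩ ∧ P' = ⟨T, β, q'⟩ ∧
            q' ∈ AddAction.orbit (T × (G × ZMod 2)) q) := by
  have h2 : (2 : F) ≠ 0 := Ring.two_ne_zero hF
  -- Finite rank over the finite-dimensional algebra D gives finite dimension over F, on which the
  -- dimension counts rest.
  have : FiniteDimensional F U := Module.Finite.trans Dᵐᵒᵖ U
  have : FiniteDimensional F U' := Module.Finite.trans D'ᵐᵒᵖ U'
  obtain ⟨hn, φ₀, b, δ, h1, h3, h4, h5⟩ := hB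
  obtain ⟨hn', φ₀', b', δ', h1', h3', h4', h5'⟩ := hB'
  have H : IsHermitianTriple 𝒟 𝒰 φ₀ b δ B := ⟨hD, hU, h1, h3, h4, h5, hn⟩
  have H' : IsHermitianTriple 𝒟' 𝒰' φ₀' b' δ' B' := ⟨hD', hU', h1', h3', h4', h5', hn'⟩
  obtain ⟨Q, hQ⟩ := H.exists_parameters h2
  obtain ⟨Q', hQ'⟩ := H'.exists_parameters h2
  refine ⟨H.existsUnique_superadjunction, H'.existsUnique_superadjunction,
    ⟨Q, hQ, fun P hP => hP.unique hD hn hQ⟩, ⟨Q', hQ', fun P hP => hP.unique hD' hn' hQ'⟩, ?_⟩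
  intro φ φ' P P' hφ hφ' hP hP'
  constructor
  · intro hiso
    obtain ⟨T, β, q⟩ := P
    obtain ⟨t, s, rfl⟩ := hP.eq_act_of_isomorphic hD hU hn hD' hU' hn' hP' hφ hφ' hiso
    exact ⟨T, β, q, _, rfl, rfl, ⟨(t, s), rfl⟩⟩
  · rintro ⟨T, β, q, _, rfl, rfl, ⟨⟨t, s⟩, rfl⟩⟩
    exact hP.isomorphic_of_eq_act h2 hD hU hn hD' hU' hn' hP' hφ hφ'
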